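/- Notation. $Y=(y^\alpha,\bar y^{\dot\alpha})$ ($\alpha,\dot\alpha\in\{1,2\}$) are commuting spinor variables, $p_\alpha=-i\partial/\partial y^\alpha$, indices are moved with $\epsilon_{\alpha\beta}$, $(ab)=a_\alpha b^\alpha$; $k,\bar k$ are the exterior Klein operators ($k$ anticommutes with $y$, $\bar k$ with $\bar y$, $k^2=\bar k^2=1$, $[k,\bar k]=0$), $K=(k,\bar k)$; fields take values in an associative colour algebra; $h^{\alpha\dot\alpha}$ is the background vierbein, $D_L=h^{\alpha\dot\alpha}D_{\alpha\dot\alpha}$ the Lorentz covariant derivative, $D(u,\bar u)=u^\alpha\bar u^{\dot\alpha}D_{\alpha\dot\alpha}$, $h(a,\bar a)=h_{\alpha\dot\alpha}a^\alpha\bar a^{\dot\alpha}$, $\bar H(\bar a,\bar b)=\frac12h_{\gamma\dot\alpha}h^{\gamma}{}_{\dot\beta}\bar a^{\dot\alpha}\bar b^{\dot\beta}$. $f_{m,n}$ is the part of $f(Y)$ of degree $m$ in $y$ and $n$ in $\bar y$; c.c. exchanges dotted and undotted spinors, $k$ and $\bar k$, $\eta$ and $\bar\eta$. Spins are nonnegative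 integers or half-integers, $[s]$ is the integer part and $\{s\}=s-[s]$. Fields. A Fronsdal field of spin $s$ is $\phi_{s+\{s\},s-\{s\}}$, $\phi_{s-\{s\},s+\{s\}}$ (equal for bosons). The spin-$s$ master fields are the one-form $\omega=\sum_{a+b=2s-2}\omega_{a,b}$ with $\omega_{a,b}=-h(p,\bar p)\phi_{a+1,b+1}$, and the zero-form $C=\sum_{n\ge0}(C_{2s+n,n}+C_{n,2s+n})$, where, up to numerical coefficients, $\phi_{s+\{s\}+m,s-\{s\}-m}=D^m(y,\bar p)\phi_{s+\{s\},s-\{s\}}$, $C_{2s+n,n}=D^n(y,\bar y)D^{[s]}(y,\bar p)\phi_{s+\{s\},s-\{s\}}\bar k$, and the conjugate formulae hold. A component of bidegree $(a,b)$ has helicity of positive (negative) sign if $a\ge b$ ($a\le b$). Vertices. With all expressions evaluated at $Y_1=Y_2=0$, $$\Upsilon(\omega,\omega)=-e^{-i(p_1p_2)+i(p_1y)+i(p_2y)-i(\bar p_1\bar p_2)+i(\bar p_1\bar y)+i(\bar p_2\bar y)}\,\omega(Y_1;K)\omega(Y_2;K),$$ $$\Upsilon(\Omega,\omega,C)=-\tfrac{i\eta}2\int_0^1\!dt\,h(p_1,t\bar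 p_1+\bar p_2)\,e^{-it(p_1p_2)+i(1-t)(p_1y)-i(\bar p_1\bar p_2)+i(\bar p_1\bar y)+i(\bar p_2\bar y)}\big[\omega(Y_1;K)C(Y_2;K)-e^{-2i(\bar p_1\bar y)}C(Y_2;K)\omega(-Y_1;K)\big]k+c.c.,$$ $$\Upsilon(\Omega,\Omega,C,C)=-\tfrac{i\eta\bar\eta}4\int\!\frac{d^4t}{t_4^2}\delta(1-t_3-t_4)\delta'(1-t_1-t_2)\bar H(\bar p,\bar p)\,e^{it_1(p_1y)-it_2(p_2y)-it_3(\bar p_1\bar p_2)+it_2t_4(\bar p_1\bar y)-it_1t_4(\bar p_2\bar y)}\,C(Y_1;K)C(Y_2;K)k\bar k+c.c.$$ (integral over $t_i\ge 0$), $$\Upsilon(\omega,C)=-e^{-i(p_1p_2)+i(p_1y)+i(p_2y)-i(\bar p_1\bar p_2)+i(\bar p_1\bar y)+i(\bar p_2\bar y)}\big[\omega(Y_1;K)C(Y_2;K)-C(Y_1;K)\omega(Y_2;K)\big],$$ $$\Upsilon(\Omega,C,C)=\tfrac{i\eta}2\int_0^1\!dt\,h(y,(1-t)\bar p_1-t\bar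 p_2)\,e^{it(p_1y)-i(1-t)(p_2y)-i(\bar p_1\bar p_2)+i(\bar p_1\bar y)+i(\bar p_2\bar y)}\,C(Y_1;K)C(Y_2;K)k+c.c.$$ Currents. Let $\Upsilon_{m,n}(u,v|Y)$ and $\Upsilon_{m,n}(\bar u,\bar v|Y)$ be the contractions with $u^\alpha v^\beta$, $\bar u^{\dot\alpha}\bar v^{\dot\beta}$ of the coefficients of $h^{\alpha}{}_{\dot\gamma}h^{\beta\dot\gamma}$ and $h_\gamma{}^{\dot\alpha}h^{\gamma\dot\beta}$ in a two-form $\Upsilon_{m,n}$, and $\Upsilon_{m,n}(u,\bar v|Y)$ the contraction of the coefficient of $h^{\alpha\dot\alpha}$ in a one-form. The Fronsdal current of spin $s_1$ is, in the one-form sector, for integer $s_1=s\ge1$, $$J_{s,s}=\tfrac1{2s}\Upsilon_{s,s-2}(\bar y,\bar y|Y)+\tfrac{i}{2s^2(s+1)}\big[D(p,\bar y)\Upsilon_{s-1,s-1}(y,y|Y)+sD(y,\bar y)\Upsilon_{s-1,s-1}(y,p|Y)\big]+c.c.$$ (without the first term if $s=1$) and, for $s\ge2$, $$J_{s-2,s-2}=\tfrac12\Upsilon_{s,s-2}(p,p|Y)+\tfrac{i}{2s(s-1)}\big[D(p,\bar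 y)\Upsilon_{s-1,s-1}(\bar p,\bar p|Y)-sD(p,\bar p)\Upsilon_{s-1,s-1}(\bar y,\bar p|Y)\big]+c.c.;$$ for half-integer $s_1=s\ge3/2$, with $\Upsilon=\Upsilon_{s-1/2,s-3/2}$, it consists of $\frac1{s-1/2}\Upsilon(\bar y,\bar y|Y)$, $-\frac1{s+1/2}\Upsilon(p,p|Y)$, $-i\frac{s^2-1/4}{2s}\big[(s+\frac12)\Upsilon(y,p|Y)+(s-\frac12)\Upsilon(\bar y,\bar p|Y)\big]$ and their conjugates. In the zero-form sector it is $-\frac12[i\Upsilon_{1,1}(p,\bar p|Y)-D(p,\bar p)\Upsilon_{0,0}(y,\bar y|0)]$ for $s_1=0$, $\Upsilon_{0,1}(y,\bar p|0,\bar y)$ and its conjugate for $s_1=\frac12$, $-\frac\eta4\Upsilon_{0,2}(y,\bar p|0,\bar y)+c.c.$ for $s_1=1$. Let the two factors of a vertex (in this order) have spins $s_2,s_3$, and let $\mathcal S=[s_1]+[s_2]+[s_3]$. The number $\#_{der}$ of derivatives of a term is the number of symbols $D$ in it after $\omega$, $C$ have been expressed through the Fronsdal fields. Theorem. (0) For one-forms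 of spins $s_2,s_3$ the spin-$s_1$ part (total degree $2s_1-2$ in $Y$) of $\Upsilon(\omega,\omega)$ vanishes unless the triangle inequalities $$s_1+s_2\ge s_3+1,\qquad s_1+s_3\ge s_2+1,\qquad s_2+s_3\ge s_1+1\tag{T}$$ hold. (1) One-form sector. In each case, the vertex contributes to the Fronsdal current only in the cases listed, and all terms of the contribution satisfy the condition given. $\Upsilon(\omega,\omega)$: only if (T) holds; $\#_{der}\le\mathcal S-2s_1$ if the helicities of the factors have the same sign, $\#_{der}\le\mathcal S-2\max\{s_2,s_3\}$ if they have opposite signs. $\Upsilon(\Omega,\omega,C)$ (either order of $\omega$, $C$): under (T), $\#_{der}\le\mathcal S-2\min\{s_1,s_2,s_3\}$; if $s_2=s_1+s_3$, $\#_{der}\le\mathcal S-2\min\{s_1,s_3\}$; if $s_3=s_1+s_2$, $\#_{der}\le\mathcal S-2\min\{s_1,s_2\}$; if $s_2>s_1+s_3$, $\#_{der}\le\mathcal S$ for equal and $\#_{der}\le\mathcal S-2\min\{s_1,s_3\}$ for opposite signs of the helicities; if $s_3>s_1+s_2$, $\#_{der}\le\mathcal S$ for equal and $\#_{der}\le\mathcal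 S-2\min\{s_1,s_2\}$ for opposite signs. $\Upsilon(\Omega,\Omega,C,C)$: for equal signs of the helicities only if (T), $s_2=s_1+s_3$, $s_3=s_1+s_2$ or $s_1\ge s_2+s_3$ holds, with $\#_{der}=\mathcal S$; for opposite signs only if $s_1\ge s_2+s_3$, with $\#_{der}=\mathcal S-2\min\{s_2,s_3\}$. The complete currents (all helicities) contain only the terms so allowed. In particular, under (T) the current from $\Upsilon(\omega,\omega)+\Upsilon(\Omega,\omega,C)$ has $\#_{der}\le\mathcal S-2\min\{s_1,s_2,s_3\}$ and the current from $\Upsilon(\Omega,\Omega,C,C)$ has $\#_{der}=\mathcal S$. (2) Zero-form sector, $s_1\in\{0,\frac12,1\}$. Every term contributed by $\Upsilon(\omega,C)$ (either order) satisfies one of: $s_1\in\{\frac12,1\}$, $s_2+s_3\ge s_1+1$ and $\#_{der}=\mathcal S-2\min\{s_1,s_2,s_3\}$; or $|s_2-s_3|\ge s_1+1$ and $\#_{der}=\mathcal S$; or $s_1=1$, $s_2+s_3\ge 2$, the spin of $C$ is $0$ or $\frac12$, and $\#_{der}=\mathcal S-2$. Every term contributed by $\Upsilon(\Omega,C,C)$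 satisfies one of: $s_1\in\{\frac12,1\}$, $s_2+s_3\le s_1$ and $\#_{der}=\mathcal S-2\min\{s_1,s_2,s_3\}$; or $s_1\in\{\frac12,1\}$, $|s_2-s_3|\le s_1$ and $\#_{der}=\mathcal S$; or $s_1=0$, $|s_2-s_3|\le1$, $s_2+s_3\ge1$ and $\#_{der}=[s_2]+[s_3]$. -/

import Mathlib

namespace HigherSpin

open scoped ContDiff

noncomputable section

/-! ### Space-time functions -/

/-- Coordinates of a four-dimensional space-time patch. -/
abbrev SpaceTime := Fin 4 → ℝ

/-- Smooth functions on the patch with values in the (associative, possibly noncommutative)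
colour algebra `A`. -/
def SmoothFun (A : Type*) [NormedRing A] [NormedAlgebra ℂ A] :
    Subalgebra ℂ (SpaceTime → A) where
  carrier := {f | ContDiff ℝ ∞ f}
  mul_mem' hf hg := by
    simp only [Set.mem_ofPred_eq] at hf hg ⊢
    exact hf.mul hg
  add_mem' hf hg := by
    simp only [Set.mem_ofPred_eq] at hf hg ⊢
    exact hf.add hg
  algebraMap_mem' c := by
    change ContDiff ℝ ∞ fun _ : SpaceTime => algebraMap ℂ A c
    exact contDiff_const

variable {A : Type*} [NormedRing A] [NormedAlgebra ℂ A]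

/-- The coordinate derivative `∂/∂xⁿ`. -/
def pdX (n : Fin 4) (f : SmoothFun A) : SmoothFun A :=
  ⟨fun x => fderiv ℝ f.1 x (Pi.single n 1),
    (ContDiff.fderiv_right (m := ∞) (show ContDiff ℝ ∞ f.1 from f.2) (by simp)).clm_apply
      contDiff_const⟩

/-- Product of a complex function and an `A`-valued function. -/
def scal (g : SmoothFun ℂ) (f : SmoothFun A) : SmoothFun A :=
  ⟨fun x => g.1 x • f.1 x, ContDiff.smul (show ContDiff ℝ ∞ g.1 from g.2) (show ContDiff ℝ ∞ f.1 from f.2)⟩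

/-! ### Generating functions

`true` labels undotted spinors and `false` dotted ones, so complex conjugation of formulae is the
exchange `χ ↔ !χ`. -/

/-- The four commuting variables `y^α = (true, α)` and `ȳ^α̇ = (false, α̇)`. -/
abbrev Var := Bool × Fin 2

/-- Exponents of monomials in `Y = (y, ȳ)`. -/
abbrev Expo := Var →₀ ℕ

/-- Degree in the undotted (`χ = true`) or dotted (`χ = false`) variables. -/
def deg (χ : Bool) (μ : Expo) : ℕ := ∑ a, μ (χ, a)

/-- Words `k^i k̄^j` in the exterior Klein operators: `κ true = i`, `κ false = j`. -/
abbrev Klein := Bool → ZMod 2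

variable (A) in
/-- Formal power series `f(Y; K | x)`: for every monomial of `Y` and every Klein word a function
of `x` with values in `A`; Klein operators are written to the right. -/
abbrev Gen := Expo → Klein → SmoothFun A

/-- The function of chirality with value `u` at `χ` and `v` at `!χ`. -/
def pair {T : Type*} (χ : Bool) (u v : T) : Bool → T := fun c => if c = χ then u else v

/-- `f_{m,n}(Y)`: the part of degree `m true` in `y` and `m false` in `ȳ`. -/
def comp (m : Bool → ℕ) (f : Gen A) : Gen A :=
  fun μ => if ∀ χ, deg χ μ = m χ then f μ else 0

/-- The part of nonnegative (`τ = true`) or nonpositive (`τ = false`) helicity: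
`deg y ≥ deg ȳ`, respectively `deg y ≤ deg ȳ`. -/
def helPart (τ : Bool) (f : Gen A) : Gen A :=
  fun μ => if deg (!τ) μ ≤ deg τ μ then f μ else 0

/-- `f(-Y)`. -/
def reflect (f : Gen A) : Gen A := fun μ => (-1 : ℂ) ^ (deg true μ + deg false μ) • f μ

/-- `f k` for `χ = true` and `f k̄` for `χ = false`. -/
def mulK (χ : Bool) (f : Gen A) : Gen A := fun μ κ => f μ (κ - Pi.single χ 1)

/-- The antisymmetric symbol, `ε 0 1 = 1`; it is both `ε_{αβ}` and `ε^{αβ}`. -/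
def eps (a b : Fin 2) : ℂ := !![0, 1; -1, 0] a b

/-- `∂/∂y^α` or `∂/∂ȳ^α̇`. -/
def pdY (v : Var) (f : Gen A) : Gen A :=
  fun μ => ((μ v : ℂ) + 1) • f (μ + Finsupp.single v 1)

/-- Multiplication by `y^α` or `ȳ^α̇`. -/
def mulY (v : Var) (f : Gen A) : Gen A :=
  fun μ => if μ v = 0 then 0 else f (μ - Finsupp.single v 1)

/-- The spinor operators with upper index: `y^α`, and `p^α = ε^{αβ} p_β` with
`p_β = -i ∂/∂y^β`. -/
inductive Slot
  | y
  | p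

/-- `y^a` or `p^a` of chirality `χ`, acting on everything to the right. -/
def Slot.act (s : Slot) (χ : Bool) (a : Fin 2) (f : Gen A) : Gen A :=
  match s with
  | .y => mulY (χ, a) f
  | .p => ∑ b, (eps a b * (-Complex.I)) • pdY (χ, b) f

/-! ### Background and Lorentz covariant derivative -/

/-- A background: vierbein `h^{αα̇} = dxⁿ h_n^{αα̇}` with its inverse `e^n_{αα̇}`, and a Lorentz
connection `ϖ_{αβ}` (`χ = true`), `ϖ̄_{α̇β̇}` (`χ = false`). A pair `(α, α̇)` is a function `ι`
with `ι true = α`, `ι false = α̇`. -/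
structure Background where
  /-- `h_n^{αα̇}` -/
  h : Fin 4 → (Bool → Fin 2) → SmoothFun ℂ
  /-- `e^n_{αα̇}` -/
  e : Fin 4 → (Bool → Fin 2) → SmoothFun ℂ
  /-- `ϖ_{n αβ}` and `ϖ̄_{n α̇β̇}` -/
  conn : Fin 4 → Bool → Fin 2 → Fin 2 → SmoothFun ℂ
  e_h : ∀ ι ι', ∑ n, e n ι * h n ι' = if ι = ι' then 1 else 0
  h_e : ∀ n n', ∑ ι, h n ι * e n' ι = if n = n' then 1 else 0
  conn_symm : ∀ n χ a b, conn n χ a b = conn n χ b a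

/-- Product of a function of `x` and a generating function. -/
def scalG (g : SmoothFun ℂ) (f : Gen A) : Gen A := fun μ κ => scal g (f μ κ)

/-- The components `D_n = ∂_n + i ϖ_{n αβ} y^α p^β + i ϖ̄_{n α̇β̇} ȳ^α̇ p̄^β̇` of the Lorentz
covariant derivative `D_L`. -/
def Background.lorentz (bg : Background) (n : Fin 4) (f : Gen A) : Gen A :=
  (fun μ κ => pdX n (f μ κ)) +
    ∑ χ, ∑ a, ∑ b, Complex.I • scalG (bg.conn n χ a b) (Slot.y.act χ a (Slot.p.act χ b f))

/-- The frame components `D_{αα̇}`, defined by `D_L = h^{αα̇} D_{αα̇}`. -/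
def Background.covD (bg : Background) (ι : Bool → Fin 2) (f : Gen A) : Gen A :=
  ∑ n, scalG (bg.e n ι) (bg.lorentz n f)

/-- `lam D(u, ū) = lam u^α ū^α̇ D_{αα̇}` with `u` of chirality `χ` and `ū` of chirality `!χ`.
The formal parameter `lam` counts space-time derivatives. -/
def Background.D (bg : Background) (lam : ℂ) (χ : Bool) (u v : Slot) (f : Gen A) : Gen A :=
  lam • ∑ a, ∑ b, u.act χ a (v.act (!χ) b (bg.covD (pair χ a b) f))

/-! ### Differential forms -/

variable (A) in
/-- A one-form `h^{αα̇} w_{αα̇}(Y; K | x)`. -/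
abbrev OneForm := (Bool → Fin 2) → Gen A

variable (A) in
/-- A two-form `H^{αβ} B_{αβ} + H̄^{α̇β̇} B̄_{α̇β̇}` with `B = B true`, `B̄ = B false` symmetric, where
`H^{αβ} = h^α_{γ̇} h^{βγ̇}`, `H̄^{α̇β̇} = h_γ^α̇ h^{γβ̇}`. -/
abbrev TwoForm := Bool → Fin 2 → Fin 2 → Gen A

/-- The two-form `h^{αα̇} ∧ h^{ββ̇} T_{αα̇,ββ̇}`, by
`h^{αα̇} ∧ h^{ββ̇} = (ε^{α̇β̇} H^{αβ} + ε^{αβ} H̄^{α̇β̇}) / 2`. -/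
def wedge (T : (Bool → Fin 2) → (Bool → Fin 2) → Gen A) : TwoForm A :=
  fun χ a b => ∑ c, ∑ d, (eps c d / 4) •
    (T (pair χ a c) (pair χ b d) + T (pair χ b c) (pair χ a d))

/-- `w(u, ū | Y) = u^α ū^α̇ w_{αα̇}(Y)`, `u` of chirality `χ`. -/
def OneForm.at (w : OneForm A) (χ : Bool) (u v : Slot) : Gen A :=
  ∑ a, ∑ b, u.act χ a (v.act (!χ) b (w (pair χ a b)))

/-- `B(u, v | Y) = u^α v^β B_{αβ}(Y)` in the part of chirality `χ`. -/
def TwoForm.at (B : TwoForm A) (χ : Bool) (u v : Slot) : Gen A :=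
  ∑ a, ∑ b, u.act χ a (v.act χ b (B χ a b))

/-- Bidegree component of a one-form. -/
def OneForm.part (w : OneForm A) (m : Bool → ℕ) : OneForm A := fun ι => comp m (w ι)

/-- Bidegree component of a two-form. -/
def TwoForm.part (B : TwoForm A) (m : Bool → ℕ) : TwoForm A := fun χ a b => comp m (B χ a b)

/-- A one-form of spin `N / 2`: only monomials of total degree `N - 2`. -/
def OneForm.HasSpin (w : OneForm A) (N : ℕ) : Prop :=
  ∀ ι μ, w ι μ ≠ 0 → deg true μ + deg false μ + 2 = N

/-- The spin `N / 2` part of a two-form: the monomials of total degree `N - 2`. -/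
def TwoForm.spinPart (B : TwoForm A) (N : ℕ) : TwoForm A :=
  fun χ a b μ => if deg true μ + deg false μ + 2 = N then B χ a b μ else 0

/-! ### Bilinear vertices

A vertex is `F(Y, P₁, P₂) f(Y₁; K) g(Y₂; K) |_{Y₁ = Y₂ = 0}`, with a kernel `F` that is a power
series in the variables `Y` (leg `0`), `P₁` (leg `1`) and `P₂` (leg `2`); the `p_i` carry lower
indices. -/

/-- Polynomials in the variables `Y`, `P₁`, `P₂`. -/
abbrev Sym := MvPolynomial (Fin 3 × Var) ℂ

/-- The variable of leg `i`, chirality `χ`, index `a`. -/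
def leg (i : Fin 3) (χ : Bool) (a : Fin 2) : Sym := MvPolynomial.X (i, (χ, a))

/-- `(p_i y) = (p_i)_α y^α`. -/
def py (χ : Bool) (i : Fin 3) : Sym := ∑ a, leg i χ a * leg 0 χ a

/-- `(p_i p_j) = (p_i)_α (p_j)^α = ε^{αβ} (p_i)_α (p_j)_β`. -/
def pp (χ : Bool) (i j : Fin 3) : Sym := ∑ a, ∑ b, MvPolynomial.C (eps a b) * leg i χ a * leg j χ b

/-- `y_α = y^β ε_{βα}`. -/
def yLow (χ : Bool) (a : Fin 2) : Sym := ∑ b, MvPolynomial.C (eps b a) * leg 0 χ b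

/-- The coefficients of the kernel `F`: exponents of `Y`, `P₁`, `P₂`. -/
abbrev Kernel := Expo → Expo → Expo → ℂ

/-- The exponent of `Y^μ P₁^ν P₂^ρ`. -/
def joinExpo (μ ν ρ : Expo) : Fin 3 × Var →₀ ℕ :=
  Finsupp.equivFunOnFinite.symm fun v => ![μ, ν, ρ] v.1 v.2

/-- The power series `G exp(q)` for `q` without constant term. Terms `G q^j` of the exponential
series with `j` larger than the degree of a monomial do not contribute to its coefficient. -/
def expKernel (G q : Sym) : Kernel := fun μ ν ρ =>
  ∑ j ∈ Finset.range ((joinExpo μ ν ρ).degree + 1),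
    MvPolynomial.coeff (joinExpo μ ν ρ) (G * q ^ j) / (j.factorial : ℂ)

/-- Product of the coefficient `u` of `Y₁^ν` and the coefficient `v` of `Y₂^ρ`: the Klein operators
of the first factor are moved to the right, `k f(y) = f(-y) k`, `k̄ f(ȳ) = f(-ȳ) k̄`. -/
def twMul (ρ : Expo) (u v : Klein → SmoothFun A) : Klein → SmoothFun A := fun κ =>
  ∑ κ₁ : Klein, (∏ χ, if κ₁ χ = 1 then (-1 : ℂ) ^ deg χ ρ else 1) • (u κ₁ * v (κ - κ₁))

/-- `ν! = ∏ ν_v!`, with the factor `(-i)^{|ν|}`: the value of `P^ν Y^ν`, `p_α = -i ∂/∂y^α`. -/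
def pairing (ν : Expo) : ℂ := (-Complex.I) ^ ν.degree * ∏ v, ((ν v).factorial : ℂ)

/-- `F(Y, P₁, P₂) f(Y₁; K) g(Y₂; K) |_{Y₁ = Y₂ = 0}`. -/
def Kernel.apply (F : Kernel) (f g : Gen A) : Gen A := fun μ =>
  ∑ᶠ νρ : Expo × Expo, (F μ νρ.1 νρ.2 * pairing νρ.1 * pairing νρ.2) •
    twMul νρ.2 (f νρ.1) (g νρ.2)

/-- Coupling constant: `η` for `χ = true` and `η̄` for `χ = false`. -/
def coupling (η : ℂ) (χ : Bool) : ℂ := if χ then η else (starRingEnd ℂ) η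

/-- Exponent of the star product,
`- i (p₁p₂) + i (p₁y) + i (p₂y) - i (p̄₁p̄₂) + i (p̄₁ȳ) + i (p̄₂ȳ)`. -/
def starKernel : Kernel :=
  expKernel 1 (∑ χ, MvPolynomial.C Complex.I * (-pp χ 1 2 + py χ 1 + py χ 2))

/-- `Υ(ω, ω) = - ω ⋆ ω` with fixed order of the two factors. -/
def vertexWW (w₂ w₃ : OneForm A) : TwoForm A :=
  wedge fun ι ι' => -(starKernel.apply (w₂ ι) (w₃ ι'))

/-- Kernel of `Υ(Ω, ω, C)`, component `αα̇ = ι` of `h`: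
`∫₀¹ dt (p_w)_α (t p̄_w + p̄_c)_α̇
  exp{ - i t (p_w p_c) + i (1 - t)(p_w y) - i (p̄_w p̄_c) + i σ (p̄_w ȳ) + i (p̄_c ȳ) }`,
where `w` and `c` are the legs of `ω` and `C`, and `σ = ±1`; `χ = false` is the conjugate. -/
def kernelWC (χ : Bool) (w c : Fin 3) (σ : ℂ) (ι : Bool → Fin 2) : Kernel := fun μ ν ρ =>
  ∫ t in (0 : ℝ)..1,
    expKernel
      (leg w χ (ι χ) * (MvPolynomial.C (t : ℂ) * leg w (!χ) (ι (!χ)) + leg c (!χ) (ι (!χ))))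
      (MvPolynomial.C (-Complex.I * t) * pp χ w c + MvPolynomial.C (Complex.I * (1 - t)) * py χ w
        - MvPolynomial.C Complex.I * pp (!χ) w c + MvPolynomial.C (Complex.I * σ) * py (!χ) w
        + MvPolynomial.C Complex.I * py (!χ) c) μ ν ρ

/-- The `ω C`-ordered part of `Υ(Ω, ω, C)`. -/
def vertexWC (η : ℂ) (w : OneForm A) (C : Gen A) : TwoForm A :=
  wedge fun ι ι' => ∑ χ, (-(Complex.I * coupling η χ) / 2) •
    mulK χ ((kernelWC χ 1 2 1 ι).apply (w ι') C)

/-- The `C ω`-ordered part of `Υ(Ω, ω, C)`, with `C(Y₂; K) ω(-Y₁; K)` and the additional factor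
`- exp(- 2 i (p̄₁ȳ))`; here the first factor `C` is leg `1` and `ω` is leg `2`. -/
def vertexCW (η : ℂ) (C : Gen A) (w : OneForm A) : TwoForm A :=
  wedge fun ι ι' => ∑ χ, (Complex.I * coupling η χ / 2) •
    mulK χ ((kernelWC χ 2 1 (-1) ι).apply C (reflect (w ι')))

/-- Integrand of the kernel of `Υ(Ω, Ω, C, C)` in front of `H̄^{α̇β̇} / 2`. Acting on the exponential
below, `p̄_α̇ p̄_β̇ / t₄²` gives `(t₂ p̄₁ - t₁ p̄₂)_α̇ (t₂ p̄₁ - t₁ p̄₂)_β̇`; the exponent is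
`i t₁ (p₁y) - i t₂ (p₂y) - i t₃ (p̄₁p̄₂) + i t₂ t₄ (p̄₁ȳ) - i t₁ t₄ (p̄₂ȳ)`. -/
def kernelCCAux (χ : Bool) (a b : Fin 2) (t₁ t₂ t₃ t₄ : ℝ) : Kernel :=
  expKernel
    ((MvPolynomial.C (t₂ : ℂ) * leg 1 (!χ) a - MvPolynomial.C (t₁ : ℂ) * leg 2 (!χ) a) *
      (MvPolynomial.C (t₂ : ℂ) * leg 1 (!χ) b - MvPolynomial.C (t₁ : ℂ) * leg 2 (!χ) b))
    (MvPolynomial.C (Complex.I * t₁) * py χ 1 - MvPolynomial.C (Complex.I * t₂) * py χ 2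
      - MvPolynomial.C (Complex.I * t₃) * pp (!χ) 1 2
      + MvPolynomial.C (Complex.I * t₂ * t₄) * py (!χ) 1
      - MvPolynomial.C (Complex.I * t₁ * t₄) * py (!χ) 2)

/-- The integral of the integrand over nonnegative `t` with `δ(1 - t₃ - t₄) δ'(1 - t₁ - t₂)`:
integration against `δ'(1 - r)` is the derivative at `r = 1` of the integral over
`t₁ + t₂ = r`. -/
def kernelCC (χ : Bool) (a b : Fin 2) : Kernel := fun μ ν ρ =>
  ∫ t₄ in (0 : ℝ)..1,
    deriv (fun r : ℝ => ∫ t₁ in (0 : ℝ)..r, kernelCCAux χ a b t₁ (r - t₁) (1 - t₄) t₄ μ ν ρ) 1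

/-- `Υ(Ω, Ω, C, C)`: the term `χ = true` is proportional to `H̄(p̄, p̄)`, its conjugate to
`H(p, p)`. -/
def vertexCC (η : ℂ) (C₂ C₃ : Gen A) : TwoForm A := fun χ a b =>
  (-(Complex.I * coupling η true * coupling η false) / 8) •
    mulK true (mulK false ((kernelCC (!χ) a b).apply C₂ C₃))

/-- The `ω C`-ordered part of `Υ(ω, C) = - [ω, C]_⋆`. -/
def vertex0WC (w : OneForm A) (C : Gen A) : OneForm A := fun ι => -(starKernel.apply (w ι) C)

/-- The `C ω`-ordered part of `Υ(ω, C) = - [ω, C]_⋆`. -/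
def vertex0CW (C : Gen A) (w : OneForm A) : OneForm A := fun ι => starKernel.apply C (w ι)

/-- Kernel of `Υ(Ω, C, C)`, component `αα̇ = ι` of `h`:
`∫₀¹ dt y_α ((1 - t) p̄₁ - t p̄₂)_α̇
  exp{ i t (p₁y) - i (1 - t)(p₂y) - i (p̄₁p̄₂) + i (p̄₁ȳ) + i (p̄₂ȳ) }`. -/
def kernel0CC (χ : Bool) (ι : Bool → Fin 2) : Kernel := fun μ ν ρ =>
  ∫ t in (0 : ℝ)..1,
    expKernel
      (yLow χ (ι χ) * (MvPolynomial.C ((1 : ℂ) - t) * leg 1 (!χ) (ι (!χ))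
        - MvPolynomial.C (t : ℂ) * leg 2 (!χ) (ι (!χ))))
      (MvPolynomial.C (Complex.I * t) * py χ 1 - MvPolynomial.C (Complex.I * (1 - t)) * py χ 2
        - MvPolynomial.C Complex.I * pp (!χ) 1 2 + MvPolynomial.C Complex.I * py (!χ) 1
        + MvPolynomial.C Complex.I * py (!χ) 2) μ ν ρ

/-- `Υ(Ω, C, C)`. -/
def vertex0CC (η : ℂ) (C₂ C₃ : Gen A) : OneForm A := fun ι =>
  ∑ χ, (Complex.I * coupling η χ / 2) • mulK χ ((kernel0CC χ ι).apply C₂ C₃)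

/-! ### Master fields of fixed spin in terms of the Fronsdal field

The spin `s = N / 2` is given by the natural number `N = 2 s`; then `[s] = N / 2` and
`s + {s} = (N + 1) / 2` with division in `ℕ`. -/

variable (A) in
/-- A Fronsdal (or Fang-Fronsdal) field of spin `N / 2` in the transverse-traceless gauge, without
its differential constraints: `φ true = φ_{s+{s}, s-{s}}(Y; K)` and
`φ false = φ_{s-{s}, s+{s}}(Y; K)`, which coincide for bosons. For spin `0` and `1/2` these are the
scalar and the two-component spinor fields. -/
structure FronsdalField (N : ℕ) where
  φ : Bool → Gen A
  homogeneous : ∀ χ μ, φ χ μ ≠ 0 → deg χ μ = (N + 1) / 2 ∧ deg (!χ) μ = N / 2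
  boson : Even N → φ true = φ false
  klein : ∀ χ μ κ, κ true ≠ κ false → φ χ μ κ = 0

/-- Numerical coefficients in the expressions of `ω` and `C` through the Fronsdal field; they
depend on the spin, the number of the component and the chirality (and on `η`). -/
structure Coefficients where
  /-- coefficients of the components of `ω` -/
  gauge : ℕ → Bool → ℕ → ℂ
  /-- coefficients of the components of `C` -/
  weyl : ℕ → Bool → ℕ → ℂ

/-- For `χ = true`, `φ_{s+{s}+m, s-{s}-m} = c D^m(y, p̄) φ_{s+{s}, s-{s}}`; for `χ = false` the
conjugate. -/
def FronsdalField.tower {N : ℕ} (Φ : FronsdalField A N) (bg : Background) (lam : ℂ)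
    (co : Coefficients) (χ : Bool) (m : ℕ) : Gen A :=
  co.gauge N χ m • (bg.D lam χ .y .p)^[m] (Φ.φ χ)

/-- The gauge one-form `ω = ∑ ω_{a,b}`, `a + b = 2 (s - 1)`, with `ω_{a,b} = - h(p, p̄) φ_{a+1,b+1}`,
i.e. `(ω_{a,b})_{αα̇} = ∂_α ∂̄_α̇ φ_{a+1,b+1}`. -/
def FronsdalField.omega {N : ℕ} (Φ : FronsdalField A N) (bg : Background) (lam : ℂ)
    (co : Coefficients) : OneForm A := fun ι μ =>
  if deg true μ + deg false μ + 2 = N then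
    if deg false μ ≤ deg true μ then
      pdY (true, ι true) (pdY (false, ι false)
        (Φ.tower bg lam co true ((deg true μ - deg false μ) / 2))) μ
    else
      pdY (true, ι true) (pdY (false, ι false)
        (Φ.tower bg lam co false ((deg false μ - deg true μ) / 2))) μ
  else 0

/-- For `χ = true`, `C_{2s+n,n} = c D^n(y, ȳ) D^{[s]}(y, p̄) φ_{s+{s}, s-{s}} k̄`; for `χ = false`
the conjugate `C_{n,2s+n}`. -/
def FronsdalField.weylComp {N : ℕ} (Φ : FronsdalField A N) (bg : Background) (lam : ℂ)
    (co : Coefficients) (χ : Bool) (n : ℕ) : Gen A :=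
  co.weyl N χ n • mulK (!χ) ((bg.D lam χ .y .y)^[n] ((bg.D lam χ .y .p)^[N / 2] (Φ.φ χ)))

/-- The zero-form `C = ∑ (C_{n,2s+n} + C_{2s+n,n})` (for `s = 0` there is one component for each
`n`). -/
def FronsdalField.weyl {N : ℕ} (Φ : FronsdalField A N) (bg : Background) (lam : ℂ)
    (co : Coefficients) : Gen A := fun μ =>
  if deg true μ = N + deg false μ then Φ.weylComp bg lam co true (deg false μ) μ
  else if deg false μ = N + deg true μ then Φ.weylComp bg lam co false (deg true μ) μ
  else 0

/-- Helicity part of a one-form. -/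
def OneForm.hel (τ : Bool) (w : OneForm A) : OneForm A := fun ι => helPart τ (w ι)

/-! ### Projection to Fronsdal currents -/

/-- Labels of the irreducible components of the current of the equations of a given spin.
Bosons use `main false` and `trace false` only; fermions use all labels, the Boolean being the
chirality. -/
inductive CurrentLabel
  | main (χ : Bool)
  | trace (χ : Bool)
  | gammaTrace (χ : Bool)

variable (A) in
/-- The collection of components of a current. -/
abbrev Current := CurrentLabel → Gen A

/-- `J_{s,s}` for integer `s ≥ 1`:
`Υ_{s,s-2}(ȳ,ȳ|Y) / (2s)
  + i / (2 s² (s+1)) [D(p,ȳ) Υ_{s-1,s-1}(y,y|Y) + s D(y,ȳ) Υ_{s-1,s-1}(y,p|Y)] + c.c.`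
For `s = 1` there is no `Υ_{s,s-2}`, and this is the contribution of the one-form sector to the
Yang-Mills current. -/
def bosonMain (bg : Background) (lam : ℂ) (s : ℕ) (B : TwoForm A) : Gen A :=
  ∑ χ, ((if 2 ≤ s then (1 / (2 * s) : ℂ) • (B.part (pair χ s (s - 2))).at (!χ) .y .y else 0) +
    (Complex.I / (2 * s ^ 2 * (s + 1))) •
      (bg.D lam χ .p .y ((B.part (pair χ (s - 1) (s - 1))).at χ .y .y) +
        (s : ℂ) • bg.D lam χ .y .y ((B.part (pair χ (s - 1) (s - 1))).at χ .y .p)))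

/-- `J_{s-2,s-2}` for integer `s ≥ 2`:
`Υ_{s,s-2}(p,p|Y) / 2
  + i / (2 s (s-1)) [D(p,ȳ) Υ_{s-1,s-1}(p̄,p̄|Y) - s D(p,p̄) Υ_{s-1,s-1}(ȳ,p̄|Y)] + c.c.` -/
def bosonTrace (bg : Background) (lam : ℂ) (s : ℕ) (B : TwoForm A) : Gen A :=
  ∑ χ, ((1 / 2 : ℂ) • (B.part (pair χ s (s - 2))).at χ .p .p +
    (Complex.I / (2 * s * (s - 1))) •
      (bg.D lam χ .p .y ((B.part (pair χ (s - 1) (s - 1))).at (!χ) .p .p) -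
        (s : ℂ) • bg.D lam χ .p .p ((B.part (pair χ (s - 1) (s - 1))).at (!χ) .y .p)))

/-- The Fronsdal current of spin `N / 2 ≥ 1` determined by the right-hand side `B` of the equation
for the one-form `ω`. For half-integer `s`, with `Υ = Υ_{s-1/2,s-3/2}`, it consists of
`Υ(ȳ,ȳ|Y) / (s-1/2)`, `- Υ(p,p|Y) / (s+1/2)`,
`- i (s²-1/4) / (2s) [(s+1/2) Υ(y,p|Y) + (s-1/2) Υ(ȳ,p̄|Y)]` and of their conjugates. -/
def currentOne (bg : Background) (lam : ℂ) (N : ℕ) (B : TwoForm A) : Current A := fun l =>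
  if Even N then
    match l with
    | .main false => if 2 ≤ N then bosonMain bg lam (N / 2) B else 0
    | .trace false => if 4 ≤ N then bosonTrace bg lam (N / 2) B else 0
    | _ => 0
  else if 3 ≤ N then
    match l with
    | .main χ => (1 / ((N : ℂ) / 2 - 1 / 2)) •
        (B.part (pair χ ((N - 1) / 2) ((N - 3) / 2))).at (!χ) .y .y
    | .trace χ => (-(1 / ((N : ℂ) / 2 + 1 / 2))) •
        (B.part (pair χ ((N - 1) / 2) ((N - 3) / 2))).at χ .p .p
    | .gammaTrace χ => (-(Complex.I * (((N : ℂ) / 2) ^ 2 - 1 / 4) / N)) •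
        ((((N : ℂ) / 2 + 1 / 2)) • (B.part (pair χ ((N - 1) / 2) ((N - 3) / 2))).at χ .y .p +
          (((N : ℂ) / 2 - 1 / 2)) • (B.part (pair χ ((N - 1) / 2) ((N - 3) / 2))).at (!χ) .y .p)
  else 0

/-- The current of the Klein-Gordon (`N = 0`), Dirac (`N = 1`) and Yang-Mills (`N = 2`) equations
determined by the right-hand side `w` of the equation for the zero-form `C`:
`J_{0,0} = - (i Υ_{1,1}(p,p̄|Y) - D(p,p̄) Υ_{0,0}(y,ȳ|0)) / 2`;
`J_{1,0} = Υ_{0,1}(y,p̄|0,ȳ)` and its conjugate; `J_{1,1} = - η Υ_{0,2}(y,p̄|0,ȳ) / 4 + c.c.` -/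
def currentZero (bg : Background) (η lam : ℂ) (N : ℕ) (w : OneForm A) : Current A := fun l =>
  match N, l with
  | 0, .main false => (-1 / 2 : ℂ) • (Complex.I • (w.part (pair true 1 1)).at true .p .p -
      bg.D lam true .p .p ((w.part (pair true 0 0)).at true .y .y))
  | 1, .main χ => (w.part (pair χ 0 1)).at χ .y .p
  | 2, .main false => ∑ χ, (-(coupling η χ) / 4) • (w.part (pair χ 0 2)).at χ .y .p
  | _, _ => 0

/-! ### Counting of derivatives -/

/-- `J`, as a function of the parameter `lam` multiplying each space-time derivative, is a
polynomial all of whose powers of `lam` lie in `T`: every term of the current carries a number of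
derivatives that belongs to `T`. If `T` is empty, the current vanishes. -/
def Carries (J : ℂ → Current A) (T : Set ℕ) : Prop :=
  ∃ c : ℕ →₀ Current A, (∀ k ∈ c.support, k ∈ T) ∧
    ∀ lam : ℂ, J lam = ∑ k ∈ c.support, lam ^ k • c k

/-- The spin `N / 2`. -/
def spin (N : ℕ) : ℚ := N / 2

/-- `𝒮 = [s₁] + [s₂] + [s₃]`. -/
def sumS (N₁ N₂ N₃ : ℕ) : ℚ := ((N₁ / 2 + N₂ / 2 + N₃ / 2 : ℕ) : ℚ)

/-- The triangle inequalities `s_i + s_j ≥ s_k + 1`. -/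
def Triangle (s₁ s₂ s₃ : ℚ) : Prop :=
  s₃ + 1 ≤ s₁ + s₂ ∧ s₂ + 1 ≤ s₁ + s₃ ∧ s₁ + 1 ≤ s₂ + s₃

/-! ### The tables

`s_i = N_i / 2`; `s₁` is the spin of the vertex and `s₂`, `s₃` are the spins of its first and second
factor. `τ₂`, `τ₃` are the signs of the helicities of the factors. -/

/-- Numbers of derivatives allowed for `Υ(ω, ω)`. -/
def tableWW (N₁ N₂ N₃ : ℕ) (τ₂ τ₃ : Bool) : Set ℕ :=
  {k | Triangle (spin N₁) (spin N₂) (spin N₃) ∧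
    (k : ℚ) ≤ if τ₂ = τ₃ then sumS N₁ N₂ N₃ - 2 * spin N₁
      else sumS N₁ N₂ N₃ - 2 * max (spin N₂) (spin N₃)}

/-- Numbers of derivatives allowed for `Υ(Ω, ω, C)`. -/
def tableWC (N₁ N₂ N₃ : ℕ) (τ₂ τ₃ : Bool) : Set ℕ :=
  {k |
    (Triangle (spin N₁) (spin N₂) (spin N₃) ∧
      (k : ℚ) ≤ sumS N₁ N₂ N₃ - 2 * min (spin N₁) (min (spin N₂) (spin N₃))) ∨
    (spin N₂ = spin N₁ + spin N₃ ∧ (k : ℚ) ≤ sumS N₁ N₂ N₃ - 2 * min (spin N₁) (spin N₃)) ∨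
    (spin N₃ = spin N₁ + spin N₂ ∧ (k : ℚ) ≤ sumS N₁ N₂ N₃ - 2 * min (spin N₁) (spin N₂)) ∨
    (spin N₁ + spin N₃ < spin N₂ ∧ (k : ℚ) ≤ if τ₂ = τ₃ then sumS N₁ N₂ N₃
      else sumS N₁ N₂ N₃ - 2 * min (spin N₁) (spin N₃)) ∨
    (spin N₁ + spin N₂ < spin N₃ ∧ (k : ℚ) ≤ if τ₂ = τ₃ then sumS N₁ N₂ N₃
      else sumS N₁ N₂ N₃ - 2 * min (spin N₁) (spin N₂))}

/-- Numbers of derivatives allowed for `Υ(Ω, Ω, C, C)`. -/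
def tableCC (N₁ N₂ N₃ : ℕ) (τ₂ τ₃ : Bool) : Set ℕ :=
  {k |
    (τ₂ = τ₃ ∧
      (Triangle (spin N₁) (spin N₂) (spin N₃) ∨ spin N₂ = spin N₁ + spin N₃ ∨
        spin N₃ = spin N₁ + spin N₂ ∨ spin N₂ + spin N₃ ≤ spin N₁) ∧
      (k : ℚ) = sumS N₁ N₂ N₃) ∨
    (τ₂ ≠ τ₃ ∧ spin N₂ + spin N₃ ≤ spin N₁ ∧
      (k : ℚ) = sumS N₁ N₂ N₃ - 2 * min (spin N₂) (spin N₃))}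

/-- Numbers of derivatives allowed for `Υ(ω, C)`, where `C` is the field of spin `N / 2`.
If `s₁ = 1` and `C` has spin `0` or `1/2`, terms with `𝒮 - 2` derivatives occur as well. -/
def table0WC (N₁ N₂ N₃ N : ℕ) : Set ℕ :=
  {k |
    ((N₁ = 1 ∨ N₁ = 2) ∧ spin N₁ + 1 ≤ spin N₂ + spin N₃ ∧
      ((k : ℚ) = sumS N₁ N₂ N₃ - 2 * min (spin N₁) (min (spin N₂) (spin N₃)) ∨
        (N₁ = 2 ∧ spin N < 1 ∧ (k : ℚ) = sumS N₁ N₂ N₃ - 2))) ∨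
    ((N₁ = 0 ∨ N₁ = 1 ∨ N₁ = 2) ∧ spin N₁ + 1 ≤ |spin N₂ - spin N₃| ∧
      (k : ℚ) = sumS N₁ N₂ N₃)}

/-- Numbers of derivatives allowed for `Υ(Ω, C, C)`. -/
def table0CC (N₁ N₂ N₃ : ℕ) : Set ℕ :=
  {k |
    ((N₁ = 1 ∨ N₁ = 2) ∧ spin N₂ + spin N₃ ≤ spin N₁ ∧
      (k : ℚ) = sumS N₁ N₂ N₃ - 2 * min (spin N₁) (min (spin N₂) (spin N₃))) ∨
    ((N₁ = 1 ∨ N₁ = 2) ∧ |spin N₂ - spin N₃| ≤ spin N₁ ∧ (k : ℚ) = sumS N₁ N₂ N₃) ∨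
    (N₁ = 0 ∧ |spin N₂ - spin N₃| ≤ 1 ∧ 1 ≤ spin N₂ + spin N₃ ∧
      (k : ℚ) = ((N₂ / 2 + N₃ / 2 : ℕ) : ℚ))}

end

end HigherSpin

open HigherSpin

namespace HigherSpin

noncomputable section

open scoped ContDiff

variable {A : Type*} [NormedRing A] [NormedAlgebra ℂ A]

/-! ### Polynomials in the derivative-counting parameter -/

section PolyIn

variable {M M' : Type*} [AddCommMonoid M] [Module ℂ M] [AddCommMonoid M'] [Module ℂ M']

/-! Counting derivatives is bookkeeping of degrees in `Y`. Once `ω` and `C` are expressed through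
Fronsdal fields, the coefficient of a monomial of bidegree `a` is proportional to a single power of
`lam`: half the difference of the two degrees, rounded down, for `ω`, and `[s]` plus the smaller
degree for `C` (`graded_omega`, `graded_weyl`).

The kernels are exponentials of quadratic forms times simple prefactors. Each factor of the exponent
raises the degrees of exactly two legs of one chirality, so the degrees of the output and of the two
inputs obey triangle inequalities, equalities and parity conditions: `StarRel`, `WCRel`, `CCRel`,
`ZeroCCRel`. A bidegree component of a vertex is therefore a finite sum of powers of `lam` over the
pairs `(a, b)` compatible with its bidegree `m` (`PolyIn.apply`). The projection to a current uses
only components near the diagonal and adds one derivative to the diagonal ones. What remains is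
linear arithmetic, carried by the `count_` lemmas.

Degrees alone do not suffice in two places. In `Υ(Ω,Ω,C,C)`, differentiating the exponent reproduces
the spinor already present in the prefactor, so every contraction with `p` vanishes
(`vertexCC_part_at_p`). Only contractions with `y` remain, and for these the number of derivatives
is fixed exactly. In `Υ(ω,C)`, the one-form is a gradient in `Y`, so a contraction with `p`
annihilates `ω` and acts only on `C` (`ordApply_contract`). The sharper relation obtained in this
way gives the exact counts of the zero-form sector. -/

theorem _root_.IsLinearMap.sum_map {ι M M' : Type*} [AddCommMonoid M] [Module ℂ M]
    [AddCommMonoid M'] [Module ℂ M'] {L : M → M'} (h : IsLinearMap ℂ L) (s : Finset ι) (f : ι → M) :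
    L (∑ i ∈ s, f i) = ∑ i ∈ s, L (f i) := map_sum (h.mk' L) f s

/-- `J` is a polynomial with coefficients in `M` all of whose exponents lie in `T`. -/
def PolyIn (J : ℂ → M) (T : Set ℕ) : Prop :=
  ∃ c : ℕ →₀ M, (∀ k ∈ c.support, k ∈ T) ∧ ∀ lam : ℂ, J lam = ∑ k ∈ c.support, lam ^ k • c k

theorem PolyIn.mono {J : ℂ → M} {T T' : Set ℕ} (h : PolyIn J T) (hT : T ⊆ T') : PolyIn J T' := by
  obtain ⟨c, hc, hJ⟩ := h
  exact ⟨c, fun k hk => hT (hc k hk), hJ⟩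

theorem PolyIn.zero (T : Set ℕ) : PolyIn (fun _ => (0 : M)) T := ⟨0, by simp, by simp⟩

/-- The exponent is restricted only when the coefficient is nonzero. Hence an empty set of
admissible exponents expresses vanishing. -/
theorem PolyIn.monomial {T : Set ℕ} (k : ℕ) (x : M) (h : x ≠ 0 → k ∈ T) :
    PolyIn (fun lam => lam ^ k • x) T := by
  classical
  by_cases hx : x = 0
  · subst hx; simpa using PolyIn.zero T
  · refine ⟨Finsupp.single k x, ?_, ?_⟩
    · intro j hj
      rw [Finsupp.support_single _ hx] at hj
      rw [Finset.mem_singleton.1 hj]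
      exact h hx
    · intro lam
      simp [Finsupp.support_single k hx]

theorem PolyIn.add {J J' : ℂ → M} {T : Set ℕ} (h : PolyIn J T) (h' : PolyIn J' T) :
    PolyIn (fun lam => J lam + J' lam) T := by
  classical
  obtain ⟨c, hc, hJ⟩ := h
  obtain ⟨c', hc', hJ'⟩ := h'
  refine ⟨c + c', ?_, ?_⟩
  · intro k hk
    rcases Finset.mem_union.1 (Finsupp.support_add hk) with h | h
    · exact hc k h
    · exact hc' k h
  · intro lam
    simp only [hJ, hJ']
    exact (Finsupp.sum_add_index' (h := fun k x => lam ^ k • x) (by simp) (by simp)).symm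

theorem PolyIn.sum {ι : Type*} (s : Finset ι) {J : ι → ℂ → M} {T : Set ℕ}
    (h : ∀ i ∈ s, PolyIn (J i) T) : PolyIn (fun lam => ∑ i ∈ s, J i lam) T := by
  classical
  induction s using Finset.induction_on with
  | empty => simpa using PolyIn.zero T
  | insert a s ha ih =>
    simp only [Finset.sum_insert ha]
    exact (h a (by simp)).add (ih fun i hi => h i (by simp [hi]))

/-- Exponents may repeat and coefficients may cancel; cancellation only removes exponents. Vertices
arise in this form, as sums over pairs of monomials. -/
theorem PolyIn.of_sum {ι : Type*} (s : Finset ι) (d : ι → ℕ) (x : ι → M) {J : ℂ → M} {T : Set ℕ}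
    (h : ∀ i ∈ s, x i ≠ 0 → d i ∈ T) (hJ : ∀ lam, J lam = ∑ i ∈ s, lam ^ d i • x i) :
    PolyIn J T := by
  rw [funext hJ]
  exact PolyIn.sum s fun i hi => PolyIn.monomial _ _ (h i hi)

theorem PolyIn.map {J : ℂ → M} {T : Set ℕ} (h : PolyIn J T) {L : M → M'} (hL : IsLinearMap ℂ L) :
    PolyIn (fun lam => L (J lam)) T := by
  obtain ⟨c, hc, hJ⟩ := h
  refine PolyIn.of_sum c.support id (fun k => L (c k)) (fun k hk _ => hc k hk) fun lam => ?_
  rw [hJ, hL.sum_map]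
  simp [hL.map_smul]

theorem PolyIn.smul {J : ℂ → M} {T : Set ℕ} (h : PolyIn J T) (a : ℂ) :
    PolyIn (fun lam => a • J lam) T :=
  h.map (L := fun x => a • x) ⟨fun x y => smul_add a x y, fun b x => smul_comm a b x⟩

theorem PolyIn.neg {M : Type*} [AddCommGroup M] [Module ℂ M] {J : ℂ → M} {T : Set ℕ}
    (h : PolyIn J T) : PolyIn (fun lam => -J lam) T := by
  simpa using h.smul (-1)

theorem PolyIn.sub {M : Type*} [AddCommGroup M] [Module ℂ M] {J J' : ℂ → M}
    {T : Set ℕ} (h : PolyIn J T) (h' : PolyIn J' T) : PolyIn (fun lam => J lam - J' lam) T := by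
  simpa [sub_eq_add_neg] using h.add h'.neg

/-- Accounts for the explicit factor `lam` in each `D`, which shifts all exponents by one. -/
theorem PolyIn.param_smul {J : ℂ → M} {T : Set ℕ} (h : PolyIn J {k | k + 1 ∈ T}) :
    PolyIn (fun lam => lam • J lam) T := by
  obtain ⟨c, hc, hJ⟩ := h
  refine PolyIn.of_sum c.support (fun k => k + 1) c (fun k hk _ => hc k hk) fun lam => ?_
  rw [hJ, Finset.smul_sum]
  exact Finset.sum_congr rfl fun k _ => by rw [smul_smul, pow_succ']

/-- Finiteness of `ι` keeps the union of the supports of the components finite; this is why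
`CurrentLabel` is shown to be finite. -/
theorem PolyIn.pi {ι : Type*} [Finite ι] {V : ι → Type*} [∀ i, AddCommMonoid (V i)]
    [∀ i, Module ℂ (V i)] {J : ℂ → ∀ i, V i} {T : Set ℕ} (h : ∀ i, PolyIn (fun lam => J lam i) T) :
    PolyIn J T := by
  classical
  cases nonempty_fintype ι
  have : J = fun lam => ∑ i, Pi.single i (J lam i) := by
    funext lam
    rw [Finset.univ_sum_single]
  rw [this]
  exact PolyIn.sum _ fun i _ => (h i).map (LinearMap.single ℂ V i).isLinear

end PolyIn

instance : Finite CurrentLabel := by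
  refine Finite.of_surjective (fun x : Fin 3 × Bool => match x.1 with
    | 0 => CurrentLabel.main x.2
    | 1 => CurrentLabel.trace x.2
    | 2 => CurrentLabel.gammaTrace x.2) ?_
  rintro (χ | χ | χ)
  · exact ⟨(0, χ), rfl⟩
  · exact ⟨(1, χ), rfl⟩
  · exact ⟨(2, χ), rfl⟩

theorem carries_of_components {J : ℂ → Current A} {T : Set ℕ}
    (h : ∀ l, PolyIn (fun lam => J lam l) T) : Carries J T := PolyIn.pi h

/-! ### Linearity of the operations on generating functions -/

theorem _root_.IsLinearMap.fin_sum {ι M M' : Type*} [AddCommMonoid M] [Module ℂ M]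
    [AddCommMonoid M'] [Module ℂ M'] (s : Finset ι) {L : ι → M → M'} (h : ∀ i, IsLinearMap ℂ (L i)) :
    IsLinearMap ℂ fun x => ∑ i ∈ s, L i x :=
  ⟨fun x y => by simp [(h _).map_add, Finset.sum_add_distrib],
    fun c x => by simp [(h _).map_smul, Finset.smul_sum]⟩

theorem _root_.IsLinearMap.const_smul {M M' : Type*} [AddCommMonoid M] [Module ℂ M]
    [AddCommMonoid M'] [Module ℂ M'] {L : M → M'} (h : IsLinearMap ℂ L) (a : ℂ) : IsLinearMap ℂ fun x => a • L x :=
  ⟨fun x y => by simp [h.map_add], fun c x => by rw [h.map_smul, smul_comm]⟩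

theorem isLinearMap_comp (m : Bool → ℕ) : IsLinearMap ℂ (comp m : Gen A → Gen A) := by
  constructor <;> intros <;> funext μ <;> simp only [comp, Pi.add_apply, Pi.smul_apply] <;>
    split_ifs <;> simp

theorem isLinearMap_mulK (χ : Bool) : IsLinearMap ℂ (mulK χ : Gen A → Gen A) :=
  ⟨fun _ _ => rfl, fun _ _ => rfl⟩

theorem isLinearMap_pdY (v : Var) : IsLinearMap ℂ (pdY v : Gen A → Gen A) := by
  constructor <;> intros <;> funext μ <;> simp only [pdY, Pi.add_apply, Pi.smul_apply]
  · rw [smul_add]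
  · rw [smul_comm]

theorem isLinearMap_mulY (v : Var) : IsLinearMap ℂ (mulY v : Gen A → Gen A) := by
  constructor <;> intros <;> funext μ <;> simp only [mulY, Pi.add_apply, Pi.smul_apply] <;>
    split_ifs <;> simp

theorem isLinearMap_act (s : Slot) (χ : Bool) (a : Fin 2) :
    IsLinearMap ℂ (s.act χ a : Gen A → Gen A) := by
  cases s
  · exact isLinearMap_mulY _
  · exact IsLinearMap.fin_sum _ fun b => (isLinearMap_pdY _).const_smul _

theorem isLinearMap_scalG (g : SmoothFun ℂ) : IsLinearMap ℂ (scalG g : Gen A → Gen A) := by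
  constructor <;> intros <;> funext μ κ <;> apply Subtype.ext <;> funext x <;>
    simp only [scalG, scal, Pi.add_apply, Pi.smul_apply, Subalgebra.coe_add, Subalgebra.coe_smul]
  · rw [smul_add]
  · rw [smul_comm]

theorem pdX_add (n : Fin 4) (f g : SmoothFun A) : pdX n (f + g) = pdX n f + pdX n g := by
  apply Subtype.ext
  funext x
  have hf : DifferentiableAt ℝ f.1 x :=
    (show ContDiff ℝ ∞ f.1 from f.2).differentiable (by simp) x
  have hg : DifferentiableAt ℝ g.1 x :=
    (show ContDiff ℝ ∞ g.1 from g.2).differentiable (by simp) x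
  change fderiv ℝ (f.1 + g.1) x _ = fderiv ℝ f.1 x _ + fderiv ℝ g.1 x _
  rw [fderiv_add hf hg]
  rfl

theorem pdX_smul (n : Fin 4) (c : ℂ) (f : SmoothFun A) : pdX n (c • f) = c • pdX n f := by
  apply Subtype.ext
  funext x
  have hf : DifferentiableAt ℝ f.1 x :=
    (show ContDiff ℝ ∞ f.1 from f.2).differentiable (by simp) x
  change fderiv ℝ (c • f.1) x _ = c • fderiv ℝ f.1 x _
  rw [fderiv_const_smul hf]
  rfl

theorem _root_.IsLinearMap.comp' {M M' M'' : Type*} [AddCommMonoid M] [Module ℂ M]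
    [AddCommMonoid M'] [Module ℂ M'] [AddCommMonoid M''] [Module ℂ M''] {L : M' → M''} {L' : M → M'}
    (h : IsLinearMap ℂ L) (h' : IsLinearMap ℂ L') : IsLinearMap ℂ fun x => L (L' x) :=
  ⟨fun x y => by rw [h'.map_add, h.map_add], fun c x => by rw [h'.map_smul, h.map_smul]⟩

theorem _root_.IsLinearMap.add' {M M' : Type*} [AddCommMonoid M] [Module ℂ M]
    [AddCommMonoid M'] [Module ℂ M'] {L L' : M → M'} (h : IsLinearMap ℂ L) (h' : IsLinearMap ℂ L') :
    IsLinearMap ℂ fun x => L x + L' x :=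
  ⟨fun x y => by rw [h'.map_add, h.map_add, add_add_add_comm],
    fun c x => by rw [h'.map_smul, h.map_smul, smul_add]⟩

theorem isLinearMap_covD (bg : Background) (ι : Bool → Fin 2) :
    IsLinearMap ℂ (bg.covD ι : Gen A → Gen A) := by
  refine IsLinearMap.fin_sum _ fun n => (isLinearMap_scalG _).comp' (IsLinearMap.add' ?_ ?_)
  · exact ⟨fun f g => by funext μ κ; exact pdX_add n _ _, fun c f => by
      funext μ κ; exact pdX_smul n c _⟩
  · exact IsLinearMap.fin_sum _ fun χ => IsLinearMap.fin_sum _ fun a =>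
      IsLinearMap.fin_sum _ fun b => ((isLinearMap_scalG _).comp' ((isLinearMap_act _ _ _).comp' (isLinearMap_act _ _ _))).const_smul _

theorem isLinearMap_D (bg : Background) (lam : ℂ) (χ : Bool) (u v : Slot) :
    IsLinearMap ℂ (bg.D lam χ u v : Gen A → Gen A) :=
  (IsLinearMap.fin_sum _ fun a => IsLinearMap.fin_sum _ fun b => (isLinearMap_act u χ a).comp'
    ((isLinearMap_act v (!χ) b).comp' (isLinearMap_covD bg _))).const_smul lam

theorem D_eq_smul (bg : Background) (lam : ℂ) (χ : Bool) (u v : Slot) (f : Gen A) :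
    bg.D lam χ u v f = lam • bg.D 1 χ u v f := by
  simp [Background.D]

theorem D_iterate (bg : Background) (lam : ℂ) (χ : Bool) (u v : Slot) (n : ℕ) (f : Gen A) :
    (bg.D lam χ u v)^[n] f = lam ^ n • (bg.D 1 χ u v)^[n] f := by
  induction n with
  | zero => simp
  | succ n ih =>
    rw [Function.iterate_succ_apply', Function.iterate_succ_apply', ih,
      (isLinearMap_D bg lam χ u v).map_smul, D_eq_smul, smul_smul, pow_succ]

theorem PolyIn.D {J : ℂ → Gen A} {T : Set ℕ} (h : PolyIn J {k | k + 1 ∈ T}) (bg : Background)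
    (χ : Bool) (u v : Slot) : PolyIn (fun lam => bg.D lam χ u v (J lam)) T := by
  have h' := (h.map (isLinearMap_D bg 1 χ u v)).param_smul
  simpa only [← D_eq_smul] using h'

/-! ### Fields homogeneous in the parameter -/

/-- The degrees of a monomial in the undotted and dotted variables. -/
def bideg (μ : Expo) : Bool → ℕ := fun χ => deg χ μ

/-- The coefficient of a monomial of bidegree `a` in `f lam` is proportional to `lam ^ d a`, and
vanishes unless `P a`. -/
structure Graded (f : ℂ → Gen A) (d : (Bool → ℕ) → ℕ) (P : (Bool → ℕ) → Prop) : Prop where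
  eq_smul : ∀ lam μ, f lam μ = lam ^ d (bideg μ) • f 1 μ
  support : ∀ lam μ, f lam μ ≠ 0 → P (bideg μ)

theorem Graded.hel {f : ℂ → Gen A} {d : (Bool → ℕ) → ℕ} {P : (Bool → ℕ) → Prop}
    (h : Graded f d P) (τ : Bool) :
    Graded (fun lam => helPart τ (f lam)) d fun a => P a ∧ a (!τ) ≤ a τ := by
  constructor
  · intro lam μ
    simp only [helPart]
    split_ifs
    · exact h.eq_smul lam μ
    · simp
  · intro lam μ hμ
    simp only [helPart] at hμ
    split_ifs at hμ with hd
    · exact ⟨h.support lam μ hμ, hd⟩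
    · exact absurd rfl hμ

theorem Graded.reflect {f : ℂ → Gen A} {d : (Bool → ℕ) → ℕ} {P : (Bool → ℕ) → Prop}
    (h : Graded f d P) : Graded (fun lam => reflect (f lam)) d P := by
  constructor
  · intro lam μ
    simp only [HigherSpin.reflect]
    rw [h.eq_smul lam μ, smul_comm]
  · intro lam μ hμ
    simp only [HigherSpin.reflect] at hμ
    exact h.support lam μ fun h0 => hμ (by rw [h0, smul_zero])

/-- Number of derivatives in the component of bidegree `a` of a gauge one-form. -/
def gaugeOrder (a : Bool → ℕ) : ℕ := ((a true - a false) + (a false - a true)) / 2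

/-- Number of derivatives in the component of bidegree `a` of a zero-form of spin `N / 2`. -/
def weylOrder (N : ℕ) (a : Bool → ℕ) : ℕ := N / 2 + min (a true) (a false)

/-- Bidegrees of a one-form of spin `N / 2`. -/
def GaugeDeg (N : ℕ) (a : Bool → ℕ) : Prop := a true + a false + 2 = N

/-- Bidegrees of a zero-form of spin `N / 2`. -/
def WeylDeg (N : ℕ) (a : Bool → ℕ) : Prop := a true = N + a false ∨ a false = N + a true

theorem tower_eq_smul {N : ℕ} (Φ : FronsdalField A N) (bg : Background) (lam : ℂ)
    (co : Coefficients) (χ : Bool) (m : ℕ) :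
    Φ.tower bg lam co χ m = lam ^ m • Φ.tower bg 1 co χ m := by
  rw [FronsdalField.tower, D_iterate, smul_comm]
  rfl

/-- In either branch the index of the tower is half the absolute difference of the degrees, rounded
down. One of the two truncated differences in `gaugeOrder` is always zero. -/
theorem graded_omega {N : ℕ} (Φ : FronsdalField A N) (bg : Background) (co : Coefficients)
    (ι : Bool → Fin 2) : Graded (fun lam => Φ.omega bg lam co ι) gaugeOrder (GaugeDeg N) := by
  constructor
  · intro lam μ
    simp only [FronsdalField.omega]
    split_ifs with h1 h2
    · rw [tower_eq_smul, (isLinearMap_pdY _).map_smul, (isLinearMap_pdY _).map_smul, Pi.smul_apply]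
      congr 2
      simp only [gaugeOrder, bideg]
      omega
    · rw [tower_eq_smul, (isLinearMap_pdY _).map_smul, (isLinearMap_pdY _).map_smul, Pi.smul_apply]
      congr 2
      simp only [gaugeOrder, bideg]
      omega
    · simp
  · intro lam μ h
    by_contra hn
    exact h (if_neg hn)

theorem weylComp_eq_smul {N : ℕ} (Φ : FronsdalField A N) (bg : Background) (lam : ℂ)
    (co : Coefficients) (χ : Bool) (n : ℕ) :
    Φ.weylComp bg lam co χ n = lam ^ (N / 2 + n) • Φ.weylComp bg 1 co χ n := by
  have hlin : ∀ (c : ℂ) (f : Gen A) (n : ℕ),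
      (bg.D 1 χ .y .y)^[n] (c • f) = c • (bg.D 1 χ .y .y)^[n] f := by
    intro c f n
    induction n with
    | zero => rfl
    | succ n ih =>
      rw [Function.iterate_succ_apply', ih, (isLinearMap_D bg 1 χ _ _).map_smul,
        Function.iterate_succ_apply']
  rw [FronsdalField.weylComp, FronsdalField.weylComp, D_iterate, D_iterate bg lam χ .y .p, hlin,
    (isLinearMap_mulK _).map_smul, (isLinearMap_mulK _).map_smul, smul_smul, smul_smul, smul_smul,
    pow_add]
  congr 1
  ring

/-- The factor `D(y, p̄)` occurs `N / 2` times, and `D(y, ȳ)` occurs as often as the smaller of the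
two degrees. -/
theorem graded_weyl {N : ℕ} (Φ : FronsdalField A N) (bg : Background) (co : Coefficients) :
    Graded (fun lam => Φ.weyl bg lam co) (weylOrder N) (WeylDeg N) := by
  constructor
  · intro lam μ
    simp only [FronsdalField.weyl]
    split_ifs with h1 h2
    · rw [weylComp_eq_smul, Pi.smul_apply]
      congr 2
      simp only [weylOrder, bideg]
      omega
    · rw [weylComp_eq_smul, Pi.smul_apply]
      congr 2
      simp only [weylOrder, bideg]
      omega
    · simp
  · intro lam μ h
    simp only [FronsdalField.weyl] at h
    split_ifs at h with h1 h2
    · exact Or.inl h1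
    · exact Or.inr h2
    · exact absurd rfl h

/-! ### Degrees of the monomials of a kernel -/

/-- Degrees of a monomial in the variables of each leg and chirality. -/
def legDeg (d : Fin 3 × Var →₀ ℕ) : Fin 3 → Bool → ℕ := fun i χ => ∑ a, d (i, (χ, a))

/-- Increase of the degree in the variables of leg `i` and chirality `χ` by one. -/
def inc (v : Fin 3 → Bool → ℕ) (i : Fin 3) (χ : Bool) : Fin 3 → Bool → ℕ :=
  fun j c => v j c + if j = i ∧ c = χ then 1 else 0

/-- Multiplication by `p` takes monomials with degrees in `Q` to monomials with degrees in `R`. -/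
def Step (Q R : (Fin 3 → Bool → ℕ) → Prop) (p : Sym) : Prop :=
  ∀ d e, Q (legDeg d) → MvPolynomial.coeff e p ≠ 0 → R (legDeg (d + e))

variable {Q R S : (Fin 3 → Bool → ℕ) → Prop}

/-- A nonzero coefficient of a product comes from a splitting of the exponent with both coefficients
nonzero, so steps compose like transitions between sets of degrees. -/
theorem Step.mul {p q : Sym} (hp : Step Q R p) (hq : Step R S q) : Step Q S (p * q) := by
  classical
  intro d e hd he
  rw [MvPolynomial.coeff_mul] at he
  obtain ⟨⟨x, y⟩, hxy, hne⟩ := Finset.exists_ne_zero_of_sum_ne_zero he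
  rw [← Finset.HasAntidiagonal.mem_antidiagonal.1 hxy, ← add_assoc]
  exact hq _ _ (hp _ _ hd (left_ne_zero_of_mul hne)) (right_ne_zero_of_mul hne)

theorem Step.add {p q : Sym} (hp : Step Q R p) (hq : Step Q R q) : Step Q R (p + q) := by
  intro d e hd he
  rw [MvPolynomial.coeff_add] at he
  by_cases h : MvPolynomial.coeff e p = 0
  · exact hq d e hd fun h' => he (by rw [h, h', add_zero])
  · exact hp d e hd h

theorem Step.neg {p : Sym} (hp : Step Q R p) : Step Q R (-p) := by
  intro d e hd he
  rw [MvPolynomial.coeff_neg] at he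
  exact hp d e hd (neg_ne_zero.1 he)

theorem Step.sub {p q : Sym} (hp : Step Q R p) (hq : Step Q R q) : Step Q R (p - q) := by
  rw [sub_eq_add_neg]
  exact hp.add hq.neg

theorem Step.C_mul {p : Sym} (hp : Step Q R p) (c : ℂ) : Step Q R (MvPolynomial.C c * p) := by
  intro d e hd he
  rw [MvPolynomial.coeff_C_mul] at he
  exact hp d e hd (right_ne_zero_of_mul he)

theorem Step.sum {ι : Type*} (s : Finset ι) {p : ι → Sym} (h : ∀ i, Step Q R (p i)) :
    Step Q R (∑ i ∈ s, p i) := by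
  intro d e hd he
  rw [MvPolynomial.coeff_sum] at he
  obtain ⟨i, -, hi⟩ := Finset.exists_ne_zero_of_sum_ne_zero he
  exact h i d e hd hi

theorem Step.one (h : ∀ v, Q v → R v) : Step Q R 1 := by
  classical
  intro d e hd he
  rw [MvPolynomial.coeff_one] at he
  split_ifs at he with h0
  · subst h0
    rw [add_zero]
    exact h _ hd
  · exact absurd rfl he

theorem Step.leg {i : Fin 3} {χ : Bool} (a : Fin 2) (h : ∀ v, Q v → R (inc v i χ)) :
    Step Q R (leg i χ a) := by
  classical
  intro d e hd he
  rw [HigherSpin.leg, MvPolynomial.coeff_X] at he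
  split_ifs at he with h0
  · subst h0
    convert h _ hd using 1
    funext j c
    simp only [legDeg, inc, Finsupp.add_apply, Finset.sum_add_distrib, Finsupp.single_apply,
      Prod.mk.injEq]
    congr 1
    by_cases hj : j = i ∧ c = χ
    · obtain ⟨rfl, rfl⟩ := hj
      simp
    · rw [if_neg hj]
      refine Finset.sum_eq_zero fun x _ => if_neg ?_
      rintro ⟨rfl, rfl, -⟩
      exact hj ⟨rfl, rfl⟩
  · exact absurd rfl he

theorem Step.pow {p : Sym} (h : Step Q Q p) (j : ℕ) : Step Q Q (p ^ j) := by
  induction j with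
  | zero => rw [pow_zero]; exact Step.one fun _ => id
  | succ j ih => rw [pow_succ]; exact ih.mul h

theorem Step.py {i : Fin 3} {χ : Bool} (h : ∀ v, Q v → Q (inc (inc v i χ) 0 χ)) :
    Step Q Q (py χ i) :=
  Step.sum _ fun a => (Step.leg (R := fun v => Q (inc v 0 χ)) a h).mul (Step.leg a fun _ hv => hv)

theorem Step.pp {i j : Fin 3} {χ : Bool} (h : ∀ v, Q v → Q (inc (inc v i χ) j χ)) :
    Step Q Q (pp χ i j) :=
  Step.sum _ fun a => Step.sum _ fun b => by
    rw [mul_assoc]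
    exact ((Step.leg (R := fun v => Q (inc v j χ)) a h).mul (Step.leg b fun _ hv => hv)).C_mul _

theorem legDeg_zero : legDeg 0 = 0 := by
  funext i χ
  simp [legDeg]

theorem legDeg_joinExpo (μ ν ρ : Expo) :
    legDeg (joinExpo μ ν ρ) = ![bideg μ, bideg ν, bideg ρ] := by
  funext i χ
  fin_cases i <;> simp [legDeg, joinExpo, bideg, deg]

/-- The relation `Q` is an invariant: the prefactor reaches it from degree zero, and every factor
`q` of every term `G q ^ j` preserves it. -/
theorem expKernel_support {G q : Sym} (hG : Step (fun v => v = 0) Q G) (hq : Step Q Q q)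
    {μ ν ρ : Expo} (h : expKernel G q μ ν ρ ≠ 0) : Q ![bideg μ, bideg ν, bideg ρ] := by
  obtain ⟨j, -, hj⟩ := Finset.exists_ne_zero_of_sum_ne_zero h
  have := (hG.mul (hq.pow j)) 0 (joinExpo μ ν ρ) legDeg_zero fun h0 => hj (by rw [h0, zero_div])
  rwa [zero_add, legDeg_joinExpo] at this

/-- The exponent of the star product. -/
def starExponent : Sym := ∑ χ, MvPolynomial.C Complex.I * (-pp χ 1 2 + py χ 1 + py χ 2)

theorem starKernel_eq : starKernel = expKernel 1 starExponent := rfl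

/-- Legs `w`, `c` are the two factors. -/
def Legs (w c : Fin 3) : Prop := (w = 1 ∧ c = 2) ∨ (w = 2 ∧ c = 1)

/-- Degrees in the star product kernel multiplied by `s χ` factors `p_c` of each chirality. -/
def StarRel (s : Bool → ℕ) (w c : Fin 3) (v : Fin 3 → Bool → ℕ) : Prop :=
  ∀ χ, v 0 χ + s χ ≤ v w χ + v c χ ∧ v w χ + s χ ≤ v 0 χ + v c χ ∧
    v c χ ≤ v 0 χ + v w χ + s χ ∧ (v 0 χ + v w χ + v c χ + s χ) % 2 = 0

/-- Each bilinear in the exponent raises two of the three legs of one chirality by one. This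
preserves the parity and the triangle inequalities satisfied after `s` is subtracted from the degree
of leg `c`. -/
theorem starExponent_step (s : Bool → ℕ) {w c : Fin 3} (h : Legs w c) :
    Step (StarRel s w c) (StarRel s w c) starExponent := by
  refine Step.sum _ fun χ => Step.C_mul (Step.add (Step.add (Step.neg (Step.pp ?_))
    (Step.py ?_)) (Step.py ?_)) _ <;> intro v hv χ' <;> have := hv χ' <;>
  rcases h with ⟨rfl, rfl⟩ | ⟨rfl, rfl⟩ <;> by_cases hχ : χ' = χ <;> simp [inc, hχ] at this ⊢ <;>
  omega

/-- Degrees in the kernel of `Υ(Ω, ω, C)`. -/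
def WCRel (χ : Bool) (w c : Fin 3) (v : Fin 3 → Bool → ℕ) : Prop :=
  v w χ = v c χ + v 0 χ + 1 ∧ v 0 (!χ) + 1 ≤ v w (!χ) + v c (!χ) ∧
    v w (!χ) ≤ v 0 (!χ) + v c (!χ) + 1 ∧ v c (!χ) ≤ v 0 (!χ) + v w (!χ) + 1 ∧
    (v 0 (!χ) + v w (!χ) + v c (!χ)) % 2 = 1

/-- Degrees in the kernel of `Υ(Ω, Ω, C, C)`. -/
def CCRel (χ : Bool) (v : Fin 3 → Bool → ℕ) : Prop :=
  v 0 χ = v 1 χ + v 2 χ ∧ v 0 (!χ) + 2 ≤ v 1 (!χ) + v 2 (!χ) ∧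
    v 1 (!χ) ≤ v 0 (!χ) + v 2 (!χ) + 2 ∧ v 2 (!χ) ≤ v 0 (!χ) + v 1 (!χ) + 2 ∧
    (v 0 (!χ) + v 1 (!χ) + v 2 (!χ)) % 2 = 0

/-- Degrees in the kernel of `Υ(Ω, C, C)`. -/
def ZeroCCRel (χ : Bool) (v : Fin 3 → Bool → ℕ) : Prop :=
  v 0 χ = v 1 χ + v 2 χ + 1 ∧ v 0 (!χ) + 1 ≤ v 1 (!χ) + v 2 (!χ) ∧
    v 1 (!χ) ≤ v 0 (!χ) + v 2 (!χ) + 1 ∧ v 2 (!χ) ≤ v 0 (!χ) + v 1 (!χ) + 1 ∧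
    (v 0 (!χ) + v 1 (!χ) + v 2 (!χ)) % 2 = 1

/-! ### Degree relations satisfied by the kernels of the vertices. -/

theorem starKernel_support {w c : Fin 3} (h : Legs w c) {μ ν ρ : Expo}
    (hF : starKernel μ ν ρ ≠ 0) : StarRel 0 w c ![bideg μ, bideg ν, bideg ρ] := by
  refine expKernel_support (Step.one ?_) (starExponent_step 0 h) hF
  rintro v rfl χ
  simp

/-- The relation holds for the integrand at every `t`; where it fails the integrand vanishes
identically. In chirality `χ` the leg `c` is not paired with `Y`, which makes the first condition an
equality. -/
theorem kernelWC_support {χ : Bool} {w c : Fin 3} (h : Legs w c) {σ : ℂ} {ι : Bool → Fin 2}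
    {μ ν ρ : Expo} (hF : kernelWC χ w c σ ι μ ν ρ ≠ 0) :
    WCRel χ w c ![bideg μ, bideg ν, bideg ρ] := by
  by_contra hn
  refine hF ?_
  rw [kernelWC]
  convert intervalIntegral.integral_zero with t
  by_contra ht
  refine hn (expKernel_support ?_ ?_ ht)
  · refine Step.mul (R := fun v => v = inc 0 w χ) (Step.leg _ ?_)
      (Step.add (Step.C_mul (Step.leg _ ?_) _) (Step.leg _ ?_)) <;> rintro v rfl
    · rfl
    all_goals
      rcases h with ⟨rfl, rfl⟩ | ⟨rfl, rfl⟩ <;> simp [inc, WCRel]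
  · refine Step.add (Step.add (Step.sub (Step.add (Step.C_mul (Step.pp ?_) _)
      (Step.C_mul (Step.py ?_) _)) (Step.C_mul (Step.pp ?_) _)) (Step.C_mul (Step.py ?_) _))
      (Step.C_mul (Step.py ?_) _) <;> intro v hv <;>
    rcases h with ⟨rfl, rfl⟩ | ⟨rfl, rfl⟩ <;> simp [inc, WCRel] at hv ⊢ <;> omega

theorem kernelCCAux_support {χ : Bool} {a b : Fin 2} {t₁ t₂ t₃ t₄ : ℝ} {μ ν ρ : Expo}
    (hF : kernelCCAux χ a b t₁ t₂ t₃ t₄ μ ν ρ ≠ 0) :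
    CCRel χ ![bideg μ, bideg ν, bideg ρ] := by
  refine expKernel_support ?_ ?_ hF
  · refine Step.mul (R := fun v => v = inc 0 1 (!χ) ∨ v = inc 0 2 (!χ))
      (Step.sub (Step.C_mul (Step.leg _ ?_) _) (Step.C_mul (Step.leg _ ?_) _))
      (Step.sub (Step.C_mul (Step.leg _ ?_) _) (Step.C_mul (Step.leg _ ?_) _))
    · rintro v rfl
      exact Or.inl rfl
    · rintro v rfl
      exact Or.inr rfl
    all_goals
      rintro v (rfl | rfl) <;> simp [inc, CCRel]
  · refine Step.sub (Step.add (Step.sub (Step.sub (Step.C_mul (Step.py ?_) _)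
      (Step.C_mul (Step.py ?_) _)) (Step.C_mul (Step.pp ?_) _)) (Step.C_mul (Step.py ?_) _))
      (Step.C_mul (Step.py ?_) _) <;> intro v hv <;> simp [inc, CCRel] at hv ⊢ <;> omega

/-- Outside the relation the integrand is zero for all parameters, and so are its integrals and the
derivative in `r`; no regularity in the parameters enters. -/
theorem kernelCC_support {χ : Bool} {a b : Fin 2} {μ ν ρ : Expo}
    (hF : kernelCC χ a b μ ν ρ ≠ 0) : CCRel χ ![bideg μ, bideg ν, bideg ρ] := by
  by_contra hn
  have h0 : ∀ t₁ t₂ t₃ t₄ : ℝ, kernelCCAux χ a b t₁ t₂ t₃ t₄ μ ν ρ = 0 := fun t₁ t₂ t₃ t₄ => by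
    by_contra ht
    exact hn (kernelCCAux_support ht)
  exact hF (by simp [kernelCC, h0])

theorem kernel0CC_support {χ : Bool} {ι : Bool → Fin 2} {μ ν ρ : Expo}
    (hF : kernel0CC χ ι μ ν ρ ≠ 0) : ZeroCCRel χ ![bideg μ, bideg ν, bideg ρ] := by
  by_contra hn
  refine hF ?_
  rw [kernel0CC]
  convert intervalIntegral.integral_zero with t
  by_contra ht
  refine hn (expKernel_support ?_ ?_ ht)
  · refine Step.mul (R := fun v => v = inc 0 0 χ) (Step.sum _ fun b => Step.C_mul (Step.leg _ ?_) _)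
      (Step.sub (Step.C_mul (Step.leg _ ?_) _) (Step.C_mul (Step.leg _ ?_) _)) <;> rintro v rfl
    · rfl
    all_goals simp [inc, ZeroCCRel]
  · refine Step.add (Step.add (Step.sub (Step.sub (Step.C_mul (Step.py ?_) _)
      (Step.C_mul (Step.py ?_) _)) (Step.C_mul (Step.pp ?_) _)) (Step.C_mul (Step.py ?_) _))
      (Step.C_mul (Step.py ?_) _) <;> intro v hv <;> simp [inc, ZeroCCRel] at hv ⊢ <;> omega

/-! ### Vertices of homogeneous fields -/

/-- Supplies a finite index set, the same for all `lam`, for the `finsum` in `Kernel.apply`. -/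
theorem finite_degree_le (B : ℕ) : {μ : Expo | deg true μ + deg false μ ≤ B}.Finite := by
  refine (Set.finite_Iic (Finsupp.equivFunOnFinite.symm fun _ : Var => B)).subset ?_
  intro μ hμ v
  obtain ⟨χ, a⟩ := v
  have h : μ (χ, a) ≤ deg χ μ :=
    Finset.single_le_sum (f := fun a => μ (χ, a)) (fun _ _ => Nat.zero_le _) (Finset.mem_univ a)
  simp only [Set.mem_ofPred_eq] at hμ
  simp only [Finsupp.equivFunOnFinite_symm_apply_apply]
  cases χ <;> omega

theorem twMul_smul (ρ : Expo) (x y : ℂ) (u v : Klein → SmoothFun A) :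
    twMul ρ (x • u) (y • v) = (x * y) • twMul ρ u v := by
  funext κ
  simp only [twMul, Pi.smul_apply, Finset.smul_sum]
  refine Finset.sum_congr rfl fun κ₁ _ => ?_
  rw [smul_mul_assoc, mul_smul_comm, smul_smul x y, smul_comm]

theorem twMul_zero_left (ρ : Expo) (v : Klein → SmoothFun A) : twMul ρ 0 v = 0 := by
  simpa using twMul_smul ρ 0 1 (0 : Klein → SmoothFun A) v

theorem twMul_zero_right (ρ : Expo) (u : Klein → SmoothFun A) : twMul ρ u 0 = 0 := by
  simpa using twMul_smul ρ 1 0 u (0 : Klein → SmoothFun A)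

theorem apply_term_ne_zero {F : Kernel} {f g : Gen A} {μ : Expo} {p : Expo × Expo}
    (h : (F μ p.1 p.2 * pairing p.1 * pairing p.2) • twMul p.2 (f p.1) (g p.2) ≠ 0) :
    F μ p.1 p.2 ≠ 0 ∧ f p.1 ≠ 0 ∧ g p.2 ≠ 0 := by
  refine ⟨fun h0 => h ?_, fun h0 => h ?_, fun h0 => h ?_⟩
  · simp [h0]
  · rw [h0, twMul_zero_left, smul_zero]
  · rw [h0, twMul_zero_right, smul_zero]

/-- The number of derivatives in a bidegree component of a vertex. -/
theorem PolyIn.apply {F : Kernel} {f g : ℂ → Gen A} {d e : (Bool → ℕ) → ℕ}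
    {P P' : (Bool → ℕ) → Prop} (hf : Graded f d P) (hg : Graded g e P')
    (hF : ∀ μ ν ρ, F μ ν ρ ≠ 0 → R ![bideg μ, bideg ν, bideg ρ]) (m : Bool → ℕ) (B : ℕ)
    (hB : ∀ a b, R ![m, a, b] → P a → P' b → a true + a false ≤ B ∧ b true + b false ≤ B)
    {T : Set ℕ} (hT : ∀ a b, R ![m, a, b] → P a → P' b → d a + e b ∈ T) :
    PolyIn (fun lam => comp m (F.apply (f lam) (g lam))) T := by
  -- The bound `B` depends on `m` but not on `lam` or on the individual monomial of the output, so
  -- one finite set of pairs serves for all of them.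
  have hfin := ((finite_degree_le B).prod (finite_degree_le B))
  refine PolyIn.of_sum hfin.toFinset (fun p => d (bideg p.1) + e (bideg p.2))
    (fun p => comp m fun μ => (F μ p.1 p.2 * pairing p.1 * pairing p.2) •
      twMul p.2 (f 1 p.1) (g 1 p.2)) ?_ ?_
  · intro p _ hp
    obtain ⟨μ, hμ⟩ := Function.ne_iff.1 hp
    simp only [comp] at hμ
    split_ifs at hμ with hm
    · obtain ⟨h1, h2, h3⟩ := apply_term_ne_zero hμ
      refine hT _ _ ?_ (hf.support _ _ h2) (hg.support _ _ h3)
      have := hF _ _ _ h1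
      rwa [show bideg μ = m from funext hm] at this
    · exact absurd rfl hμ
  · intro lam
    funext μ
    simp only [Finset.sum_apply, Pi.smul_apply, comp]
    split_ifs with hm
    · rw [Kernel.apply, finsum_eq_sum_of_support_subset]
      · refine Finset.sum_congr rfl fun p _ => ?_
        rw [hf.eq_smul lam, hg.eq_smul lam, twMul_smul, ← pow_add, smul_comm]
      · intro p hp
        obtain ⟨h1, h2, h3⟩ := apply_term_ne_zero hp
        have := hF _ _ _ h1
        rw [show bideg μ = m from funext hm] at this
        have := hB _ _ this (hf.support _ _ h2) (hg.support _ _ h3)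
        simpa [bideg] using this
    · simp

/-! ### Currents in the one-form sector -/

theorem isLinearMap_twoForm_at (χ : Bool) (u v : Slot) :
    IsLinearMap ℂ fun B : TwoForm A => B.at χ u v :=
  IsLinearMap.fin_sum _ fun a => IsLinearMap.fin_sum _ fun b =>
    (isLinearMap_act u χ a).comp' ((isLinearMap_act v χ b).comp' ⟨fun _ _ => rfl, fun _ _ => rfl⟩)

/-- Diagonal components enter only for bosons and always under one `D`, hence the shift of
exponents. A contraction whose first-acting slot is `y` has the form `y y` in a chirality of not
larger degree; this is what makes the count for `Υ(Ω,Ω,C,C)` exact. -/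
theorem carries_currentOne (bg : Background) (N : ℕ) {B : ℂ → TwoForm A} {T : Set ℕ}
    (h : ∀ (m : Bool → ℕ) (c : Bool) (u v : Slot), m true + m false + 2 = N →
      m true ≤ m false + 2 → m false ≤ m true + 2 → (v = .y → u = .y ∧ m c ≤ m (!c)) →
      PolyIn (fun lam => ((B lam).part m).at c u v)
        {k | k + (if m true = m false then 1 else 0) ∈ T}) :
    Carries (fun lam => currentOne bg lam N (B lam)) T := by
  have h₀ : ∀ (χ : Bool) (m n : ℕ) (c : Bool) (u v : Slot), m + n + 2 = N → n < m → m ≤ n + 2 →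
      (v = .y → u = .y ∧ c = !χ) →
      PolyIn (fun lam => ((B lam).part (pair χ m n)).at c u v) T := by
    intro χ m n c u v h1 h2 h3 h4
    have := h (pair χ m n) c u v (by cases χ <;> simp [pair] <;> omega)
      (by cases χ <;> simp [pair] <;> omega) (by cases χ <;> simp [pair] <;> omega)
      (fun hv => ⟨(h4 hv).1, by rw [(h4 hv).2]; simp [pair]; omega⟩)
    refine this.mono fun k hk => ?_
    rwa [Set.mem_ofPred_eq, if_neg (by cases χ <;> simp [pair] <;> omega), add_zero] at hk
  have h₁ : ∀ (χ : Bool) (m : ℕ) (c : Bool) (u v : Slot), m + m + 2 = N → (v = .y → u = .y) →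
      PolyIn (fun lam => ((B lam).part (pair χ m m)).at c u v) {k | k + 1 ∈ T} := by
    intro χ m c u v h1 h4
    have := h (pair χ m m) c u v (by simp [pair]; omega)
      (by simp [pair]) (by simp [pair])
      (fun hv => ⟨h4 hv, by simp [pair]⟩)
    simpa [pair] using this
  refine carries_of_components fun l => ?_
  by_cases hN : Even N
  · simp only [currentOne, if_pos hN]
    obtain ⟨s, rfl⟩ := hN
    rw [show (s + s) / 2 = s by omega]
    rcases l with (_ | _) | (_ | _) | (_ | _)
    · by_cases h2 : 2 ≤ s + s
      · simp only [if_pos h2]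
        refine PolyIn.sum _ fun χ _ => PolyIn.add ?_ (PolyIn.smul (PolyIn.add (PolyIn.D ?_ _ _ _ _)
          (PolyIn.smul (PolyIn.D ?_ _ _ _ _) _)) _)
        · split_ifs with h4
          · exact (h₀ _ _ _ _ _ _ (by omega) (by omega) (by omega) (by simp)).smul _
          · exact PolyIn.zero _
        · exact h₁ _ _ _ _ _ (by omega) (by simp)
        · exact h₁ _ _ _ _ _ (by omega) (by simp)
      · simp only [if_neg h2]
        exact PolyIn.zero _
    · exact PolyIn.zero _
    · by_cases h2 : 4 ≤ s + s
      · simp only [if_pos h2]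
        refine PolyIn.sum _ fun χ _ => PolyIn.add ?_ (PolyIn.smul (PolyIn.sub (PolyIn.D ?_ _ _ _ _)
          (PolyIn.smul (PolyIn.D ?_ _ _ _ _) _)) _)
        · exact (h₀ _ _ _ _ _ _ (by omega) (by omega) (by omega) (by simp)).smul _
        · exact h₁ _ _ _ _ _ (by omega) (by simp)
        · exact h₁ _ _ _ _ _ (by omega) (by simp)
      · simp only [if_neg h2]
        exact PolyIn.zero _
    · exact PolyIn.zero _
    · exact PolyIn.zero _
    · exact PolyIn.zero _
  · by_cases h3 : 3 ≤ N
    · simp only [currentOne, if_neg hN, if_pos h3]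
      obtain ⟨s, rfl⟩ := Nat.not_even_iff_odd.1 hN
      rcases l with χ | χ | χ
      · exact (h₀ _ _ _ _ _ _ (by omega) (by omega) (by omega) (by simp)).smul _
      · exact (h₀ _ _ _ _ _ _ (by omega) (by omega) (by omega) (by simp)).smul _
      · exact (((h₀ _ _ _ _ _ _ (by omega) (by omega) (by omega) (by simp)).smul _).add
          ((h₀ _ _ _ _ _ _ (by omega) (by omega) (by omega) (by simp)).smul _)).smul _
    · simp only [currentOne, if_neg hN, if_neg h3]
      exact PolyIn.zero _

theorem carries_currentOne_of_part (bg : Background) (N : ℕ) {B : ℂ → TwoForm A} {T : Set ℕ}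
    (h : ∀ m : Bool → ℕ, m true + m false + 2 = N → m true ≤ m false + 2 → m false ≤ m true + 2 →
      PolyIn (fun lam => (B lam).part m) {k | k + (if m true = m false then 1 else 0) ∈ T}) :
    Carries (fun lam => currentOne bg lam N (B lam)) T :=
  carries_currentOne bg N fun m c u v h1 h2 h3 _ =>
    (h m h1 h2 h3).map (isLinearMap_twoForm_at c u v)

theorem comp_mulK (m : Bool → ℕ) (χ : Bool) (f : Gen A) :
    comp m (mulK χ f) = mulK χ (comp m f) := by
  funext μ κ
  simp only [comp, mulK]
  split_ifs <;> rfl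

theorem PolyIn.wedge {W : ℂ → (Bool → Fin 2) → (Bool → Fin 2) → Gen A} {m : Bool → ℕ} {T : Set ℕ}
    (h : ∀ ι ι', PolyIn (fun lam => comp m (W lam ι ι')) T) :
    PolyIn (fun lam => (wedge (W lam)).part m) T := by
  refine PolyIn.pi fun χ => PolyIn.pi fun a => PolyIn.pi fun b => ?_
  have hlin := isLinearMap_comp (A := A) m
  simp only [TwoForm.part, HigherSpin.wedge, hlin.sum_map, hlin.map_smul, hlin.map_add]
  exact PolyIn.sum _ fun c _ => PolyIn.sum _ fun d _ => ((h _ _).add (h _ _)).smul _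

theorem PolyIn.twoForm_part_add {B B' : ℂ → TwoForm A} {m : Bool → ℕ} {T : Set ℕ}
    (h : PolyIn (fun lam => (B lam).part m) T) (h' : PolyIn (fun lam => (B' lam).part m) T) :
    PolyIn (fun lam => (B lam + B' lam).part m) T := by
  have : ∀ lam, (B lam + B' lam).part m = (B lam).part m + (B' lam).part m := fun lam => by
    funext χ a b
    exact (isLinearMap_comp m).map_add _ _
  simp only [this]
  exact h.add h'

/-! ### The tables in terms of doubled spins -/

theorem two_mul_spin (N : ℕ) : 2 * spin N = N := by
  rw [spin]; ring

theorem triangle_iff {N₁ N₂ N₃ : ℕ} : Triangle (spin N₁) (spin N₂) (spin N₃) ↔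
    N₃ + 2 ≤ N₁ + N₂ ∧ N₂ + 2 ≤ N₁ + N₃ ∧ N₁ + 2 ≤ N₂ + N₃ := by
  simp only [Triangle, spin]
  have key : ∀ a b c : ℕ, (a : ℚ) / 2 + 1 ≤ b / 2 + c / 2 ↔ a + 2 ≤ b + c := by
    intro a b c
    rw [← Nat.cast_le (α := ℚ)]
    push_cast
    constructor <;> intro h <;> linarith
  rw [key, key, key]

theorem spin_eq_iff {a b c : ℕ} : spin a = spin b + spin c ↔ a = b + c := by
  rw [← Nat.cast_inj (R := ℚ)]
  push_cast
  simp only [spin]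
  constructor <;> intro h <;> linarith

theorem spin_lt_iff {a b c : ℕ} : spin a + spin b < spin c ↔ a + b < c := by
  rw [← Nat.cast_lt (α := ℚ)]
  push_cast
  simp only [spin]
  constructor <;> intro h <;> linarith

theorem spin_le_iff {a b c : ℕ} : spin a + spin b ≤ spin c ↔ a + b ≤ c := by
  rw [← Nat.cast_le (α := ℚ)]
  push_cast
  simp only [spin]
  constructor <;> intro h <;> linarith

theorem two_mul_min_spin (a b : ℕ) : 2 * min (spin a) (spin b) = ((min a b : ℕ) : ℚ) := by
  rw [mul_min_of_nonneg _ _ (by norm_num), two_mul_spin, two_mul_spin, Nat.cast_min]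

theorem two_mul_max_spin (a b : ℕ) : 2 * max (spin a) (spin b) = ((max a b : ℕ) : ℚ) := by
  rw [mul_max_of_nonneg _ _ (by norm_num), two_mul_spin, two_mul_spin, Nat.cast_max]

theorem min_spin (a b : ℕ) : min (spin a) (spin b) = spin (min a b) := by
  have := two_mul_min_spin a b
  have := two_mul_spin (min a b)
  linarith

theorem le_sumS_sub_iff {k a N₁ N₂ N₃ : ℕ} :
    (k : ℚ) ≤ sumS N₁ N₂ N₃ - a ↔ k + a ≤ N₁ / 2 + N₂ / 2 + N₃ / 2 := by
  rw [sumS, ← Nat.cast_le (α := ℚ), Nat.cast_add k a]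
  constructor <;> intro h <;> linarith

theorem eq_sumS_sub_iff {k a N₁ N₂ N₃ : ℕ} :
    (k : ℚ) = sumS N₁ N₂ N₃ - a ↔ k + a = N₁ / 2 + N₂ / 2 + N₃ / 2 := by
  rw [sumS, ← Nat.cast_inj (R := ℚ), Nat.cast_add k a]
  constructor <;> intro h <;> linarith

theorem le_sumS_iff {k N₁ N₂ N₃ : ℕ} :
    (k : ℚ) ≤ sumS N₁ N₂ N₃ ↔ k ≤ N₁ / 2 + N₂ / 2 + N₃ / 2 := by
  rw [sumS, Nat.cast_le]

theorem eq_sumS_iff {k N₁ N₂ N₃ : ℕ} :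
    (k : ℚ) = sumS N₁ N₂ N₃ ↔ k = N₁ / 2 + N₂ / 2 + N₃ / 2 := by
  rw [sumS, Nat.cast_inj]

theorem mem_tableWW_iff {N₁ N₂ N₃ k : ℕ} {τ₂ τ₃ : Bool} : k ∈ tableWW N₁ N₂ N₃ τ₂ τ₃ ↔
    (N₃ + 2 ≤ N₁ + N₂ ∧ N₂ + 2 ≤ N₁ + N₃ ∧ N₁ + 2 ≤ N₂ + N₃) ∧
      if τ₂ = τ₃ then k + N₁ ≤ N₁ / 2 + N₂ / 2 + N₃ / 2
      else k + max N₂ N₃ ≤ N₁ / 2 + N₂ / 2 + N₃ / 2 := by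
  simp only [tableWW, Set.mem_ofPred_eq, triangle_iff, two_mul_spin, two_mul_max_spin]
  split_ifs <;> rw [le_sumS_sub_iff]

theorem mem_tableWC_iff {N₁ N₂ N₃ k : ℕ} {τ₂ τ₃ : Bool} : k ∈ tableWC N₁ N₂ N₃ τ₂ τ₃ ↔
    ((N₃ + 2 ≤ N₁ + N₂ ∧ N₂ + 2 ≤ N₁ + N₃ ∧ N₁ + 2 ≤ N₂ + N₃) ∧
      k + min N₁ (min N₂ N₃) ≤ N₁ / 2 + N₂ / 2 + N₃ / 2) ∨
    (N₂ = N₁ + N₃ ∧ k + min N₁ N₃ ≤ N₁ / 2 + N₂ / 2 + N₃ / 2) ∨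
    (N₃ = N₁ + N₂ ∧ k + min N₁ N₂ ≤ N₁ / 2 + N₂ / 2 + N₃ / 2) ∨
    (N₁ + N₃ < N₂ ∧ if τ₂ = τ₃ then k ≤ N₁ / 2 + N₂ / 2 + N₃ / 2
      else k + min N₁ N₃ ≤ N₁ / 2 + N₂ / 2 + N₃ / 2) ∨
    (N₁ + N₂ < N₃ ∧ if τ₂ = τ₃ then k ≤ N₁ / 2 + N₂ / 2 + N₃ / 2
      else k + min N₁ N₂ ≤ N₁ / 2 + N₂ / 2 + N₃ / 2) := by
  simp only [tableWC, Set.mem_ofPred_eq, triangle_iff, min_spin, two_mul_spin, spin_eq_iff,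
    spin_lt_iff]
  split_ifs <;> simp only [le_sumS_sub_iff, le_sumS_iff]

theorem mem_tableCC_iff {N₁ N₂ N₃ k : ℕ} {τ₂ τ₃ : Bool} : k ∈ tableCC N₁ N₂ N₃ τ₂ τ₃ ↔
    (τ₂ = τ₃ ∧ ((N₃ + 2 ≤ N₁ + N₂ ∧ N₂ + 2 ≤ N₁ + N₃ ∧ N₁ + 2 ≤ N₂ + N₃) ∨ N₂ = N₁ + N₃ ∨
        N₃ = N₁ + N₂ ∨ N₂ + N₃ ≤ N₁) ∧ k = N₁ / 2 + N₂ / 2 + N₃ / 2) ∨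
    (τ₂ ≠ τ₃ ∧ N₂ + N₃ ≤ N₁ ∧ k + min N₂ N₃ = N₁ / 2 + N₂ / 2 + N₃ / 2) := by
  simp only [tableCC, Set.mem_ofPred_eq, triangle_iff, min_spin, two_mul_spin, spin_eq_iff,
    spin_le_iff, eq_sumS_iff, eq_sumS_sub_iff]

/-! ### Counting of derivatives in the one-form sector -/

/-- Bidegrees of the components that enter the current of spin `N / 2`. -/
def CurrentDeg (N : ℕ) (m : Bool → ℕ) : Prop :=
  m true + m false + 2 = N ∧ m true ≤ m false + 2 ∧ m false ≤ m true + 2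

/-- The additional derivative in the projection of the diagonal components to the current. -/
def diagOrder (m : Bool → ℕ) : ℕ := if m true = m false then 1 else 0


/-- The parity of `N` is the remainder lost in halving, so the count becomes linear in the degrees.
-/
theorem two_mul_gaugeOrder {N : ℕ} {a : Bool → ℕ} {τ : Bool} (ha : GaugeDeg N a)
    (hτ : a (!τ) ≤ a τ) : 2 * gaugeOrder a + N % 2 + a (!τ) = a τ := by
  simp only [GaugeDeg, gaugeOrder] at *
  cases τ <;> simp only [Bool.not_true, Bool.not_false] at * <;> omega

/-- On the diagonal the extra derivative uses up the slack `2`. Off the diagonal the degrees differ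
by at most two, and by one when `N` is odd. -/
theorem two_mul_diagOrder_le {N : ℕ} {m : Bool → ℕ} (hm : CurrentDeg N m) (χ : Bool) :
    2 * diagOrder m + N % 2 + m χ ≤ m (!χ) + 2 := by
  obtain ⟨h1, h2, h3⟩ := hm
  rw [diagOrder]
  cases χ <;> simp only [Bool.not_true, Bool.not_false] <;> split_ifs <;> omega

theorem add_not (m : Bool → ℕ) (χ : Bool) : m true + m false = m χ + m (!χ) := by
  cases χ
  · exact add_comm _ _
  · rfl

theorem weylOrder_eq {N : ℕ} {b : Bool → ℕ} {χ : Bool} (h : b χ = N + b (!χ)) :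
    weylOrder N b = N / 2 + b (!χ) := by
  rw [weylOrder]
  cases χ <;> simp only [Bool.not_true, Bool.not_false] at * <;> omega

theorem weylDeg_cases {N : ℕ} {b : Bool → ℕ} (h : WeylDeg N b) (χ : Bool) :
    b χ = N + b (!χ) ∨ b (!χ) = N + b χ := by
  rcases h with h | h <;> cases χ <;> simp only [Bool.not_true, Bool.not_false] <;> omega

/-- Parity excludes sums one short of the triangle inequality, so its failure means equality or
strict excess on the other side. In each of the regions left by `hN`, the required minimum is at
most `N₁` and at most `N₃`. -/
theorem mem_tableWC_of_le {N₁ N₂ N₃ k : ℕ} (τ₂ τ₃ : Bool) (hpar : (N₁ + N₂ + N₃) % 2 = 0)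
    (hN : N₁ + 2 ≤ N₂ + N₃)
    (hk : k + N₁ ≤ N₁ / 2 + N₂ / 2 + N₃ / 2 ∨ k + N₃ ≤ N₁ / 2 + N₂ / 2 + N₃ / 2) :
    k ∈ tableWC N₁ N₂ N₃ τ₂ τ₃ := by
  rw [mem_tableWC_iff]
  generalize N₁ / 2 + N₂ / 2 + N₃ / 2 = s at *
  split_ifs <;> omega

/-- The triangle inequalities of the two chiralities add up to those of the spins; the shift by `2`
comes from total degree `N - 2`. For equal signs the bound follows from `m ≤ a + b` in the
subdominant chirality. For opposite signs it follows by bounding the dominant degree of either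
factor by the degrees of `m` and of the other factor. -/
theorem count_vertexWW {N₁ N₂ N₃ : ℕ} {m a b : Bool → ℕ} {τ₂ τ₃ : Bool} (hm : CurrentDeg N₁ m)
    (h : StarRel 0 1 2 ![m, a, b]) (ha : GaugeDeg N₂ a) (hb : GaugeDeg N₃ b)
    (hτ₂ : a (!τ₂) ≤ a τ₂) (hτ₃ : b (!τ₃) ≤ b τ₃) :
    gaugeOrder a + gaugeOrder b + diagOrder m ∈ tableWW N₁ N₂ N₃ τ₂ τ₃ := by
  rw [mem_tableWW_iff]
  have ga := two_mul_gaugeOrder ha hτ₂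
  have gb := two_mul_gaugeOrder hb hτ₃
  have hd1 := two_mul_diagOrder_le hm true
  have hd2 := two_mul_diagOrder_le hm false
  obtain ⟨hm1, -, -⟩ := hm
  obtain ⟨h1, h2, h3, -⟩ := h true
  obtain ⟨h1', h2', h3', -⟩ := h false
  have n1 := Nat.div_add_mod N₁ 2
  have n2 := Nat.div_add_mod N₂ 2
  have n3 := Nat.div_add_mod N₃ 2
  simp only [GaugeDeg, Matrix.cons_val, Pi.zero_apply, add_zero, Bool.not_true, Bool.not_false] at *
  refine ⟨⟨by linarith, by linarith, by linarith⟩, ?_⟩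
  cases τ₂ <;> cases τ₃ <;> simp only [Bool.not_true, Bool.not_false] at * <;>
    simp only [if_true, reduceCtorEq, if_false]
  · linarith
  · rw [← max_add_add_left, max_le_iff]; constructor <;> linarith
  · rw [← max_add_add_left, max_le_iff]; constructor <;> linarith
  · linarith
-- If `C` has its excess degree in chirality `χ`, the equality in `WCRel` forces `N₁ + N₃ < N₂`. If
-- the excess lies in the other chirality, then `N₁ + 2 ≤ N₂ + N₃` and the count is lower by `N₁` or
-- by `N₃`, according to the sign of the helicity of `ω`.
theorem count_vertexWC {N₁ N₂ N₃ : ℕ} {m a b : Bool → ℕ} {χ τ₂ τ₃ : Bool} (hm : CurrentDeg N₁ m)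
    (h : WCRel χ 1 2 ![m, a, b]) (ha : GaugeDeg N₂ a) (hb : WeylDeg N₃ b)
    (hτ₂ : a (!τ₂) ≤ a τ₂) (hτ₃ : b (!τ₃) ≤ b τ₃) :
    gaugeOrder a + weylOrder N₃ b + diagOrder m ∈ tableWC N₁ N₂ N₃ τ₂ τ₃ := by
  have ga := two_mul_gaugeOrder ha hτ₂
  have hd1 := two_mul_diagOrder_le hm χ
  have hd2 := two_mul_diagOrder_le hm (!χ)
  obtain ⟨hm1, -, -⟩ := hm
  have ha' : a true + a false + 2 = N₂ := ha
  rw [add_not _ χ] at ha' hm1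
  obtain ⟨e1, h1, h2, h3, h4⟩ := h
  have n1 := Nat.div_add_mod N₁ 2
  have n2 := Nat.div_add_mod N₂ 2
  have n3 := Nat.div_add_mod N₃ 2
  simp only [Matrix.cons_val, Bool.not_not] at *
  rcases weylDeg_cases hb χ with hc | hc
  · rw [weylOrder_eq hc, mem_tableWC_iff]
    right; right; right; left
    refine ⟨by linarith, ?_⟩
    rcases Bool.eq_or_eq_not τ₂ χ with rfl | rfl
    · have key : gaugeOrder a + (N₃ / 2 + b !τ₂) + diagOrder m ≤ N₁ / 2 + N₂ / 2 + N₃ / 2 := by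
        linarith
      split_ifs with hττ
      · exact key
      · have : τ₃ = !τ₂ := by cases τ₂ <;> cases τ₃ <;> simp_all
        subst this
        simp only [Bool.not_not] at hτ₃
        -- A zero-form component with both signs has equal degrees, hence spin zero; the minimum in
        -- the bound for opposite signs is then zero.
        have : N₃ = 0 := by omega
        subst this
        simpa using key
    · simp only [Bool.not_not] at *
      have key : gaugeOrder a + (N₃ / 2 + b !χ) + diagOrder m + N₁ ≤ N₁ / 2 + N₂ / 2 + N₃ / 2 := by
        linarith
      have := min_le_left N₁ N₃
      split_ifs <;> linarith
  · have hw : weylOrder N₃ b = N₃ / 2 + b χ := by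
      simpa using weylOrder_eq (χ := !χ) (by simpa using hc)
    rw [hw]
    refine mem_tableWC_of_le _ _ (by omega) (by linarith) ?_
    rcases Bool.eq_or_eq_not τ₂ χ with rfl | rfl
    · right
      linarith
    · left
      simp only [Bool.not_not] at *
      linarith

/-- By `CCRel`, `m χ = a χ + b χ`. If both zero-forms have their excess in `!χ`, these summands are
the smaller degrees and the count is `𝒮`. A factor with its excess in `χ` lowers the count by twice
its spin and forces `N₂ + N₃ ≤ N₁`; two such factors must both have spin zero. -/
theorem count_vertexCC {N₁ N₂ N₃ : ℕ} {m a b : Bool → ℕ} {χ τ₂ τ₃ : Bool} (hm : CurrentDeg N₁ m)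
    (hχ : m (!χ) ≤ m χ)
    (h : CCRel χ ![m, a, b]) (ha : WeylDeg N₂ a) (hb : WeylDeg N₃ b)
    (hτ₂ : a (!τ₂) ≤ a τ₂) (hτ₃ : b (!τ₃) ≤ b τ₃) :
    weylOrder N₂ a + weylOrder N₃ b + diagOrder m ∈ tableCC N₁ N₂ N₃ τ₂ τ₃ := by
  -- Since `m χ` is the larger degree, the additional derivative makes up exactly what the diagonal
  -- lacks; this is where the count becomes an equality.
  have hd : m χ + diagOrder m = N₁ / 2 := by
    obtain ⟨hm1, hm2, hm3⟩ := hm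
    rw [diagOrder]
    cases χ <;> simp only [Bool.not_true, Bool.not_false] at * <;> split_ifs <;> omega
  have hle : m χ ≤ m (!χ) + 2 := by
    obtain ⟨hm1, hm2, hm3⟩ := hm
    cases χ <;> assumption
  obtain ⟨hm1, -, -⟩ := hm
  rw [add_not _ χ] at hm1
  obtain ⟨e1, h1, h2, h3, h4⟩ := h
  rw [mem_tableCC_iff]
  simp only [Matrix.cons_val] at *
  have hττ : τ₂ = χ ∨ τ₂ = !χ := Bool.eq_or_eq_not _ _
  have hττ' : τ₃ = χ ∨ τ₃ = !χ := Bool.eq_or_eq_not _ _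
  rcases weylDeg_cases ha χ with ha' | ha' <;> rcases weylDeg_cases hb χ with hb' | hb'
  · rw [weylOrder_eq ha', weylOrder_eq hb']
    have : N₂ = 0 := by linarith
    have : N₃ = 0 := by linarith
    subst N₂ N₃
    rcases hττ with rfl | rfl <;> rcases hττ' with rfl | rfl <;> simp <;> omega
  · rw [weylOrder_eq ha', show weylOrder N₃ b = N₃ / 2 + b χ by
      simpa using weylOrder_eq (χ := !χ) (by simpa using hb')]
    have k1 : N₂ ≤ N₃ := by linarith
    have k2 : N₂ + N₃ ≤ N₁ := by linarith
    have k3 : (N₂ / 2 + a !χ) + (N₃ / 2 + b χ) + diagOrder m + N₂ = N₁ / 2 + N₂ / 2 + N₃ / 2 := by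
      linarith
    rw [min_eq_left k1]
    rcases hττ with rfl | rfl <;> rcases hττ' with rfl | rfl <;> simp only [Bool.not_not] at * <;>
      simp <;> omega
  · rw [weylOrder_eq hb', show weylOrder N₂ a = N₂ / 2 + a χ by
      simpa using weylOrder_eq (χ := !χ) (by simpa using ha')]
    have k1 : N₃ ≤ N₂ := by linarith
    have k2 : N₂ + N₃ ≤ N₁ := by linarith
    have k3 : (N₂ / 2 + a χ) + (N₃ / 2 + b !χ) + diagOrder m + N₃ = N₁ / 2 + N₂ / 2 + N₃ / 2 := by
      linarith
    rw [min_eq_right k1]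
    rcases hττ with rfl | rfl <;> rcases hττ' with rfl | rfl <;> simp only [Bool.not_not] at * <;>
      simp <;> omega
  · rw [show weylOrder N₂ a = N₂ / 2 + a χ by
      simpa using weylOrder_eq (χ := !χ) (by simpa using ha'),
      show weylOrder N₃ b = N₃ / 2 + b χ by
      simpa using weylOrder_eq (χ := !χ) (by simpa using hb')]
    have k1 : N₂ ≤ N₁ + N₃ := by linarith
    have k2 : N₃ ≤ N₁ + N₂ := by linarith
    have k3 : (N₂ / 2 + a χ) + (N₃ / 2 + b χ) + diagOrder m = N₁ / 2 + N₂ / 2 + N₃ / 2 := by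
      linarith
    have k4 : (N₁ + N₂ + N₃) % 2 = 0 := by omega
    rcases hττ with rfl | rfl <;> rcases hττ' with rfl | rfl <;> simp only [Bool.not_not] at * <;>
      simp <;> omega

theorem tableWC_symm (N₁ N₂ N₃ : ℕ) (τ₂ τ₃ : Bool) :
    tableWC N₁ N₂ N₃ τ₂ τ₃ = tableWC N₁ N₃ N₂ τ₃ τ₂ := by
  ext k
  rw [mem_tableWC_iff, mem_tableWC_iff, min_comm N₂ N₃, add_comm N₂ N₃, add_right_comm (N₁ / 2)]
  by_cases h : τ₂ = τ₃
  · subst h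
    tauto
  · simp only [if_neg h, if_neg (Ne.symm h)]
    tauto

/-! ### Bidegree components of the one-form-sector vertices as polynomials in `lam`. -/

theorem polyIn_vertexWW {N₂ N₃ : ℕ} {w₂ w₃ : ℂ → OneForm A} {P₂ P₃ : (Bool → ℕ) → Prop}
    (h₂ : ∀ ι, Graded (fun lam => w₂ lam ι) gaugeOrder P₂)
    (h₃ : ∀ ι, Graded (fun lam => w₃ lam ι) gaugeOrder P₃)
    (hP₂ : ∀ a, P₂ a → GaugeDeg N₂ a) (hP₃ : ∀ a, P₃ a → GaugeDeg N₃ a) {m : Bool → ℕ} {T : Set ℕ}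
    (hT : ∀ a b, StarRel 0 1 2 ![m, a, b] → P₂ a → P₃ b → gaugeOrder a + gaugeOrder b ∈ T) :
    PolyIn (fun lam => (vertexWW (w₂ lam) (w₃ lam)).part m) T := by
  refine PolyIn.wedge fun ι ι' => ?_
  have := PolyIn.apply (h₂ ι) (h₃ ι') (fun _ _ _ => starKernel_support (Or.inl ⟨rfl, rfl⟩)) m
    (N₂ + N₃)
    (fun a b _ ha hb => by
      have h1 := hP₂ a ha
      have h2 := hP₃ b hb
      simp only [GaugeDeg] at h1 h2
      omega) hT
  have hneg : ∀ f : Gen A, comp m (-f) = -comp m f := fun f => by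
    simpa using (isLinearMap_comp m).map_smul (-1) f
  simp only [hneg]
  exact this.neg

theorem polyIn_vertexWC (η : ℂ) {N₂ N₃ : ℕ} {w : ℂ → OneForm A} {C : ℂ → Gen A}
    {P₂ P₃ : (Bool → ℕ) → Prop}
    (h₂ : ∀ ι, Graded (fun lam => w lam ι) gaugeOrder P₂) (h₃ : Graded C (weylOrder N₃) P₃)
    (hP₂ : ∀ a, P₂ a → GaugeDeg N₂ a) (hP₃ : ∀ a, P₃ a → WeylDeg N₃ a) {m : Bool → ℕ} {T : Set ℕ}
    (hT : ∀ χ a b, WCRel χ 1 2 ![m, a, b] → P₂ a → P₃ b → gaugeOrder a + weylOrder N₃ b ∈ T) :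
    PolyIn (fun lam => (vertexWC η (w lam) (C lam)).part m) T := by
  refine PolyIn.wedge fun ι ι' => ?_
  have hlin := isLinearMap_comp (A := A) m
  simp only [hlin.sum_map, hlin.map_smul, comp_mulK]
  -- By the equality in `WCRel`, the degree of `C` in `χ` is smaller than that of `ω`, and its other
  -- degree differs from it by `N₃`. Hence the bound `3 * N₂ + N₃`.
  refine PolyIn.sum _ fun χ _ => ((PolyIn.apply (h₂ ι') h₃
    (fun _ _ _ => kernelWC_support (Or.inl ⟨rfl, rfl⟩)) m
    (3 * N₂ + N₃) ?_ (hT χ)).map (isLinearMap_mulK χ)).smul _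
  intro a b hR ha hb
  have h1 := hP₂ a ha
  have h2 := hP₃ b hb
  obtain ⟨e, -⟩ := hR
  simp only [GaugeDeg, WeylDeg, Matrix.cons_val] at h1 h2 e
  cases χ <;> omega

theorem polyIn_vertexCW (η : ℂ) {N₂ N₃ : ℕ} {w : ℂ → OneForm A} {C : ℂ → Gen A}
    {P₂ P₃ : (Bool → ℕ) → Prop}
    (h₃ : ∀ ι, Graded (fun lam => w lam ι) gaugeOrder P₃) (h₂ : Graded C (weylOrder N₂) P₂)
    (hP₃ : ∀ a, P₃ a → GaugeDeg N₃ a) (hP₂ : ∀ a, P₂ a → WeylDeg N₂ a) {m : Bool → ℕ} {T : Set ℕ}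
    (hT : ∀ χ a b, WCRel χ 1 2 ![m, a, b] → P₃ a → P₂ b → gaugeOrder a + weylOrder N₂ b ∈ T) :
    PolyIn (fun lam => (vertexCW η (C lam) (w lam)).part m) T := by
  refine PolyIn.wedge fun ι ι' => ?_
  have hlin := isLinearMap_comp (A := A) m
  simp only [hlin.sum_map, hlin.map_smul, comp_mulK]
  refine PolyIn.sum _ fun χ _ => ((PolyIn.apply h₂ (h₃ ι').reflect
    (fun _ _ _ => kernelWC_support (Or.inr ⟨rfl, rfl⟩)) m
    (3 * N₃ + N₂) ?_ ?_).map (isLinearMap_mulK χ)).smul _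
  · intro b a hR hb ha
    have h1 := hP₃ a ha
    have h2 := hP₂ b hb
    obtain ⟨e, -⟩ := hR
    simp only [GaugeDeg, WeylDeg, Matrix.cons_val] at h1 h2 e
    cases χ <;> omega
  · intro b a hR hb ha
    rw [add_comm]
    -- Exchanging the legs together with the two inputs leaves the relation definitionally
    -- unchanged.
    exact hT χ a b hR ha hb

/-! ### Derivatives of exponential kernels -/

theorem joinExpo_add_zero (μ ν ρ : Expo) (v : Var) :
    joinExpo (μ + Finsupp.single v 1) ν ρ = joinExpo μ ν ρ + Finsupp.single (0, v) 1 := by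
  classical
  ext ⟨i, x⟩
  fin_cases i <;> simp [joinExpo, Finsupp.single_apply, Prod.ext_iff]

/-- This is `∂(G e^q) = G (∂q) e^q` for `G` independent of the variable. Raising the monomial
lengthens the truncated series by one term, while differentiation kills the term `j = 0`, so the
truncations match. -/
theorem expKernel_derivative {G q : Sym} {v : Var} (hG : MvPolynomial.pderiv (0, v) G = 0)
    (μ ν ρ : Expo) : ((μ v : ℂ) + 1) * expKernel G q (μ + Finsupp.single v 1) ν ρ =
      expKernel (G * MvPolynomial.pderiv (0, v) q) q μ ν ρ := by
  have hv : ((μ v : ℕ) : ℂ) = (joinExpo μ ν ρ (0, v) : ℕ) := by simp [joinExpo]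
  simp only [expKernel, joinExpo_add_zero, map_add, Finsupp.degree_single, Finset.mul_sum]
  rw [Finset.sum_range_succ', hv]
  have key : ∀ j : ℕ, ((joinExpo μ ν ρ (0, v) : ℂ) + 1) *
      (MvPolynomial.coeff (joinExpo μ ν ρ + Finsupp.single (0, v) 1) (G * q ^ j) /
        (j.factorial : ℂ)) =
      MvPolynomial.coeff (joinExpo μ ν ρ) (G * MvPolynomial.pderiv (0, v) (q ^ j)) /
        (j.factorial : ℂ) := by
    intro j
    have : MvPolynomial.pderiv (0, v) (G * q ^ j) = G * MvPolynomial.pderiv (0, v) (q ^ j) := by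
      rw [MvPolynomial.pderiv_mul, hG, zero_mul, zero_add]
    rw [← this, MvPolynomial.coeff_pderiv]
    ring
  rw [key 0]
  simp only [pow_zero, MvPolynomial.pderiv_one, mul_zero, MvPolynomial.coeff_zero, zero_div,
    add_zero]
  refine Finset.sum_congr rfl fun j _ => ?_
  rw [key, MvPolynomial.pderiv_pow, Nat.add_sub_cancel, Nat.factorial_succ]
  have h1 : G * (((j + 1 : ℕ) : Sym) * q ^ j * MvPolynomial.pderiv (0, v) q) =
      MvPolynomial.C ((j + 1 : ℕ) : ℂ) * (G * MvPolynomial.pderiv (0, v) q * q ^ j) := by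
    rw [map_natCast]
    ring
  have h2 : ((j : ℂ) + 1) ≠ 0 := Nat.cast_add_one_ne_zero j
  have h3 : (j.factorial : ℂ) ≠ 0 := Nat.cast_ne_zero.2 (Nat.factorial_ne_zero j)
  rw [h1, MvPolynomial.coeff_C_mul]
  push_cast
  field_simp

theorem pderiv_leg {i : Fin 3} (hi : i ≠ 0) (χ : Bool) (a : Fin 2) (v : Var) :
    MvPolynomial.pderiv (0, v) (leg i χ a) = 0 :=
  MvPolynomial.pderiv_X_of_ne fun h => hi (congrArg Prod.fst h)

theorem pderiv_pp {i j : Fin 3} (hi : i ≠ 0) (hj : j ≠ 0) (χ : Bool) (v : Var) :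
    MvPolynomial.pderiv (0, v) (pp χ i j) = 0 := by
  simp [pp, pderiv_leg hi, pderiv_leg hj]

theorem pderiv_py {i : Fin 3} (hi : i ≠ 0) (χ c : Bool) (b : Fin 2) :
    MvPolynomial.pderiv (0, (c, b)) (py χ i) = if c = χ then leg i χ b else 0 := by
  classical
  simp only [py, map_sum, MvPolynomial.pderiv_mul, pderiv_leg hi, zero_mul, zero_add]
  simp only [leg, MvPolynomial.pderiv_X, Pi.single_apply, Prod.mk.injEq, true_and]
  by_cases h : c = χ
  · subst h
    simp
  · simp [h, Ne.symm h]

/-! ### Vanishing contractions of `Υ(Ω, Ω, C, C)` -/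

/-- The derivative of the exponent is `i t₄ (t₂ p̄₁ - t₁ p̄₂)`, proportional to the spinor in the
prefactor, and the antisymmetric contraction of a spinor with itself vanishes. -/
theorem kernelCCAux_contract (χ : Bool) (a : Fin 2) (t₁ t₂ t₃ t₄ : ℝ) (μ ν ρ : Expo) :
    ((μ (!χ, 1) : ℂ) + 1) *
        kernelCCAux χ a 0 t₁ t₂ t₃ t₄ (μ + Finsupp.single (!χ, 1) 1) ν ρ =
      ((μ (!χ, 0) : ℂ) + 1) *
        kernelCCAux χ a 1 t₁ t₂ t₃ t₄ (μ + Finsupp.single (!χ, 0) 1) ν ρ := by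
  have h1 : (1 : Fin 3) ≠ 0 := by decide
  have h2 : (2 : Fin 3) ≠ 0 := by decide
  simp only [kernelCCAux]
  rw [expKernel_derivative, expKernel_derivative]
  · refine congrArg (fun G => expKernel G _ μ ν ρ) ?_
    simp only [map_add, map_sub, MvPolynomial.pderiv_C_mul, pderiv_py h1, pderiv_py h2,
      pderiv_pp h1 h2, Bool.not_eq_self, if_true, if_false]
    simp only [map_mul]
    ring
  all_goals simp [pderiv_leg h1, pderiv_leg h2]

theorem kernelCC_contract (χ : Bool) (a : Fin 2) (μ ν ρ : Expo) :
    ((μ (!χ, 1) : ℂ) + 1) * kernelCC χ a 0 (μ + Finsupp.single (!χ, 1) 1) ν ρ =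
      ((μ (!χ, 0) : ℂ) + 1) * kernelCC χ a 1 (μ + Finsupp.single (!χ, 0) 1) ν ρ := by
  -- Constants pass through the integrals and the derivative without any integrability or
  -- differentiability assumption.
  simp only [kernelCC, ← intervalIntegral.integral_const_mul]
  refine intervalIntegral.integral_congr fun t₄ _ => ?_
  rw [← deriv_const_mul_field, ← deriv_const_mul_field]
  simp only [← intervalIntegral.integral_const_mul, kernelCCAux_contract]

theorem pdY_kernelCC_apply (χ : Bool) (a : Fin 2) (f g : Gen A) :
    pdY (!χ, 1) ((kernelCC χ a 0).apply f g) = pdY (!χ, 0) ((kernelCC χ a 1).apply f g) := by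
  funext μ
  simp only [pdY, Kernel.apply, smul_finsum, smul_smul]
  refine finsum_congr fun p => ?_
  rw [← mul_assoc, ← mul_assoc, kernelCC_contract]
  simp only [mul_assoc]

theorem deg_add_single (χ : Bool) (μ : Expo) (v : Var) :
    deg χ (μ + Finsupp.single v 1) = deg χ μ + if χ = v.1 then 1 else 0 := by
  obtain ⟨c, b⟩ := v
  simp only [deg, Finsupp.add_apply, Finset.sum_add_distrib]
  congr 1
  by_cases h : χ = c
  · subst h
    fin_cases b <;> simp [Finsupp.single_apply]
  · refine (Finset.sum_eq_zero fun x _ => ?_).trans (if_neg h).symm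
    exact Finsupp.single_eq_of_ne fun h' => h (congrArg Prod.fst h')

/-- The bidegrees of the derivative of the component `m` in a variable of chirality `χ`. -/
def lower (χ : Bool) (m : Bool → ℕ) : Bool → ℕ := fun c => if c = χ then m c - 1 else m c

/-- The subtraction in `lower` is truncated, so degree zero has to be treated separately. -/
theorem pdY_comp {m : Bool → ℕ} (v : Var) (hm : 1 ≤ m v.1) (f : Gen A) :
    pdY v (comp m f) = comp (lower v.1 m) (pdY v f) := by
  funext μ
  have : (∀ χ, deg χ (μ + Finsupp.single v 1) = m χ) ↔ ∀ χ, deg χ μ = lower v.1 m χ := by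
    refine forall_congr' fun χ => ?_
    rw [deg_add_single, lower]
    by_cases h : χ = v.1
    · subst h
      simp only [if_true]
      omega
    · simp only [if_neg h, add_zero]
  simp only [pdY, comp, this]
  split_ifs <;> simp

theorem pdY_comp_of_eq_zero {m : Bool → ℕ} (v : Var) (hm : m v.1 = 0) (f : Gen A) :
    pdY v (comp m f) = 0 := by
  funext μ
  have : ¬∀ χ, deg χ (μ + Finsupp.single v 1) = m χ := fun h => by
    have := h v.1
    rw [deg_add_single, hm, if_pos rfl] at this
    omega
  simp only [pdY, comp, if_neg this, smul_zero, Pi.zero_apply]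

theorem sum_act_p (χ : Bool) (f : Fin 2 → Gen A) :
    ∑ b, Slot.p.act χ b (f b) = (-Complex.I) • (pdY (χ, 1) (f 0) - pdY (χ, 0) (f 1)) := by
  simp [Slot.act, eps, Fin.sum_univ_two, sub_eq_add_neg]
  exact neg_smul Complex.I (pdY (χ, 1) (f 0))

/-- The identity for the kernels passes to each bidegree component. It leaves only `y y`
contractions, whose chirality has the smaller or equal degree. -/
theorem vertexCC_part_at_p (η : ℂ) (C₂ C₃ : Gen A) (m : Bool → ℕ) (c : Bool) (u : Slot) :
    ((vertexCC η C₂ C₃).part m).at c u .p = 0 := by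
  have key : ∀ a, pdY (c, 1) ((vertexCC η C₂ C₃).part m c a 0) =
      pdY (c, 0) ((vertexCC η C₂ C₃).part m c a 1) := by
    intro a
    have hK := pdY_kernelCC_apply (!c) a C₂ C₃
    rw [Bool.not_not] at hK
    have hpk : ∀ (v : Var) (χ : Bool) (f : Gen A), pdY v (mulK χ f) = mulK χ (pdY v f) :=
      fun _ _ _ => rfl
    simp only [TwoForm.part, vertexCC]
    rcases Nat.eq_zero_or_pos (m c) with h0 | h0
    · rw [pdY_comp_of_eq_zero _ h0, pdY_comp_of_eq_zero _ h0]
    · rw [pdY_comp _ h0, pdY_comp _ h0, (isLinearMap_pdY _).map_smul, (isLinearMap_pdY _).map_smul,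
        hpk, hpk, hpk, hpk, hK]
  refine Finset.sum_eq_zero fun a _ => ?_
  rw [← (isLinearMap_act u c a).sum_map, sum_act_p, key, sub_self, smul_zero,
    (isLinearMap_act u c a).map_zero]

theorem carries_vertexCC (bg : Background) (η : ℂ) {N₁ N₂ N₃ : ℕ} {C₂ C₃ : ℂ → Gen A}
    {P₂ P₃ : (Bool → ℕ) → Prop} (h₂ : Graded C₂ (weylOrder N₂) P₂)
    (h₃ : Graded C₃ (weylOrder N₃) P₃) (hP₂ : ∀ a, P₂ a → WeylDeg N₂ a)
    (hP₃ : ∀ a, P₃ a → WeylDeg N₃ a) {T : Set ℕ}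
    (hT : ∀ χ m a b, CurrentDeg N₁ m → m (!χ) ≤ m χ → CCRel χ ![m, a, b] → P₂ a → P₃ b →
      weylOrder N₂ a + weylOrder N₃ b + diagOrder m ∈ T) :
    Carries (fun lam => currentOne bg lam N₁ (vertexCC η (C₂ lam) (C₃ lam))) T := by
  refine carries_currentOne bg N₁ fun m c u v h1 h2 h3 huv => ?_
  cases v with
  | p =>
    simp only [vertexCC_part_at_p]
    exact PolyIn.zero _
  | y =>
    obtain ⟨rfl, hc⟩ := huv rfl
    refine PolyIn.sum _ fun a _ => PolyIn.sum _ fun b _ => PolyIn.map (PolyIn.map ?_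
      (isLinearMap_act _ _ _)) (isLinearMap_act _ _ _)
    have hlin := isLinearMap_comp (A := A) m
    simp only [TwoForm.part, vertexCC, hlin.map_smul, comp_mulK]
    refine (((PolyIn.apply h₂ h₃ (fun _ _ _ => kernelCC_support) m
      (N₂ + N₃ + 2 * (m true + m false)) ?_ ?_).map (isLinearMap_mulK _)).map
      (isLinearMap_mulK _)).smul _
    · intro a b hR ha hb
      have h1 := hP₂ a ha
      have h2 := hP₃ b hb
      obtain ⟨e, -⟩ := hR
      simp only [WeylDeg, Matrix.cons_val] at h1 h2 e
      cases c <;> simp only [Bool.not_true, Bool.not_false] at e <;> omega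
    · intro a b hR ha hb
      exact hT (!c) m a b ⟨h1, h2, h3⟩ (by simpa using hc) hR ha hb

/-! ### Derivatives of the star product -/

theorem expKernel_add (G G' q : Sym) (μ ν ρ : Expo) :
    expKernel (G + G') q μ ν ρ = expKernel G q μ ν ρ + expKernel G' q μ ν ρ := by
  simp only [expKernel, add_mul, MvPolynomial.coeff_add, add_div, Finset.sum_add_distrib]

theorem expKernel_C_mul (z : ℂ) (G q : Sym) (μ ν ρ : Expo) :
    expKernel (MvPolynomial.C z * G) q μ ν ρ = z * expKernel G q μ ν ρ := by
  simp only [expKernel, mul_assoc, MvPolynomial.coeff_C_mul, mul_div_assoc, Finset.mul_sum]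

theorem pderiv_starExponent (χ : Bool) (b : Fin 2) :
    MvPolynomial.pderiv (0, (χ, b)) starExponent =
      MvPolynomial.C Complex.I * (leg 1 χ b + leg 2 χ b) := by
  have h1 : (1 : Fin 3) ≠ 0 := by decide
  have h2 : (2 : Fin 3) ≠ 0 := by decide
  simp only [starExponent, map_sum, MvPolynomial.pderiv_C_mul, map_add, map_neg, pderiv_pp h1 h2,
    pderiv_py h1, pderiv_py h2, neg_zero, zero_add]
  cases χ <;> simp

/-- The first (`o = true`) or second (`o = false`) leg. -/
def legOf (o : Bool) : Fin 3 := if o then 1 else 2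

theorem legOf_ne_zero (o : Bool) : legOf o ≠ 0 := by
  cases o <;> decide

/-- A vertex with the factors in the order `f g` for `o = true` and `g f` for `o = false`; thus `f`
has leg `legOf o` and `g` has leg `legOf (!o)`. -/
def ordApply (o : Bool) (F : Kernel) (f g : Gen A) : Gen A :=
  if o then F.apply f g else F.apply g f

/-- The degree in leg `legOf (!o)` is bounded by the other degrees. -/
def BoundRel (o : Bool) (K : ℕ) (v : Fin 3 → Bool → ℕ) : Prop :=
  ∀ χ, v (legOf (!o)) χ ≤ v 0 χ + v (legOf o) χ + K

theorem starExponent_step_bound (o : Bool) (K : ℕ) :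
    Step (BoundRel o K) (BoundRel o K) starExponent := by
  refine Step.sum _ fun χ => Step.C_mul (Step.add (Step.add (Step.neg (Step.pp ?_))
    (Step.py ?_)) (Step.py ?_)) _ <;> intro v hv χ' <;> have := hv χ' <;>
  cases o <;> by_cases hχ : χ' = χ <;> simp [inc, hχ, legOf] at this ⊢ <;> omega

theorem Step.bound_mul_leg {o : Bool} {K : ℕ} {G : Sym}
    (hG : Step (fun v => v = 0) (BoundRel o K) G) (i : Fin 3) (χ : Bool) (a : Fin 2) :
    Step (fun v => v = 0) (BoundRel o (K + 1)) (G * HigherSpin.leg i χ a) := by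
  refine hG.mul (Step.leg a fun v hv c => ?_)
  have := hv c
  simp only [inc]
  split_ifs <;> omega

theorem finite_support_apply_term {F : Kernel} {f g : Gen A} {μ : Expo} (B : ℕ)
    (h : ∀ ν ρ, F μ ν ρ ≠ 0 → f ν ≠ 0 → g ρ ≠ 0 →
      deg true ν + deg false ν ≤ B ∧ deg true ρ + deg false ρ ≤ B) :
    Function.HasFiniteSupport fun p : Expo × Expo =>
      (F μ p.1 p.2 * pairing p.1 * pairing p.2) • twMul p.2 (f p.1) (g p.2) := by
  refine ((finite_degree_le B).prod (finite_degree_le B)).subset fun p hp => ?_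
  obtain ⟨h1, h2, h3⟩ := apply_term_ne_zero hp
  exact h _ _ h1 h2 h3

/-- The derivative of the star kernel has two terms, and `finsum` is additive only for finite
supports; hence the degree bounds on both. -/
theorem pdY_apply {F F' F'' : Kernel} {f g : Gen A} {v : Var} {z : ℂ}
    (hF : ∀ μ ν ρ, ((μ v : ℂ) + 1) * F (μ + Finsupp.single v 1) ν ρ = z * (F' μ ν ρ + F'' μ ν ρ))
    (h' : ∀ μ, ∃ B, ∀ ν ρ, F' μ ν ρ ≠ 0 → f ν ≠ 0 → g ρ ≠ 0 →
      deg true ν + deg false ν ≤ B ∧ deg true ρ + deg false ρ ≤ B)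
    (h'' : ∀ μ, ∃ B, ∀ ν ρ, F'' μ ν ρ ≠ 0 → f ν ≠ 0 → g ρ ≠ 0 →
      deg true ν + deg false ν ≤ B ∧ deg true ρ + deg false ρ ≤ B) :
    pdY v (F.apply f g) = z • (F'.apply f g + F''.apply f g) := by
  funext μ
  obtain ⟨B', hB'⟩ := h' μ
  obtain ⟨B'', hB''⟩ := h'' μ
  simp only [pdY, Kernel.apply, Pi.smul_apply, Pi.add_apply]
  rw [← finsum_add_distrib (finite_support_apply_term B' hB')
    (finite_support_apply_term B'' hB''), smul_finsum, smul_finsum]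
  refine finsum_congr fun p => ?_
  rw [smul_smul, ← mul_assoc, ← mul_assoc, hF, ← add_smul, smul_smul]
  congr 1
  ring

/-- The kernel `G e^{q}` of the star product with a prefactor. -/
def starG (G : Sym) : Kernel := expKernel G starExponent

theorem starG_derivative {G : Sym} (hG : ∀ v, MvPolynomial.pderiv (0, v) G = 0) (o χ : Bool)
    (b : Fin 2) (μ ν ρ : Expo) :
    ((μ (χ, b) : ℂ) + 1) * starG G (μ + Finsupp.single (χ, b) 1) ν ρ =
      Complex.I * (starG (G * leg (legOf o) χ b) μ ν ρ +
        starG (G * leg (legOf (!o)) χ b) μ ν ρ) := by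
  rw [starG, expKernel_derivative (hG _), pderiv_starExponent, mul_left_comm, expKernel_C_mul,
    mul_add, expKernel_add]
  cases o
  · rw [add_comm]; rfl
  · rfl

theorem starG_bound {o : Bool} {K : ℕ} {G : Sym} (hG : Step (fun v => v = 0) (BoundRel o K) G)
    (μ ν ρ : Expo) (h : starG G μ ν ρ ≠ 0) : BoundRel o K ![bideg μ, bideg ν, bideg ρ] :=
  expKernel_support hG (starExponent_step_bound o K) h

theorem pdY_ordApply {o : Bool} {K N : ℕ} {G : Sym}
    (hG : ∀ v, MvPolynomial.pderiv (0, v) G = 0) (hK : Step (fun v => v = 0) (BoundRel o K) G)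
    {f : Gen A} (hf : ∀ ν, f ν ≠ 0 → GaugeDeg N (bideg ν)) (g : Gen A) (χ : Bool) (b : Fin 2) :
    pdY (χ, b) (ordApply o (starG G) f g) = Complex.I •
      (ordApply o (starG (G * leg (legOf o) χ b)) f g +
        ordApply o (starG (G * leg (legOf (!o)) χ b)) f g) := by
  have hb := fun i => starG_bound (hK.bound_mul_leg i χ b)
  cases o
  · refine pdY_apply (starG_derivative hG false χ b) ?_ ?_
    all_goals
      intro μ
      refine ⟨2 * N + 2 * (K + 1) + deg true μ + deg false μ, fun ν ρ h1 _ h3 => ?_⟩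
      have h2 := hf _ h3
      have ht := hb _ μ ν ρ h1 true
      have hf' := hb _ μ ν ρ h1 false
      simp only [GaugeDeg, bideg, legOf, Matrix.cons_val, Bool.not_false, if_true,
        Bool.false_eq_true, if_false] at h2 ht hf'
      omega
  · refine pdY_apply (starG_derivative hG true χ b) ?_ ?_
    all_goals
      intro μ
      refine ⟨2 * N + 2 * (K + 1) + deg true μ + deg false μ, fun ν ρ h1 h3 _ => ?_⟩
      have h2 := hf _ h3
      have ht := hb _ μ ν ρ h1 true
      have hf' := hb _ μ ν ρ h1 false
      simp only [GaugeDeg, bideg, legOf, Matrix.cons_val, Bool.not_true, if_true,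
        Bool.false_eq_true, if_false] at h2 ht hf'
      omega

/-! ### Cancellation of contractions with a gauge field -/

theorem finsum_shift {α β M : Type*} [AddCommMonoid M] {F : α → M} {e : β → α}
    (he : Function.Injective e) (h : ∀ x, F x ≠ 0 → x ∈ Set.range e) :
    ∑ᶠ x, F x = ∑ᶠ y, F (e y) := by
  rw [← finsum_mem_range he, ← finsum_mem_univ F]
  exact finsum_mem_inter_support_eq' _ _ _ fun x hx => ⟨fun _ => h x hx, fun _ => trivial⟩

theorem joinExpo_add_one (μ ν ρ : Expo) (v : Var) :
    joinExpo μ (ν + Finsupp.single v 1) ρ = joinExpo μ ν ρ + Finsupp.single (1, v) 1 := by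
  classical
  ext ⟨i, x⟩
  fin_cases i <;> simp [joinExpo, Finsupp.single_apply, Prod.ext_iff]

theorem joinExpo_add_two (μ ν ρ : Expo) (v : Var) :
    joinExpo μ ν (ρ + Finsupp.single v 1) = joinExpo μ ν ρ + Finsupp.single (2, v) 1 := by
  classical
  ext ⟨i, x⟩
  fin_cases i <;> simp [joinExpo, Finsupp.single_apply, Prod.ext_iff]

/-- The truncation is longer by one than that of `expKernel`. The excess is the same for both values
of the contracted index, so it does not matter in the comparison. -/
theorem sum_coeff_mul_leg (G q : Sym) (i : Fin 3) (χ : Bool) (b : Fin 2) (d : Fin 3 × Var →₀ ℕ) :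
    ∑ j ∈ Finset.range ((d + Finsupp.single (i, (χ, b)) 1).degree + 1),
        MvPolynomial.coeff (d + Finsupp.single (i, (χ, b)) 1) (G * leg i χ b * q ^ j) /
          (j.factorial : ℂ) =
      ∑ j ∈ Finset.range (d.degree + 2), MvPolynomial.coeff d (G * q ^ j) / (j.factorial : ℂ) := by
  rw [map_add, Finsupp.degree_single]
  refine Finset.sum_congr rfl fun j _ => ?_
  rw [mul_right_comm, leg, MvPolynomial.coeff_mul_X]

theorem expKernel_mul_leg_eq_zero {G q : Sym} {i : Fin 3} {χ : Bool} {b : Fin 2} {μ ν ρ : Expo}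
    (h : joinExpo μ ν ρ (i, (χ, b)) = 0) : expKernel (G * leg i χ b) q μ ν ρ = 0 := by
  classical
  refine Finset.sum_eq_zero fun j _ => ?_
  rw [mul_right_comm, leg, MvPolynomial.coeff_mul_X', if_neg (by simpa using h), zero_div]

theorem pairing_add_single (ν : Expo) (v : Var) :
    pairing (ν + Finsupp.single v 1) = -Complex.I * pairing ν * ((ν v : ℂ) + 1) := by
  classical
  have h : ∏ w, (((ν + Finsupp.single v 1 : Expo) w).factorial : ℂ) =
      ((ν v : ℂ) + 1) * ∏ w, ((ν w).factorial : ℂ) := by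
    rw [← Finset.mul_prod_erase _ _ (Finset.mem_univ v),
      ← Finset.mul_prod_erase _ (fun w => ((ν w).factorial : ℂ)) (Finset.mem_univ v), ← mul_assoc]
    congr 1
    · simp [Nat.factorial_succ]
    · refine Finset.prod_congr rfl fun w hw => ?_
      rw [Finsupp.add_apply, Finsupp.single_eq_of_ne (Finset.ne_of_mem_erase hw), add_zero]
  rw [pairing, h, map_add, Finsupp.degree_single, pow_succ, pairing]
  ring

theorem eq_add_single_of_ne_zero {ν : Expo} {v : Var} (h : ν v ≠ 0) :
    ∃ ν', ν' + Finsupp.single v 1 = ν :=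
  ⟨ν - Finsupp.single v 1, tsub_add_cancel_of_le (by simpa [Nat.one_le_iff_ne_zero] using h)⟩

theorem twMul_add_single (ρ : Expo) (χ : Bool) (b b' : Fin 2) (u v : Klein → SmoothFun A) :
    twMul (ρ + Finsupp.single (χ, b) 1) u v = twMul (ρ + Finsupp.single (χ, b') 1) u v := by
  funext κ
  simp only [twMul, deg_add_single]

/-- A factor `p` on the leg of the gauge field is a derivative of that field, so the contraction
produces its curl in `Y`, zero by `h`. Removing one power of the leg variable by reindexing brings
both sides to the same coefficients. -/
theorem ordApply_mul_leg (o : Bool) (G : Sym) {f₀ f₁ : Gen A} (g : Gen A) {χ : Bool}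
    (h : pdY (χ, 1) f₀ = pdY (χ, 0) f₁) :
    ordApply o (starG (G * leg (legOf o) χ 1)) f₀ g =
      ordApply o (starG (G * leg (legOf o) χ 0)) f₁ g := by
  funext μ
  have hν : ∀ ν : Expo, ((ν (χ, 1) : ℂ) + 1) • f₀ (ν + Finsupp.single (χ, 1) 1) =
      ((ν (χ, 0) : ℂ) + 1) • f₁ (ν + Finsupp.single (χ, 0) 1) := fun ν => congrFun h ν
  cases o
  · have key : ∀ (b : Fin 2) (f : Gen A),
        ordApply false (starG (G * leg (legOf false) χ b)) f g μ =
        ∑ᶠ p : Expo × Expo, ((∑ j ∈ Finset.range ((joinExpo μ p.1 p.2).degree + 2),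
          MvPolynomial.coeff (joinExpo μ p.1 p.2) (G * starExponent ^ j) / (j.factorial : ℂ)) *
          (-Complex.I * pairing p.1 * pairing p.2)) •
            twMul (p.2 + Finsupp.single (χ, 0) 1) (g p.1)
              (((p.2 (χ, b) : ℂ) + 1) • f (p.2 + Finsupp.single (χ, b) 1)) := by
      intro b f
      refine (finsum_shift (e := fun p : Expo × Expo => (p.1, p.2 + Finsupp.single (χ, b) 1))
        ?_ ?_).trans (finsum_congr fun p => ?_)
      · rintro ⟨x, y⟩ ⟨x', y'⟩ hp
        simpa using hp
      · rintro ⟨x, y⟩ hp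
        obtain ⟨h1, -, -⟩ := apply_term_ne_zero hp
        obtain ⟨y', hy'⟩ := eq_add_single_of_ne_zero (ν := y) (v := (χ, b)) fun h0 =>
          h1 (expKernel_mul_leg_eq_zero (by simpa [joinExpo, legOf] using h0))
        exact ⟨(x, y'), by simp [hy']⟩
      · simp only [starG, expKernel, joinExpo_add_two, legOf, Bool.false_eq_true, if_false]
        -- The Klein sign sees only the degree, so the index `b` can be replaced by `0`, common to
        -- both sides.
        rw [sum_coeff_mul_leg, pairing_add_single, twMul_add_single _ _ b 0]
        conv_rhs => rw [← one_smul ℂ (g p.1), twMul_smul, smul_smul]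
        congr 1
        ring
    rw [key, key]
    exact finsum_congr fun p => by rw [hν]
  · have key : ∀ (b : Fin 2) (f : Gen A),
        ordApply true (starG (G * leg (legOf true) χ b)) f g μ =
        ∑ᶠ p : Expo × Expo, ((∑ j ∈ Finset.range ((joinExpo μ p.1 p.2).degree + 2),
          MvPolynomial.coeff (joinExpo μ p.1 p.2) (G * starExponent ^ j) / (j.factorial : ℂ)) *
          (-Complex.I * pairing p.1 * pairing p.2)) •
            twMul p.2 (((p.1 (χ, b) : ℂ) + 1) • f (p.1 + Finsupp.single (χ, b) 1)) (g p.2) := by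
      intro b f
      refine (finsum_shift (e := fun p : Expo × Expo => (p.1 + Finsupp.single (χ, b) 1, p.2))
        ?_ ?_).trans (finsum_congr fun p => ?_)
      · rintro ⟨x, y⟩ ⟨x', y'⟩ hp
        simpa using hp
      · rintro ⟨x, y⟩ hp
        obtain ⟨h1, -, -⟩ := apply_term_ne_zero hp
        obtain ⟨x', hx'⟩ := eq_add_single_of_ne_zero (ν := x) (v := (χ, b)) fun h0 =>
          h1 (expKernel_mul_leg_eq_zero (by simpa [joinExpo, legOf] using h0))
        exact ⟨(x', y), by simp [hx']⟩
      · simp only [starG, expKernel, joinExpo_add_one, legOf, if_true]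
        rw [sum_coeff_mul_leg, pairing_add_single]
        conv_rhs => rw [← one_smul ℂ (g p.2), twMul_smul, smul_smul]
        congr 1
        ring
    rw [key, key]
    exact finsum_congr fun p => by rw [hν]

/-- In the contraction of `p` with a gauge field only the derivative of the other factor
survives. -/
theorem ordApply_contract {o : Bool} {K N : ℕ} {G : Sym}
    (hG : ∀ v, MvPolynomial.pderiv (0, v) G = 0) (hK : Step (fun v => v = 0) (BoundRel o K) G)
    {f₀ f₁ : Gen A} (hf₀ : ∀ ν, f₀ ν ≠ 0 → GaugeDeg N (bideg ν))
    (hf₁ : ∀ ν, f₁ ν ≠ 0 → GaugeDeg N (bideg ν)) (g : Gen A) {χ : Bool}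
    (h : pdY (χ, 1) f₀ = pdY (χ, 0) f₁) :
    pdY (χ, 1) (ordApply o (starG G) f₀ g) - pdY (χ, 0) (ordApply o (starG G) f₁ g) =
      Complex.I • (ordApply o (starG (G * leg (legOf (!o)) χ 1)) f₀ g -
        ordApply o (starG (G * leg (legOf (!o)) χ 0)) f₁ g) := by
  rw [pdY_ordApply hG hK hf₀, pdY_ordApply hG hK hf₁, ordApply_mul_leg o G g h]
  exact (smul_sub Complex.I _ _).symm.trans (by rw [add_sub_add_left_eq_sub])

theorem pdY_comm (v w : Var) (f : Gen A) : pdY v (pdY w f) = pdY w (pdY v f) := by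
  classical
  funext μ
  simp only [pdY, smul_smul]
  rw [add_right_comm]
  congr 1
  by_cases h : v = w
  · subst h; rfl
  · simp [h, Ne.symm h]
    ring

/-- The one-form is a gradient in `Y`, so its curl vanishes. The potential depends on the bidegree,
but both shifts change the bidegree alike and select the same branch. -/
theorem pdY_omega {N : ℕ} (Φ : FronsdalField A N) (bg : Background) (lam : ℂ) (co : Coefficients)
    {χ : Bool} {ι ι' : Bool → Fin 2} (h : ι (!χ) = ι' (!χ)) (h₀ : ι χ = 0) (h₁ : ι' χ = 1) :
    pdY (χ, 1) (Φ.omega bg lam co ι) = pdY (χ, 0) (Φ.omega bg lam co ι') := by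
  have key : ∀ Ψ : Gen A, pdY (χ, 1) (pdY (true, ι true) (pdY (false, ι false) Ψ)) =
      pdY (χ, 0) (pdY (true, ι' true) (pdY (false, ι' false) Ψ)) := by
    intro Ψ
    cases χ
    · simp only [Bool.not_false] at h
      rw [h₀, h₁, h, pdY_comm (false, 1), pdY_comm (false, 0) (true, _), pdY_comm (false, 1)]
    · simp only [Bool.not_true] at h
      rw [h₀, h₁, h, pdY_comm]
  funext μ
  have hk := fun Ψ => congrFun (key Ψ) μ
  simp only [pdY] at hk
  simp only [pdY, FronsdalField.omega, deg_add_single]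
  split_ifs <;> first | exact hk _ | simp

/-! ### Currents in the zero-form sector -/

theorem isLinearMap_oneForm_part_at (m : Bool → ℕ) (χ : Bool) (u v : Slot) :
    IsLinearMap ℂ fun w : OneForm A => (w.part m).at χ u v :=
  IsLinearMap.fin_sum _ fun _ => IsLinearMap.fin_sum _ fun _ =>
    (isLinearMap_act u χ _).comp' ((isLinearMap_act v (!χ) _).comp' ((isLinearMap_comp m).comp'
      ⟨fun _ _ => rfl, fun _ _ => rfl⟩))

theorem carries_currentZero (bg : Background) (η : ℂ) (N : ℕ) {w : ℂ → OneForm A} {T : Set ℕ}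
    (h0 : N = 0 → PolyIn (fun lam => ((w lam).part (pair true 1 1)).at true .p .p) T)
    (h0' : N = 0 →
      PolyIn (fun lam => ((w lam).part (pair true 0 0)).at true .y .y) {k | k + 1 ∈ T})
    (h12 : ∀ χ, N = 1 ∨ N = 2 → PolyIn (fun lam => ((w lam).part (pair χ 0 N)).at χ .y .p) T) :
    Carries (fun lam => currentZero bg η lam N (w lam)) T := by
  refine carries_of_components fun l => ?_
  match N, l with
  | 0, .main false =>
    exact (((h0 rfl).smul _).sub ((h0' rfl).D bg true .p .p)).smul _
  | 1, .main χ => exact h12 χ (Or.inl rfl)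
  | 2, .main false => exact PolyIn.sum _ fun χ _ => (h12 χ (Or.inr rfl)).smul _
  | 0, .main true => exact PolyIn.zero _
  | 2, .main true => exact PolyIn.zero _
  | 0, .trace _ => exact PolyIn.zero _
  | 1, .trace _ => exact PolyIn.zero _
  | 2, .trace _ => exact PolyIn.zero _
  | 0, .gammaTrace _ => exact PolyIn.zero _
  | 1, .gammaTrace _ => exact PolyIn.zero _
  | 2, .gammaTrace _ => exact PolyIn.zero _
  | n + 3, l => cases l <;> exact PolyIn.zero _

/-! ### Tables of the zero-form sector in doubled spins, and the vertex `Υ(Ω,C,C)`. -/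

theorem mem_table0WC_iff {N₁ N₂ N₃ N k : ℕ} : k ∈ table0WC N₁ N₂ N₃ N ↔
    ((N₁ = 1 ∨ N₁ = 2) ∧ N₁ + 2 ≤ N₂ + N₃ ∧
      (k + min N₁ (min N₂ N₃) = N₁ / 2 + N₂ / 2 + N₃ / 2 ∨
        (N₁ = 2 ∧ N < 2 ∧ k + 2 = N₁ / 2 + N₂ / 2 + N₃ / 2))) ∨
    ((N₁ = 0 ∨ N₁ = 1 ∨ N₁ = 2) ∧ (N₁ + 2 + N₃ ≤ N₂ ∨ N₁ + 2 + N₂ ≤ N₃) ∧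
      k = N₁ / 2 + N₂ / 2 + N₃ / 2) := by
  have e1 : spin N₁ + 1 ≤ spin N₂ + spin N₃ ↔ N₁ + 2 ≤ N₂ + N₃ := by
    rw [← Nat.cast_le (α := ℚ)]
    push_cast
    simp only [spin]
    constructor <;> intro h <;> linarith
  have e2 : spin N < 1 ↔ N < 2 := by
    rw [← Nat.cast_lt (α := ℚ)]
    push_cast
    simp only [spin]
    constructor <;> intro h <;> linarith
  have e3 : spin N₁ + 1 ≤ |spin N₂ - spin N₃| ↔ N₁ + 2 + N₃ ≤ N₂ ∨ N₁ + 2 + N₂ ≤ N₃ := by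
    rw [le_abs, ← Nat.cast_le (α := ℚ), ← Nat.cast_le (α := ℚ)]
    push_cast
    simp only [spin]
    constructor <;> rintro (h | h)
    · left; linarith
    · right; linarith
    · left; linarith
    · right; linarith
  have e4 : (k : ℚ) = sumS N₁ N₂ N₃ - 2 ↔ k + 2 = N₁ / 2 + N₂ / 2 + N₃ / 2 := by
    rw [← eq_sumS_sub_iff]
    norm_num
  simp only [table0WC, Set.mem_ofPred_eq, min_spin, two_mul_spin, e1, e2, e3, e4,
    eq_sumS_sub_iff, eq_sumS_iff]

theorem mem_table0CC_iff {N₁ N₂ N₃ k : ℕ} : k ∈ table0CC N₁ N₂ N₃ ↔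
    ((N₁ = 1 ∨ N₁ = 2) ∧ N₂ + N₃ ≤ N₁ ∧
      k + min N₁ (min N₂ N₃) = N₁ / 2 + N₂ / 2 + N₃ / 2) ∨
    ((N₁ = 1 ∨ N₁ = 2) ∧ (N₂ ≤ N₁ + N₃ ∧ N₃ ≤ N₁ + N₂) ∧ k = N₁ / 2 + N₂ / 2 + N₃ / 2) ∨
    (N₁ = 0 ∧ (N₂ ≤ 2 + N₃ ∧ N₃ ≤ 2 + N₂) ∧ 2 ≤ N₂ + N₃ ∧ k = N₂ / 2 + N₃ / 2) := by
  have e1 : ∀ N : ℕ, |spin N₂ - spin N₃| ≤ spin N ↔ N₂ ≤ N + N₃ ∧ N₃ ≤ N + N₂ := by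
    intro N
    rw [abs_sub_le_iff, ← Nat.cast_le (α := ℚ), ← Nat.cast_le (α := ℚ)]
    push_cast
    simp only [spin]
    constructor <;> rintro ⟨h, h'⟩ <;> constructor <;> linarith
  have e2 : |spin N₂ - spin N₃| ≤ 1 ↔ N₂ ≤ 2 + N₃ ∧ N₃ ≤ 2 + N₂ := by
    rw [← e1]
    norm_num [spin]
  have e3 : 1 ≤ spin N₂ + spin N₃ ↔ 2 ≤ N₂ + N₃ := by
    rw [← Nat.cast_le (α := ℚ)]
    push_cast
    simp only [spin]
    constructor <;> intro h <;> linarith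
  simp only [table0CC, Set.mem_ofPred_eq, min_spin, two_mul_spin, spin_le_iff, e1, e2, e3,
    eq_sumS_sub_iff, eq_sumS_iff, Nat.cast_inj]

theorem table0WC_symm (N₁ N₂ N₃ N : ℕ) : table0WC N₁ N₂ N₃ N = table0WC N₁ N₃ N₂ N := by
  ext k
  rw [mem_table0WC_iff, mem_table0WC_iff, min_comm N₂ N₃, add_comm N₂ N₃,
    add_right_comm (N₁ / 2), or_comm (a := N₁ + 2 + N₃ ≤ N₂)]

/-- The explicit `y` in the kernel gives `a χ + b χ = m χ - 1 ≤ 1`, which leaves few possible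
degrees; the inequalities of the other chirality then constrain the spins. -/
theorem count_vertex0CC {N₁ N₂ N₃ : ℕ} {m a b : Bool → ℕ} {χ : Bool} (h : ZeroCCRel χ ![m, a, b])
    (ha : WeylDeg N₂ a) (hb : WeylDeg N₃ b)
    (hm : (N₁ = 0 ∧ m χ = 1 ∧ m (!χ) = 1) ∨ ((N₁ = 1 ∨ N₁ = 2) ∧ m χ = N₁ ∧ m (!χ) = 0)) :
    weylOrder N₂ a + weylOrder N₃ b ∈ table0CC N₁ N₂ N₃ := by
  obtain ⟨e1, h1, h2, h3, h4⟩ := h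
  rw [mem_table0CC_iff]
  simp only [Matrix.cons_val] at *
  have wa := weylDeg_cases ha χ
  have wb := weylDeg_cases hb χ
  have oa : weylOrder N₂ a = N₂ / 2 + min (a χ) (a (!χ)) := by
    cases χ
    · exact congrArg _ (min_comm _ _)
    · rfl
  have ob : weylOrder N₃ b = N₃ / 2 + min (b χ) (b (!χ)) := by
    cases χ
    · exact congrArg _ (min_comm _ _)
    · rfl
  rw [oa, ob]
  clear oa ob ha hb
  generalize a χ = a1 at *
  generalize a (!χ) = a2 at *
  generalize b χ = b1 at *
  generalize b (!χ) = b2 at *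
  generalize m χ = m1 at *
  generalize m (!χ) = m2 at *
  obtain ⟨rfl, rfl, rfl⟩ | ⟨rfl | rfl, rfl, rfl⟩ := hm
  · obtain rfl : a1 = 0 := by omega
    obtain rfl : b1 = 0 := by omega
    right; right
    refine ⟨rfl, ⟨?_, ?_⟩, ?_, ?_⟩ <;> omega
  · obtain rfl : a1 = 0 := by omega
    obtain rfl : b1 = 0 := by omega
    right; left
    refine ⟨Or.inl rfl, ⟨?_, ?_⟩, ?_⟩ <;> omega
  · have : (a1 = 1 ∧ b1 = 0) ∨ (a1 = 0 ∧ b1 = 1) := by omega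
    obtain ⟨rfl, rfl⟩ | ⟨rfl, rfl⟩ := this
    · rcases Nat.eq_zero_or_pos a2 with rfl | ha2
      · omega
      · rw [min_eq_left ha2]; omega
    · rcases Nat.eq_zero_or_pos b2 with rfl | hb2
      · omega
      · rw [min_eq_left (show 1 ≤ b2 from hb2)]; omega

theorem carries_vertex0CC (bg : Background) (η : ℂ) {N₁ N₂ N₃ : ℕ} {C₂ C₃ : ℂ → Gen A}
    (h₂ : Graded C₂ (weylOrder N₂) (WeylDeg N₂)) (h₃ : Graded C₃ (weylOrder N₃) (WeylDeg N₃)) :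
    Carries (fun lam => currentZero bg η lam N₁ (vertex0CC η (C₂ lam) (C₃ lam)))
      (table0CC N₁ N₂ N₃) := by
  have key : ∀ (m : Bool → ℕ) (c : Bool) (u v : Slot) (T : Set ℕ),
      (∀ χ a b, ZeroCCRel χ ![m, a, b] → WeylDeg N₂ a → WeylDeg N₃ b →
        weylOrder N₂ a + weylOrder N₃ b ∈ T) →
      PolyIn (fun lam => ((vertex0CC η (C₂ lam) (C₃ lam)).part m).at c u v) T := by
    intro m c u v T hT
    refine PolyIn.sum _ fun a _ => PolyIn.sum _ fun b _ => PolyIn.map (PolyIn.map ?_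
      (isLinearMap_act _ _ _)) (isLinearMap_act _ _ _)
    have hlin := isLinearMap_comp (A := A) m
    simp only [OneForm.part, vertex0CC, hlin.sum_map, hlin.map_smul, comp_mulK]
    refine PolyIn.sum _ fun χ _ => ((PolyIn.apply h₂ h₃ (fun _ _ _ => kernel0CC_support) m
      (N₂ + N₃ + 2 * (m true + m false)) ?_ (hT χ)).map (isLinearMap_mulK _)).smul _
    intro a b hR ha hb
    obtain ⟨e, -⟩ := hR
    simp only [WeylDeg, Matrix.cons_val] at ha hb e
    cases χ <;> omega
  refine carries_currentZero bg η N₁ (fun hN => key _ _ _ _ _ ?_) (fun hN => key _ _ _ _ _ ?_)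
    (fun c hN => key _ _ _ _ _ ?_)
  · intro χ a b hR ha hb
    exact count_vertex0CC hR ha hb (Or.inl ⟨hN, by simp [pair], by simp [pair]⟩)
  · intro χ a b hR ha hb
    -- The kernel carries an explicit `y`, so it has no component of bidegree zero.
    have := hR.1
    simp [pair] at this
  · intro χ a b hR ha hb
    refine count_vertex0CC hR ha hb (Or.inr ⟨hN, ?_⟩)
    -- The degree in `χ` must be positive, which leaves only `χ = !c`.
    have := hR.1
    simp only [pair, Matrix.cons_val] at this ⊢
    cases c <;> cases χ <;> simp at this ⊢

/-! ### The star product of a gauge one-form and a zero-form -/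

theorem PolyIn.ordApply {o : Bool} {G : Sym} {s : Bool → ℕ}
    (hG : Step (fun v => v = 0) (StarRel s (legOf o) (legOf (!o))) G) {N N' : ℕ}
    {f g : ℂ → Gen A} (hf : Graded f gaugeOrder (GaugeDeg N))
    (hg : Graded g (weylOrder N') (WeylDeg N')) (m : Bool → ℕ) {T : Set ℕ}
    (hT : ∀ a b, StarRel s 1 2 ![m, a, b] → GaugeDeg N a → WeylDeg N' b →
      gaugeOrder a + weylOrder N' b ∈ T) :
    PolyIn (fun lam => comp m (ordApply o (starG G) (f lam) (g lam))) T := by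
  have hB : ∀ a b : Bool → ℕ, StarRel s 1 2 ![m, a, b] → GaugeDeg N a → WeylDeg N' b →
      a true + a false ≤ m true + m false + N + s true + s false ∧
      b true + b false ≤ m true + m false + N + s true + s false := by
    intro a b hR ha _
    have h1 := hR true
    have h2 := hR false
    simp only [GaugeDeg, Matrix.cons_val] at ha h1 h2
    omega
  have hlegs : Legs (legOf o) (legOf (!o)) := by cases o <;> simp [Legs, legOf]
  have hF : ∀ μ ν ρ, starG G μ ν ρ ≠ 0 →
      StarRel s (legOf o) (legOf (!o)) ![bideg μ, bideg ν, bideg ρ] :=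
    fun μ ν ρ h => expKernel_support hG (starExponent_step s hlegs) h
  cases o
  · exact PolyIn.apply hg hf hF m _ (fun b a hR hb ha => (hB a b hR ha hb).symm)
      fun b a hR hb ha => by rw [add_comm]; exact hT a b hR ha hb
  · exact PolyIn.apply hf hg hF m _ hB hT

/-- The star product of a one-form and a zero-form in one of the two orders. -/
def starForm (o : Bool) (w : OneForm A) (C : Gen A) : OneForm A :=
  fun ι => ordApply o starKernel (w ι) C

theorem sub_comp (m : Bool → ℕ) (f g : Gen A) : comp m (f - g) = comp m f - comp m g :=
  (isLinearMap_comp m).map_sub f g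

theorem starKernel_contract {N : ℕ} (Φ : FronsdalField A N) (bg : Background) (lam : ℂ)
    (co : Coefficients) (o : Bool) (C : Gen A) (χ : Bool) {K : ℕ} {G : Sym}
    (hG : ∀ v, MvPolynomial.pderiv (0, v) G = 0) (hK : Step (fun v => v = 0) (BoundRel o K) G)
    {ι ι' : Bool → Fin 2} (h : ι (!χ) = ι' (!χ)) (h₀ : ι χ = 0) (h₁ : ι' χ = 1) :
    pdY (χ, 1) (ordApply o (starG G) (Φ.omega bg lam co ι) C) -
        pdY (χ, 0) (ordApply o (starG G) (Φ.omega bg lam co ι') C) =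
      Complex.I • (ordApply o (starG (G * leg (legOf (!o)) χ 1)) (Φ.omega bg lam co ι) C -
        ordApply o (starG (G * leg (legOf (!o)) χ 0)) (Φ.omega bg lam co ι') C) :=
  ordApply_contract hG hK ((graded_omega Φ bg co ι).support lam)
    ((graded_omega Φ bg co ι').support lam) C (pdY_omega Φ bg lam co h h₀ h₁)

theorem sum_act_p_comp (χ : Bool) {m : Bool → ℕ} (hm : 1 ≤ m χ) (f : Fin 2 → Gen A) :
    ∑ b, Slot.p.act χ b (comp m (f b)) =
      (-Complex.I) • comp (lower χ m) (pdY (χ, 1) (f 0) - pdY (χ, 0) (f 1)) := by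
  rw [sum_act_p, pdY_comp _ hm, pdY_comp _ hm, sub_comp]

theorem boundRel_one (o : Bool) : Step (fun v => v = 0) (BoundRel o 0) 1 := by
  refine Step.one ?_
  rintro v rfl χ
  simp

/-- The contraction with `p` acts on `C` alone: it lowers the output degree in `!χ` and inserts one
factor `p` on the leg of `C`, as recorded by `pair χ 0 1`. -/
theorem polyIn_starForm_yp {N N' : ℕ} (Φ : FronsdalField A N) (Φ' : FronsdalField A N')
    (bg : Background) (co : Coefficients) (o χ : Bool) {m : Bool → ℕ} (hm : 1 ≤ m (!χ)) {T : Set ℕ}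
    (hT : ∀ a b, StarRel (pair χ 0 1) 1 2 ![lower (!χ) m, a, b] → GaugeDeg N a → WeylDeg N' b →
      gaugeOrder a + weylOrder N' b ∈ T) :
    PolyIn (fun lam => ((starForm o (Φ.omega bg lam co) (Φ'.weyl bg lam co)).part m).at χ .y .p)
      T := by
  refine PolyIn.sum _ fun a _ => ?_
  simp only [← (isLinearMap_act _ _ _).sum_map, OneForm.part, starForm, starKernel_eq]
  refine PolyIn.map ?_ (isLinearMap_act _ _ _)
  simp only [sum_act_p_comp _ hm]
  refine PolyIn.smul ?_ _
  have hc := fun lam => starKernel_contract Φ bg lam co o (Φ'.weyl bg lam co) (!χ) (K := 0) (G := 1)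
    (fun v => MvPolynomial.pderiv_one) (boundRel_one o) (ι := pair χ a 0) (ι' := pair χ a 1)
    (by simp [pair]) (by simp [pair]) (by simp [pair])
  simp only [starG] at hc
  simp only [hc, (isLinearMap_comp _).map_smul, sub_comp]
  have hG : ∀ b, Step (fun v => v = 0) (StarRel (pair χ 0 1) (legOf o) (legOf (!o)))
      (1 * leg (legOf (!o)) (!χ) b) := by
    intro b
    rw [one_mul]
    refine Step.leg b ?_
    rintro v rfl c
    cases o <;> cases χ <;> cases c <;> simp [inc, legOf, pair]
  exact ((PolyIn.ordApply (hG 1) (graded_omega Φ bg co _) (graded_weyl Φ' bg co) _ hT).sub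
    (PolyIn.ordApply (hG 0) (graded_omega Φ bg co _) (graded_weyl Φ' bg co) _ hT)).smul _

/-- Both contractions fall on `C`, the second being applied to kernels that already carry the factor
produced by the first. -/
theorem polyIn_starForm_pp {N N' : ℕ} (Φ : FronsdalField A N) (Φ' : FronsdalField A N')
    (bg : Background) (co : Coefficients) (o : Bool) {T : Set ℕ}
    (hT : ∀ a b, StarRel 1 1 2 ![0, a, b] → GaugeDeg N a → WeylDeg N' b →
      gaugeOrder a + weylOrder N' b ∈ T) :
    PolyIn (fun lam => ((starForm o (Φ.omega bg lam co) (Φ'.weyl bg lam co)).part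
      (pair true 1 1)).at true .p .p) T := by
  have h1 : 1 ≤ pair true 1 1 (!true) := by simp [pair]
  have h2 : 1 ≤ lower (!true) (pair true 1 1) true := by simp [pair, lower]
  have h3 : lower true (lower (!true) (pair true 1 1)) = 0 := by
    funext c
    cases c <;> simp [pair, lower]
  have hc := fun lam a => starKernel_contract Φ bg lam co o (Φ'.weyl bg lam co) (!true) (K := 0)
    (G := 1) (fun v => MvPolynomial.pderiv_one) (boundRel_one o) (ι := pair true a 0)
    (ι' := pair true a 1) (by simp [pair]) (by simp [pair]) (by simp [pair])
  have hc' := fun lam b b' => starKernel_contract Φ bg lam co o (Φ'.weyl bg lam co) true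
    (K := 0 + 1) (G := 1 * leg (legOf (!o)) (!true) b')
    (fun v => by rw [one_mul, pderiv_leg (legOf_ne_zero _)])
    ((boundRel_one o).bound_mul_leg _ _ _) (ι := pair true 0 b) (ι' := pair true 1 b)
    (by simp [pair]) (by simp [pair]) (by simp [pair])
  have hG : ∀ b b', Step (fun v => v = 0) (StarRel 1 (legOf o) (legOf (!o)))
      (1 * leg (legOf (!o)) (!true) b' * leg (legOf (!o)) true b) := by
    intro b b'
    rw [one_mul]
    refine Step.mul (R := fun v => v = inc 0 (legOf (!o)) (!true)) (Step.leg _ ?_) (Step.leg _ ?_)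
    · rintro v rfl
      rfl
    · rintro v rfl c
      cases o <;> cases c <;> simp [inc, legOf]
  have hP := fun b b' ι => PolyIn.ordApply (hG b b') (graded_omega Φ bg co ι)
    (graded_weyl Φ' bg co) 0 hT
  simp only [OneForm.at, ← (isLinearMap_act _ _ _).sum_map, OneForm.part, starForm, starKernel_eq]
  simp only [sum_act_p_comp (!true) h1]
  simp only [starG] at hc hc' hP
  simp only [hc, (isLinearMap_comp _).map_smul, (isLinearMap_act _ _ _).map_smul, ← Finset.smul_sum]
  simp only [sum_act_p_comp true h2, h3]
  refine PolyIn.smul (PolyIn.smul (PolyIn.smul ?_ _) _) _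
  have hs : ∀ (v : Var) (f g : Gen A), pdY v (f - g) = pdY v f - pdY v g :=
    fun v f g => (isLinearMap_pdY v).map_sub f g
  simp only [hs]
  -- Regrouped so that each difference is an undotted contraction at a fixed dotted index, as `hc'`
  -- requires.
  have e : ∀ x y z w : Gen A, x - y - (z - w) = (x - z) - (y - w) := fun x y z w => by abel
  simp only [e, hc', (isLinearMap_comp _).map_smul, sub_comp]
  exact (((hP _ _ _).sub (hP _ _ _)).smul _).sub (((hP _ _ _).sub (hP _ _ _)).smul _)

theorem polyIn_starForm_yy {N N' : ℕ} (Φ : FronsdalField A N) (Φ' : FronsdalField A N')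
    (bg : Background) (co : Coefficients) (o χ : Bool) (m : Bool → ℕ) {T : Set ℕ}
    (hT : ∀ a b, StarRel 0 1 2 ![m, a, b] → GaugeDeg N a → WeylDeg N' b →
      gaugeOrder a + weylOrder N' b ∈ T) :
    PolyIn (fun lam => ((starForm o (Φ.omega bg lam co) (Φ'.weyl bg lam co)).part m).at χ .y .y)
      T := by
  refine PolyIn.sum _ fun a _ => PolyIn.sum _ fun b _ => PolyIn.map (PolyIn.map ?_
      (isLinearMap_act _ _ _)) (isLinearMap_act _ _ _)
  refine PolyIn.ordApply (Step.one ?_) (graded_omega Φ bg co _) (graded_weyl Φ' bg co) m hT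
  rintro v rfl χ
  simp

/-! ### Counting of derivatives for `Υ(ω,C)`. -/

theorem weylOrder_eq_min (N : ℕ) (a : Bool → ℕ) (χ : Bool) :
    weylOrder N a = N / 2 + min (a χ) (a (!χ)) := by
  cases χ
  · exact congrArg _ (min_comm _ _)
  · rfl

theorem exists_helicity (a : Bool → ℕ) : ∃ τ, a (!τ) ≤ a τ := by
  rcases le_total (a false) (a true) with h | h
  · exact ⟨true, h⟩
  · exact ⟨false, h⟩

theorem gaugeOrder_eq (a : Bool → ℕ) (χ : Bool) :
    gaugeOrder a = ((a χ - a (!χ)) + (a (!χ) - a χ)) / 2 := by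
  cases χ
  · simp only [gaugeOrder, Bool.not_false, add_comm]
  · rfl

/-- With no `Y` left, all of `ω` is contracted with `C`, so each degree of `C` exceeds that of `ω`
by `s`. The summand `1 - s true` is the explicit `D(p, p̄)` in front of `Υ_{0,0}`. -/
theorem count_star_scalar {N N' : ℕ} {s a b : Bool → ℕ} (hs : s = 0 ∨ s = 1)
    (h : StarRel s 1 2 ![0, a, b]) (ha : GaugeDeg N a) (hb : WeylDeg N' b) :
    gaugeOrder a + weylOrder N' b + (1 - s true) ∈ table0WC 0 N N' N' := by
  have hst : s false = s true ∧ s true ≤ 1 := by rcases hs with rfl | rfl <;> simp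
  obtain ⟨h1, h2, h3, -⟩ := h true
  obtain ⟨h1', h2', h3', -⟩ := h false
  simp only [GaugeDeg, WeylDeg, gaugeOrder, weylOrder, Matrix.cons_val, Pi.zero_apply] at *
  rw [mem_table0WC_iff]
  have e1 : b true = a true + s true := by omega
  have e2 : b false = a false + s true := by omega
  rw [e1, e2] at hb ⊢
  right
  clear h1 h2 h3 h1' h2' h3' h hs
  rcases hb with hb | hb
  · refine ⟨Or.inl rfl, Or.inl (by omega), ?_⟩
    rw [min_eq_right (by omega), show a true = N' + a false by omega]
    omega
  · refine ⟨Or.inl rfl, Or.inl (by omega), ?_⟩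
    rw [min_eq_left (by omega), show a false = N' + a true by omega]
    omega

theorem count_star_spinor {N N' : ℕ} {χ : Bool} {a b : Bool → ℕ}
    (h : StarRel (pair χ 0 1) 1 2 ![0, a, b]) (ha : GaugeDeg N a) (hb : WeylDeg N' b) :
    gaugeOrder a + weylOrder N' b ∈ table0WC 1 N N' N' := by
  obtain ⟨h1, h2, h3, -⟩ := h χ
  obtain ⟨h1', h2', h3', -⟩ := h (!χ)
  have hb := weylDeg_cases hb χ
  have ha' : a true + a false + 2 = N := ha
  rw [add_not _ χ] at ha'
  rw [gaugeOrder_eq a χ, weylOrder_eq_min N' b χ, mem_table0WC_iff]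
  simp only [pair, Matrix.cons_val, Pi.zero_apply, Bool.not_eq_self, if_true, if_false] at *
  have e1 : b χ = a χ := by omega
  have e2 : b (!χ) = a (!χ) + 1 := by omega
  rw [e1, e2] at hb ⊢
  clear h1 h2 h3 h1' h2' h3' h ha e1 e2
  generalize a χ = x at *
  generalize a (!χ) = y at *
  rcases hb with hb | hb
  · right
    refine ⟨by simp, Or.inl (by omega), ?_⟩
    rw [min_eq_right (by omega)]
    omega
  · rcases Nat.eq_zero_or_pos N' with rfl | hN
    · right
      refine ⟨by simp, Or.inl (by omega), ?_⟩
      rw [min_eq_left (by omega)]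
      omega
    · left
      refine ⟨by simp, by omega, Or.inl ?_⟩
      rw [min_eq_left (show x ≤ y + 1 by omega), min_eq_left (show 1 ≤ min N N' by omega)]
      omega

/-- The remaining variable of chirality `!χ` pairs with `C` or with `ω`, so by parity `b (!χ)` is `a
(!χ) + 2` or `a (!χ)`. The second possibility always gives `𝒮 - 2`, which is exceptional only when
`C` has spin below one. -/
theorem count_star_vector {N N' : ℕ} {χ : Bool} {a b : Bool → ℕ}
    (h : StarRel (pair χ 0 1) 1 2 ![pair χ 0 1, a, b]) (ha : GaugeDeg N a) (hb : WeylDeg N' b) :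
    gaugeOrder a + weylOrder N' b ∈ table0WC 2 N N' N' := by
  obtain ⟨h1, h2, h3, -⟩ := h χ
  obtain ⟨h1', h2', h3', h4'⟩ := h (!χ)
  have hb := weylDeg_cases hb χ
  have ha' : a true + a false + 2 = N := ha
  rw [add_not _ χ] at ha'
  rw [gaugeOrder_eq a χ, weylOrder_eq_min N' b χ, mem_table0WC_iff]
  simp only [pair, Matrix.cons_val, Bool.not_eq_self, if_true, if_false] at *
  have e1 : b χ = a χ := by omega
  have e2 : b (!χ) = a (!χ) + 2 ∨ (b (!χ) = a (!χ) ∧ 1 ≤ a (!χ)) := by omega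
  rw [e1] at hb ⊢
  clear h1 h2 h3 h1' h2' h3' h4' h ha e1
  generalize a χ = x at *
  generalize a (!χ) = y at *
  generalize b (!χ) = z at *
  obtain rfl | ⟨rfl, hy⟩ := e2
  · rcases hb with hb | hb
    · right
      refine ⟨by simp, Or.inl (by omega), ?_⟩
      rw [min_eq_right (by omega)]
      omega
    · rcases (by omega : N' = 0 ∨ N' = 1 ∨ 2 ≤ N') with rfl | rfl | hN
      · right
        refine ⟨by simp, Or.inl (by omega), ?_⟩
        rw [min_eq_left (by omega)]
        omega
      · left
        refine ⟨by simp, by omega, Or.inl ?_⟩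
        rw [min_eq_left (show x ≤ y + 2 by omega), min_eq_right (show 1 ≤ N by omega)]
        omega
      · left
        refine ⟨by simp, by omega, Or.inl ?_⟩
        rw [min_eq_left (show x ≤ y + 2 by omega), min_eq_left (show 2 ≤ min N N' by omega)]
        omega
  · left
    have key : (x - z + (z - x)) / 2 + (N' / 2 + min x z) + 2 = 2 / 2 + N / 2 + N' / 2 := by
      rcases hb with hb | hb
      · rw [min_eq_right (by omega)]
        omega
      · rw [min_eq_left (by omega)]
        omega
    refine ⟨by simp, by omega, ?_⟩
    rcases Nat.lt_or_ge N' 2 with hN | hN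
    · exact Or.inr ⟨trivial, hN, key⟩
    · left
      rw [min_eq_left (show 2 ≤ min N N' by omega)]
      exact key

theorem carries_starForm (bg : Background) (η z : ℂ) {N₁ N N' : ℕ} (Φ : FronsdalField A N)
    (Φ' : FronsdalField A N') (co : Coefficients) (o : Bool) :
    Carries (fun lam => currentZero bg η lam N₁
      (z • starForm o (Φ.omega bg lam co) (Φ'.weyl bg lam co))) (table0WC N₁ N N' N') := by
  refine carries_currentZero bg η N₁ ?_ ?_ ?_
  · rintro rfl
    simp only [(isLinearMap_oneForm_part_at _ _ _ _).map_smul]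
    refine (polyIn_starForm_pp Φ Φ' bg co o fun a b hR ha hb => ?_).smul z
    simpa using count_star_scalar (Or.inr rfl) hR ha hb
  · rintro rfl
    simp only [(isLinearMap_oneForm_part_at _ _ _ _).map_smul]
    refine (polyIn_starForm_yy Φ Φ' bg co o _ _ fun a b hR ha hb => ?_).smul z
    have : pair true 0 0 = (0 : Bool → ℕ) := by funext c; simp [pair]
    rw [this] at hR
    simpa using count_star_scalar (Or.inl rfl) hR ha hb
  · intro χ hN
    simp only [(isLinearMap_oneForm_part_at _ _ _ _).map_smul]
    have hl : lower (!χ) (pair χ 0 N₁) = pair χ 0 (N₁ - 1) := by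
      funext c
      cases c <;> cases χ <;> simp [lower, pair]
    refine (polyIn_starForm_yp Φ Φ' bg co o χ (by simp [pair]; omega) fun a b hR ha hb => ?_).smul z
    rw [hl] at hR
    rcases hN with rfl | rfl
    · have : pair χ 0 (1 - 1) = (0 : Bool → ℕ) := by funext c; simp [pair]
      rw [this] at hR
      exact count_star_spinor hR ha hb
    · exact count_star_vector hR ha hb

/-! ### Assembly -/

/-- A nonzero coefficient needs a compatible pair of monomials; summing its inequalities over the
chiralities, with total degrees `N - 2`, gives the claim. -/
theorem triangle_of_vertexWW_ne_zero {N₁ N₂ N₃ : ℕ} {w₂ w₃ : OneForm A} (h₂ : w₂.HasSpin N₂)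
    (h₃ : w₃.HasSpin N₃) (h : (vertexWW w₂ w₃).spinPart N₁ ≠ 0) :
    Triangle (spin N₁) (spin N₂) (spin N₃) := by
  by_contra hT
  refine h ?_
  funext χ a b μ
  simp only [TwoForm.spinPart]
  split_ifs with hμ
  swap
  · rfl
  have key : ∀ ι ι', starKernel.apply (w₂ ι) (w₃ ι') μ = 0 := by
    intro ι ι'
    refine finsum_eq_zero_of_forall_eq_zero fun p => ?_
    by_contra hp
    obtain ⟨hF, hf, hg⟩ := apply_term_ne_zero hp
    have hR := starKernel_support (Or.inl ⟨rfl, rfl⟩) hF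
    obtain ⟨h1, h2, h3, -⟩ := hR true
    obtain ⟨h1', h2', h3', -⟩ := hR false
    have hf' := h₂ ι _ hf
    have hg' := h₃ ι' _ hg
    simp only [Matrix.cons_val, bideg, Pi.zero_apply, add_zero] at h1 h2 h3 h1' h2' h3'
    refine hT (triangle_iff.2 ⟨?_, ?_, ?_⟩) <;> omega
  simp [vertexWW, wedge, key]

theorem graded_omega_hel {N : ℕ} (Φ : FronsdalField A N) (bg : Background) (co : Coefficients)
    (τ : Bool) (ι : Bool → Fin 2) :
    Graded (fun lam => (Φ.omega bg lam co).hel τ ι) gaugeOrder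
      fun a => GaugeDeg N a ∧ a (!τ) ≤ a τ :=
  (graded_omega Φ bg co ι).hel τ

theorem carries_hel {N₁ N₂ N₃ : ℕ} (bg : Background) (η : ℂ) (co : Coefficients)
    (Φ₂ : FronsdalField A N₂) (Φ₃ : FronsdalField A N₃) (τ₂ τ₃ : Bool) :
    Carries (fun lam => currentOne bg lam N₁
      (vertexWW ((Φ₂.omega bg lam co).hel τ₂) ((Φ₃.omega bg lam co).hel τ₃)))
      (tableWW N₁ N₂ N₃ τ₂ τ₃) ∧
    Carries (fun lam => currentOne bg lam N₁
      (vertexWC η ((Φ₂.omega bg lam co).hel τ₂) (helPart τ₃ (Φ₃.weyl bg lam co))))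
      (tableWC N₁ N₂ N₃ τ₂ τ₃) ∧
    Carries (fun lam => currentOne bg lam N₁
      (vertexCW η (helPart τ₂ (Φ₂.weyl bg lam co)) ((Φ₃.omega bg lam co).hel τ₃)))
      (tableWC N₁ N₂ N₃ τ₂ τ₃) ∧
    Carries (fun lam => currentOne bg lam N₁
      (vertexCC η (helPart τ₂ (Φ₂.weyl bg lam co)) (helPart τ₃ (Φ₃.weyl bg lam co))))
      (tableCC N₁ N₂ N₃ τ₂ τ₃) := by
  refine ⟨?_, ?_, ?_, ?_⟩
  · exact carries_currentOne_of_part bg N₁ fun m h1 h2 h3 =>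
      polyIn_vertexWW (graded_omega_hel Φ₂ bg co τ₂) (graded_omega_hel Φ₃ bg co τ₃)
        (fun _ h => h.1) (fun _ h => h.1) fun a b hR ha hb =>
          count_vertexWW ⟨h1, h2, h3⟩ hR ha.1 hb.1 ha.2 hb.2
  · exact carries_currentOne_of_part bg N₁ fun m h1 h2 h3 =>
      polyIn_vertexWC η (graded_omega_hel Φ₂ bg co τ₂) ((graded_weyl Φ₃ bg co).hel τ₃)
        (fun _ h => h.1) (fun _ h => h.1) fun χ a b hR ha hb =>
          count_vertexWC ⟨h1, h2, h3⟩ hR ha.1 hb.1 ha.2 hb.2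
  · rw [tableWC_symm]
    exact carries_currentOne_of_part bg N₁ fun m h1 h2 h3 =>
      polyIn_vertexCW η (graded_omega_hel Φ₃ bg co τ₃) ((graded_weyl Φ₂ bg co).hel τ₂)
        (fun _ h => h.1) (fun _ h => h.1) fun χ a b hR ha hb =>
          count_vertexWC ⟨h1, h2, h3⟩ hR ha.1 hb.1 ha.2 hb.2
  · exact carries_vertexCC bg η ((graded_weyl Φ₂ bg co).hel τ₂) ((graded_weyl Φ₃ bg co).hel τ₃)
      (fun _ h => h.1) (fun _ h => h.1) fun χ m a b hm hχ hR ha hb =>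
        count_vertexCC hm hχ hR ha.1 hb.1 ha.2 hb.2

/-- Every bidegree has at least one sign of helicity, so each term lies in one of the tables. -/
theorem polyIn_omega_omega {N₁ N₂ N₃ : ℕ} (bg : Background) (co : Coefficients)
    (Φ₂ : FronsdalField A N₂) (Φ₃ : FronsdalField A N₃) {m : Bool → ℕ} (hm : CurrentDeg N₁ m) :
    PolyIn (fun lam => (vertexWW (Φ₂.omega bg lam co) (Φ₃.omega bg lam co)).part m)
      {k | k + diagOrder m ∈ ⋃ (τ₂ : Bool) (τ₃ : Bool), tableWW N₁ N₂ N₃ τ₂ τ₃} := by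
  refine polyIn_vertexWW (graded_omega Φ₂ bg co) (graded_omega Φ₃ bg co)
    (fun _ h => h) (fun _ h => h) fun a b hR ha hb => ?_
  obtain ⟨τ₂, h₂⟩ := exists_helicity a
  obtain ⟨τ₃, h₃⟩ := exists_helicity b
  exact Set.mem_iUnion₂.2 ⟨τ₂, τ₃, count_vertexWW hm hR ha hb h₂ h₃⟩

theorem polyIn_omega_weyl {N₁ N₂ N₃ : ℕ} (bg : Background) (η : ℂ) (co : Coefficients)
    (Φ₂ : FronsdalField A N₂) (Φ₃ : FronsdalField A N₃) {m : Bool → ℕ} (hm : CurrentDeg N₁ m) :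
    PolyIn (fun lam => (vertexWC η (Φ₂.omega bg lam co) (Φ₃.weyl bg lam co) +
        vertexCW η (Φ₂.weyl bg lam co) (Φ₃.omega bg lam co)).part m)
      {k | k + diagOrder m ∈ ⋃ (τ₂ : Bool) (τ₃ : Bool), tableWC N₁ N₂ N₃ τ₂ τ₃} := by
  refine PolyIn.twoForm_part_add ?_ ?_
  · refine polyIn_vertexWC η (graded_omega Φ₂ bg co) (graded_weyl Φ₃ bg co)
      (fun _ h => h) (fun _ h => h) fun χ a b hR ha hb => ?_
    obtain ⟨τ₂, h₂⟩ := exists_helicity a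
    obtain ⟨τ₃, h₃⟩ := exists_helicity b
    exact Set.mem_iUnion₂.2 ⟨τ₂, τ₃, count_vertexWC hm hR ha hb h₂ h₃⟩
  · refine polyIn_vertexCW η (graded_omega Φ₃ bg co) (graded_weyl Φ₂ bg co)
      (fun _ h => h) (fun _ h => h) fun χ a b hR ha hb => ?_
    obtain ⟨τ₃, h₃⟩ := exists_helicity a
    obtain ⟨τ₂, h₂⟩ := exists_helicity b
    refine Set.mem_iUnion₂.2 ⟨τ₂, τ₃, ?_⟩
    rw [tableWC_symm]
    exact count_vertexWC hm hR ha hb h₃ h₂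

theorem carries_weyl_weyl {N₁ N₂ N₃ : ℕ} (bg : Background) (η : ℂ) (co : Coefficients)
    (Φ₂ : FronsdalField A N₂) (Φ₃ : FronsdalField A N₃) :
    Carries (fun lam => currentOne bg lam N₁
      (vertexCC η (Φ₂.weyl bg lam co) (Φ₃.weyl bg lam co)))
      (⋃ (τ₂ : Bool) (τ₃ : Bool), tableCC N₁ N₂ N₃ τ₂ τ₃) := by
  refine carries_vertexCC bg η (graded_weyl Φ₂ bg co) (graded_weyl Φ₃ bg co)
    (fun _ h => h) (fun _ h => h) fun χ m a b hm hχ hR ha hb => ?_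
  obtain ⟨τ₂, h₂⟩ := exists_helicity a
  obtain ⟨τ₃, h₃⟩ := exists_helicity b
  exact Set.mem_iUnion₂.2 ⟨τ₂, τ₃, count_vertexCC hm hχ hR ha hb h₂ h₃⟩

theorem tableWW_le {N₁ N₂ N₃ k : ℕ} {τ₂ τ₃ : Bool} (h : k ∈ tableWW N₁ N₂ N₃ τ₂ τ₃) :
    (k : ℚ) ≤ sumS N₁ N₂ N₃ - 2 * min (spin N₁) (min (spin N₂) (spin N₃)) := by
  rw [mem_tableWW_iff] at h
  rw [min_spin, min_spin, two_mul_spin, le_sumS_sub_iff]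
  obtain ⟨-, h⟩ := h
  generalize N₁ / 2 + N₂ / 2 + N₃ / 2 = s at *
  split_ifs at h <;> omega

theorem tableWC_le {N₁ N₂ N₃ k : ℕ} {τ₂ τ₃ : Bool}
    (hT : Triangle (spin N₁) (spin N₂) (spin N₃)) (h : k ∈ tableWC N₁ N₂ N₃ τ₂ τ₃) :
    (k : ℚ) ≤ sumS N₁ N₂ N₃ - 2 * min (spin N₁) (min (spin N₂) (spin N₃)) := by
  rw [mem_tableWC_iff] at h
  rw [triangle_iff] at hT
  rw [min_spin, min_spin, two_mul_spin, le_sumS_sub_iff]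
  obtain ⟨-, h⟩ | ⟨h, -⟩ | ⟨h, -⟩ | ⟨h, -⟩ | ⟨h, -⟩ := h
  · exact h
  all_goals omega

theorem tableCC_eq {N₁ N₂ N₃ k : ℕ} {τ₂ τ₃ : Bool}
    (hT : Triangle (spin N₁) (spin N₂) (spin N₃)) (h : k ∈ tableCC N₁ N₂ N₃ τ₂ τ₃) :
    (k : ℚ) = sumS N₁ N₂ N₃ := by
  rw [mem_tableCC_iff] at h
  rw [triangle_iff] at hT
  rw [eq_sumS_iff]
  obtain ⟨-, -, h⟩ | ⟨-, h, -⟩ := h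
  · exact h
  · omega

theorem vertex0WC_eq (w : OneForm A) (C : Gen A) :
    vertex0WC w C = (-1 : ℂ) • starForm true w C := by
  funext ι
  exact (neg_one_smul ℂ (starKernel.apply (w ι) C)).symm

theorem vertex0CW_eq (w : OneForm A) (C : Gen A) : vertex0CW C w = (1 : ℂ) • starForm false w C :=
  (one_smul ℂ (starForm false w C)).symm

end

end HigherSpin

/-- `s_i = N_i / 2`; the factors of a vertex have spins `s₂`, `s₃` in this order. -/
theorem mainTheorem4 {A : Type*} [NormedRing A] [NormedAlgebra ℂ A] (bg : Background) (η : ℂ)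
    (co : Coefficients) (N₁ N₂ N₃ : ℕ) (Φ₂ : FronsdalField A N₂) (Φ₃ : FronsdalField A N₃) :
    -- `Υ(ω, ω)` is nonzero only if the triangle inequalities hold
    (∀ w₂ w₃ : OneForm A, w₂.HasSpin N₂ → w₃.HasSpin N₃ →
      (vertexWW w₂ w₃).spinPart N₁ ≠ 0 → Triangle (spin N₁) (spin N₂) (spin N₃)) ∧
    -- one-form sector, definite signs of the helicities of the two factors
    (∀ τ₂ τ₃ : Bool,
      Carries (fun lam => currentOne bg lam N₁
        (vertexWW ((Φ₂.omega bg lam co).hel τ₂) ((Φ₃.omega bg lam co).hel τ₃)))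
        (tableWW N₁ N₂ N₃ τ₂ τ₃) ∧
      Carries (fun lam => currentOne bg lam N₁
        (vertexWC η ((Φ₂.omega bg lam co).hel τ₂) (helPart τ₃ (Φ₃.weyl bg lam co))))
        (tableWC N₁ N₂ N₃ τ₂ τ₃) ∧
      Carries (fun lam => currentOne bg lam N₁
        (vertexCW η (helPart τ₂ (Φ₂.weyl bg lam co)) ((Φ₃.omega bg lam co).hel τ₃)))
        (tableWC N₁ N₂ N₃ τ₂ τ₃) ∧
      Carries (fun lam => currentOne bg lam N₁
        (vertexCC η (helPart τ₂ (Φ₂.weyl bg lam co)) (helPart τ₃ (Φ₃.weyl bg lam co))))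
        (tableCC N₁ N₂ N₃ τ₂ τ₃)) ∧
    -- one-form sector, complete currents
    Carries (fun lam => currentOne bg lam N₁
      (vertexWW (Φ₂.omega bg lam co) (Φ₃.omega bg lam co)))
      (⋃ (τ₂ : Bool) (τ₃ : Bool), tableWW N₁ N₂ N₃ τ₂ τ₃) ∧
    Carries (fun lam => currentOne bg lam N₁
      (vertexWC η (Φ₂.omega bg lam co) (Φ₃.weyl bg lam co) +
        vertexCW η (Φ₂.weyl bg lam co) (Φ₃.omega bg lam co)))
      (⋃ (τ₂ : Bool) (τ₃ : Bool), tableWC N₁ N₂ N₃ τ₂ τ₃) ∧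
    Carries (fun lam => currentOne bg lam N₁
      (vertexCC η (Φ₂.weyl bg lam co) (Φ₃.weyl bg lam co)))
      (⋃ (τ₂ : Bool) (τ₃ : Bool), tableCC N₁ N₂ N₃ τ₂ τ₃) ∧
    -- the two currents under the triangle inequalities
    (Triangle (spin N₁) (spin N₂) (spin N₃) →
      Carries (fun lam => currentOne bg lam N₁
        (vertexWW (Φ₂.omega bg lam co) (Φ₃.omega bg lam co) +
          (vertexWC η (Φ₂.omega bg lam co) (Φ₃.weyl bg lam co) +
            vertexCW η (Φ₂.weyl bg lam co) (Φ₃.omega bg lam co))))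
        {k | (k : ℚ) ≤ sumS N₁ N₂ N₃ - 2 * min (spin N₁) (min (spin N₂) (spin N₃))} ∧
      Carries (fun lam => currentOne bg lam N₁
        (vertexCC η (Φ₂.weyl bg lam co) (Φ₃.weyl bg lam co)))
        {k | (k : ℚ) = sumS N₁ N₂ N₃}) ∧
    -- zero-form sector
    Carries (fun lam => currentZero bg η lam N₁
      (vertex0WC (Φ₂.omega bg lam co) (Φ₃.weyl bg lam co)))
      (table0WC N₁ N₂ N₃ N₃) ∧
    Carries (fun lam => currentZero bg η lam N₁
      (vertex0CW (Φ₂.weyl bg lam co) (Φ₃.omega bg lam co)))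
      (table0WC N₁ N₂ N₃ N₂) ∧
    Carries (fun lam => currentZero bg η lam N₁
      (vertex0CC η (Φ₂.weyl bg lam co) (Φ₃.weyl bg lam co)))
      (table0CC N₁ N₂ N₃) := by
  have hWW : Carries (fun lam => currentOne bg lam N₁
      (vertexWW (Φ₂.omega bg lam co) (Φ₃.omega bg lam co)))
      (⋃ (τ₂ : Bool) (τ₃ : Bool), tableWW N₁ N₂ N₃ τ₂ τ₃) :=
    carries_currentOne_of_part bg N₁ fun m h1 h2 h3 =>
      polyIn_omega_omega bg co Φ₂ Φ₃ ⟨h1, h2, h3⟩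
  have hWC : Carries (fun lam => currentOne bg lam N₁
      (vertexWC η (Φ₂.omega bg lam co) (Φ₃.weyl bg lam co) +
        vertexCW η (Φ₂.weyl bg lam co) (Φ₃.omega bg lam co)))
      (⋃ (τ₂ : Bool) (τ₃ : Bool), tableWC N₁ N₂ N₃ τ₂ τ₃) :=
    carries_currentOne_of_part bg N₁ fun m h1 h2 h3 =>
      polyIn_omega_weyl bg η co Φ₂ Φ₃ ⟨h1, h2, h3⟩
  refine ⟨fun w₂ w₃ h₂ h₃ h => triangle_of_vertexWW_ne_zero h₂ h₃ h,
    fun τ₂ τ₃ => carries_hel bg η co Φ₂ Φ₃ τ₂ τ₃, hWW, hWC, carries_weyl_weyl bg η co Φ₂ Φ₃,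
    fun hT => ⟨?_, ?_⟩, ?_, ?_,
    carries_vertex0CC bg η (graded_weyl Φ₂ bg co) (graded_weyl Φ₃ bg co)⟩
  -- The vertices are added as bidegree components, before the projection to the current.
  · refine carries_currentOne_of_part bg N₁ fun m h1 h2 h3 => PolyIn.twoForm_part_add
      ((polyIn_omega_omega bg co Φ₂ Φ₃ ⟨h1, h2, h3⟩).mono fun k hk => ?_)
      ((polyIn_omega_weyl bg η co Φ₂ Φ₃ ⟨h1, h2, h3⟩).mono fun k hk => ?_)
    · obtain ⟨τ₂, τ₃, hk⟩ := Set.mem_iUnion₂.1 hk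
      exact tableWW_le hk
    · obtain ⟨τ₂, τ₃, hk⟩ := Set.mem_iUnion₂.1 hk
      exact tableWC_le hT hk
  · refine PolyIn.mono (carries_weyl_weyl bg η co Φ₂ Φ₃) fun k hk => ?_
    obtain ⟨τ₂, τ₃, hk⟩ := Set.mem_iUnion₂.1 hk
    exact tableCC_eq hT hk
  · simp only [vertex0WC_eq]
    exact carries_starForm bg η (-1) Φ₂ Φ₃ co true
  · simp only [vertex0CW_eq]
    rw [table0WC_symm]
    exact carries_starForm bg η 1 Φ₃ Φ₂ co false
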